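/- **Theorem (equivalence of the categories $\mathbb{CLG}_{\mathbb K}$ and $\mathbb{CLA}_{\mathbb K}$).** Let $({\mathbb K},|.|)$ be a complete ultrametric field of characteristic $0$, i.e. a field of characteristic $0$ with a non-trivial ultrametric absolute value for which it is complete. All Lie groups and Lie algebras are finite-dimensional. Let $\mathbb{CLG}_{\mathbb K}$ be the category whose objects are pairs $(G,\alpha)$, where $G$ is a ${\mathbb K}$-analytic Lie group and $\alpha\colon G\to G$ is an analytic automorphism (with analytic inverse) which is contractive, i.e. $\alpha^n(x)\to 1$ as $n\to\infty$ for each $x\in G$. A morphism $(G_1,\alpha_1)\to(G_2,\alpha_2)$ is an analytic group homomorphism $f\colon G_1\to G_2$ such that $\alpha_2\circ f=f\circ\alpha_1$. Let $\mathbb{CLA}_{\mathbb K}$ be the category whose objects are pairs $({\mathfrak g},\beta)$, where ${\mathfrak g}$ is a Lie algebra over ${\mathbb K}$ and $\beta\colon{\mathfrak g}\to{\mathfrak g}$ is a Lie algebra automorphism which is contractive, i.e. $\beta^n(x)\to 0$ as $n\to\infty$ for each $x\in{\mathfrak g}$, with respect to the unique Hausdorff vector space topology on ${\mathfrak g}$.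 A morphism $({\mathfrak g}_1,\beta_1)\to({\mathfrak g}_2,\beta_2)$ is a Lie algebra homomorphism $f\colon {\mathfrak g}_1\to{\mathfrak g}_2$ such that $\beta_2\circ f=f\circ\beta_1$. For an analytic Lie group $G$, let $L(G)=T_1(G)$ be its Lie algebra, with the Lie bracket of left-invariant vector fields, and for an analytic homomorphism $f$ let $L(f)=T_1(f)$. Then, for each object $(G,\alpha)$ of $\mathbb{CLG}_{\mathbb K}$, the Lie algebra automorphism $L(\alpha)$ is contractive, and the functor $$P\colon \mathbb{CLG}_{\mathbb K}\to\mathbb{CLA}_{\mathbb K},\qquad P(G,\alpha)=(L(G),L(\alpha)),\quad P(f)=L(f),$$ is an equivalence of categories. In particular, $\mathbb{CLG}_{\mathbb K}$ and $\mathbb{CLA}_{\mathbb K}$ are equivalent. -/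

import Mathlib

open scoped Manifold ContDiff Topology

universe u

section RelatedFields

open VectorField Set Filter

/-- Vector fields related by an analytic map have related Lie brackets. -/
theorem mfderiv_mlieBracket_of_related {K : Type*} [NontriviallyNormedField K]
    {E E' : Type*} [NormedAddCommGroup E] [NormedSpace K E] [CompleteSpace E]
    [NormedAddCommGroup E'] [NormedSpace K E'] [CompleteSpace E']
    {M M' : Type*} [TopologicalSpace M] [ChartedSpace E M] [IsManifold 𝓘(K, E) ω M]
    [TopologicalSpace M'] [ChartedSpace E' M'] [IsManifold 𝓘(K, E') ω M']
    {f : M → M'} (hf : ContMDiff 𝓘(K, E) 𝓘(K, E') ω f)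
    {V W : Π x : M, TangentSpace 𝓘(K, E) x} {V' W' : Π x : M', TangentSpace 𝓘(K, E') x}
    (hVV : ∀ x, mfderiv 𝓘(K, E) 𝓘(K, E') f x (V x) = V' (f x))
    (hWW : ∀ x, mfderiv 𝓘(K, E) 𝓘(K, E') f x (W x) = W' (f x)) (x₀ : M)
    (hV : MDifferentiableAt 𝓘(K, E) 𝓘(K, E).tangent
      (fun x ↦ (V x : TangentBundle 𝓘(K, E) M)) x₀)
    (hW : MDifferentiableAt 𝓘(K, E) 𝓘(K, E).tangent
      (fun x ↦ (W x : TangentBundle 𝓘(K, E) M)) x₀)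
    (hV' : MDifferentiableAt 𝓘(K, E') 𝓘(K, E').tangent
      (fun x ↦ (V' x : TangentBundle 𝓘(K, E') M')) (f x₀))
    (hW' : MDifferentiableAt 𝓘(K, E') 𝓘(K, E').tangent
      (fun x ↦ (W' x : TangentBundle 𝓘(K, E') M')) (f x₀)) :
    mfderiv 𝓘(K, E) 𝓘(K, E') f x₀ (mlieBracket 𝓘(K, E) V W x₀) =
      mlieBracket 𝓘(K, E') V' W' (f x₀) := by
  have : IsManifold 𝓘(K, E) 2 M := IsManifold.of_le (n := ω) le_top
  have : IsManifold 𝓘(K, E') 2 M' := IsManifold.of_le (n := ω) le_top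
  have : IsManifold 𝓘(K, E) 1 M := IsManifold.of_le (n := ω) le_top
  have : IsManifold 𝓘(K, E') 1 M' := IsManifold.of_le (n := ω) le_top
  set φ := extChartAt 𝓘(K, E) x₀ with hφ
  set ψ := extChartAt 𝓘(K, E') (f x₀) with hψ
  -- the local representatives of the vector fields and of `f`
  set rV : E → E := mpullbackWithin 𝓘(K, E) 𝓘(K, E) φ.symm V univ with hrV
  set rW : E → E := mpullbackWithin 𝓘(K, E) 𝓘(K, E) φ.symm W univ with hrW
  set rV' : E' → E' := mpullbackWithin 𝓘(K, E') 𝓘(K, E') ψ.symm V' univ with hrV'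
  set rW' : E' → E' := mpullbackWithin 𝓘(K, E') 𝓘(K, E') ψ.symm W' univ with hrW'
  set F : E → E' := ψ ∘ f ∘ φ.symm with hF
  have hx : φ.symm (φ x₀) = x₀ := extChartAt_to_inv x₀
  have hFx : F (φ x₀) = ψ (f x₀) := by simp only [hF, Function.comp, hx]
  have dV : DifferentiableAt K rV (φ x₀) := by
    have := MDifferentiableWithinAt.differentiableWithinAt_mpullbackWithin_vectorField
      (I := 𝓘(K, E)) (s := univ) hV.mdifferentiableWithinAt
    simp only [modelWithCornersSelf_coe, range_id, preimage_univ, inter_univ] at this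
    exact differentiableWithinAt_univ.1 this
  have dW : DifferentiableAt K rW (φ x₀) := by
    have := MDifferentiableWithinAt.differentiableWithinAt_mpullbackWithin_vectorField
      (I := 𝓘(K, E)) (s := univ) hW.mdifferentiableWithinAt
    simp only [modelWithCornersSelf_coe, range_id, preimage_univ, inter_univ] at this
    exact differentiableWithinAt_univ.1 this
  have dV' : DifferentiableAt K rV' (F (φ x₀)) := by
    have := MDifferentiableWithinAt.differentiableWithinAt_mpullbackWithin_vectorField
      (I := 𝓘(K, E')) (s := univ) hV'.mdifferentiableWithinAt
    rw [hFx]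
    simp only [modelWithCornersSelf_coe, range_id, preimage_univ, inter_univ] at this
    exact differentiableWithinAt_univ.1 this
  have dW' : DifferentiableAt K rW' (F (φ x₀)) := by
    have := MDifferentiableWithinAt.differentiableWithinAt_mpullbackWithin_vectorField
      (I := 𝓘(K, E')) (s := univ) hW'.mdifferentiableWithinAt
    rw [hFx]
    simp only [modelWithCornersSelf_coe, range_id, preimage_univ, inter_univ] at this
    exact differentiableWithinAt_univ.1 this
  have cF : ContDiffAt K ω F (φ x₀) := by
    have := (contMDiffAt_iff.1 (hf x₀)).2
    simpa only [modelWithCornersSelf_coe, range_id, contDiffWithinAt_univ] using this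
  have dF : DifferentiableAt K F (φ x₀) := cF.differentiableAt (by simp)
  -- near the base point the local representatives are related by `F`
  have near : ∀ᶠ y in 𝓝 (φ x₀), y ∈ φ.target ∧ f (φ.symm y) ∈ ψ.source := by
    refine (show ∀ᶠ y in 𝓝 (φ x₀), y ∈ φ.target from extChartAt_target_mem_nhds x₀).and ?_
    have h1 : ContinuousAt (f ∘ φ.symm) (φ x₀) :=
      ContinuousAt.comp (by rw [hx]; exact hf.continuous.continuousAt)
        (continuousAt_extChartAt_symm x₀)
    refine h1.preimage_mem_nhds ?_
    simp only [Function.comp, hx]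
    exact extChartAt_source_mem_nhds (f x₀)
  have key : ∀ (U : Π x : M, TangentSpace 𝓘(K, E) x) (U' : Π x : M', TangentSpace 𝓘(K, E') x),
      (∀ x, mfderiv 𝓘(K, E) 𝓘(K, E') f x (U x) = U' (f x)) → ∀ y, y ∈ φ.target →
      f (φ.symm y) ∈ ψ.source →
      fderiv K F y (mpullbackWithin 𝓘(K, E) 𝓘(K, E) φ.symm U univ y : E) =
        (mpullbackWithin 𝓘(K, E') 𝓘(K, E') ψ.symm U' univ (F y) : E') := by
    intro U U' hU y hy hy'
    have i1 : (mfderivWithin 𝓘(K, E) 𝓘(K, E) φ.symm univ y).IsInvertible := by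
      have := isInvertible_mfderivWithin_extChartAt_symm (I := 𝓘(K, E)) hy
      simpa only [modelWithCornersSelf_coe, range_id] using this
    have i2 : (mfderiv 𝓘(K, E') 𝓘(K, E') ψ (f (φ.symm y))).IsInvertible :=
      isInvertible_mfderiv_extChartAt hy'
    have e1 : mfderivWithin 𝓘(K, E) 𝓘(K, E) φ.symm univ y
        (mpullbackWithin 𝓘(K, E) 𝓘(K, E) φ.symm U univ y) = U (φ.symm y) := by
      rw [mpullbackWithin_apply]
      exact i1.self_apply_inverse _
    have e2 : ψ.symm (F y) = f (φ.symm y) := ψ.left_inv hy'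
    have e3 : (mfderivWithin 𝓘(K, E') 𝓘(K, E') ψ.symm univ (ψ (f (φ.symm y)))).comp
        (mfderiv 𝓘(K, E') 𝓘(K, E') ψ (f (φ.symm y))) = ContinuousLinearMap.id _ _ := by
      have := mfderivWithin_extChartAt_symm_comp_mfderiv_extChartAt' (I := 𝓘(K, E')) hy'
      simpa only [modelWithCornersSelf_coe, range_id] using this
    have i3 : (mfderivWithin 𝓘(K, E') 𝓘(K, E') ψ.symm univ (F y)).IsInvertible := by
      have := isInvertible_mfderivWithin_extChartAt_symm (I := 𝓘(K, E')) (ψ.map_source hy')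
      simp only [modelWithCornersSelf_coe, range_id] at this
      exact this
    have e4 : mfderivWithin 𝓘(K, E') 𝓘(K, E') ψ.symm univ (F y)
        (mfderiv 𝓘(K, E') 𝓘(K, E') ψ (f (φ.symm y)) (U' (f (φ.symm y))) : E') =
        (U' (ψ.symm (F y)) : E') := by
      have h5 : (U' (ψ.symm (F y)) : E') = (U' (f (φ.symm y)) : E') := by rw [e2]
      rw [h5]
      exact DFunLike.congr_fun e3 (U' (f (φ.symm y)))
    have e5 : fderiv K F y = (mfderiv 𝓘(K, E') 𝓘(K, E') ψ (f (φ.symm y))).comp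
        ((mfderiv 𝓘(K, E) 𝓘(K, E') f (φ.symm y)).comp
          (mfderivWithin 𝓘(K, E) 𝓘(K, E) φ.symm univ y)) := by
      rw [← mfderiv_eq_fderiv, mfderivWithin_univ]
      have m1 : MDifferentiableAt 𝓘(K, E) 𝓘(K, E) φ.symm y := by
        have := mdifferentiableWithinAt_extChartAt_symm (I := 𝓘(K, E)) hy
        simpa only [modelWithCornersSelf_coe, range_id, mdifferentiableWithinAt_univ] using this
      have m2 : MDifferentiableAt 𝓘(K, E) 𝓘(K, E') f (φ.symm y) :=
        (hf _).mdifferentiableAt (by simp)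
      have m3 : MDifferentiableAt 𝓘(K, E') 𝓘(K, E') ψ (f (φ.symm y)) :=
        mdifferentiableAt_extChartAt (by simpa only [hψ, extChartAt_source] using hy')
      rw [hF, mfderiv_comp y m3 (m2.comp y m1), mfderiv_comp y m2 m1]
      rfl
    rw [e5]
    refine Eq.trans ?_ ((i3.inverse_apply_eq).2 e4.symm).symm
    rw [← hU, ← e1]
    rfl
  have kV : (fun y ↦ fderiv K F y (rV y)) =ᶠ[𝓝 (φ x₀)] rV' ∘ F :=
    near.mono fun y hy ↦ key V V' hVV y hy.1 hy.2
  have kW : (fun y ↦ fderiv K F y (rW y)) =ᶠ[𝓝 (φ x₀)] rW' ∘ F :=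
    near.mono fun y hy ↦ key W W' hWW y hy.1 hy.2
  have bra : fderiv K F (φ x₀) (lieBracket K rV rW (φ x₀)) = lieBracket K rV' rW' (F (φ x₀)) := by
    rw [fderiv_apply_lieBracket cF le_top dW dV, kV.fderiv_eq, kW.fderiv_eq,
      fderiv_comp _ dW' dF, fderiv_comp _ dV' dF, lieBracket_eq]
    have a1 := kV.self_of_nhds
    have a2 := kW.self_of_nhds
    simp only [Function.comp] at a1 a2
    simp only [ContinuousLinearMap.comp_apply, a1, a2]
  -- express the brackets and the derivative of `f` through the local representatives
  have j1 : (mfderiv 𝓘(K, E) 𝓘(K, E) φ x₀).IsInvertible :=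
    isInvertible_mfderiv_extChartAt (mem_extChartAt_source x₀)
  have j2 : (mfderiv 𝓘(K, E') 𝓘(K, E') ψ (f x₀)).IsInvertible :=
    isInvertible_mfderiv_extChartAt (mem_extChartAt_source (f x₀))
  have b1 : (mlieBracket 𝓘(K, E) V W x₀ : E) = (mfderiv 𝓘(K, E) 𝓘(K, E) φ x₀).inverse
      (lieBracket K rV rW (φ x₀) : E) := by
    rw [← mlieBracketWithin_univ, mlieBracketWithin_apply]
    simp only [modelWithCornersSelf_coe, range_id, preimage_univ, inter_univ]
    exact congrArg (mfderiv 𝓘(K, E) 𝓘(K, E) φ x₀).inverse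
      (congrFun (lieBracketWithin_univ (𝕜 := K) (V := rV) (W := rW)) (φ x₀))
  have b2 : (mlieBracket 𝓘(K, E') V' W' (f x₀) : E') =
      (mfderiv 𝓘(K, E') 𝓘(K, E') ψ (f x₀)).inverse (lieBracket K rV' rW' (ψ (f x₀)) : E') := by
    rw [← mlieBracketWithin_univ, mlieBracketWithin_apply]
    simp only [modelWithCornersSelf_coe, range_id, preimage_univ, inter_univ]
    exact congrArg (mfderiv 𝓘(K, E') 𝓘(K, E') ψ (f x₀)).inverse
      (congrFun (lieBracketWithin_univ (𝕜 := K) (V := rV') (W := rW')) (ψ (f x₀)))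
  have chain : (mfderiv 𝓘(K, E') 𝓘(K, E') ψ (f x₀)).comp (mfderiv 𝓘(K, E) 𝓘(K, E') f x₀) =
      (fderiv K F (φ x₀)).comp (mfderiv 𝓘(K, E) 𝓘(K, E) φ x₀) := by
    have m2 : MDifferentiableAt 𝓘(K, E) 𝓘(K, E') f x₀ := (hf _).mdifferentiableAt (by simp)
    have m3 : MDifferentiableAt 𝓘(K, E') 𝓘(K, E') ψ (f x₀) :=
      mdifferentiableAt_extChartAt (mem_chart_source E' (f x₀))
    have m4 : MDifferentiableAt 𝓘(K, E) 𝓘(K, E) φ x₀ :=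
      mdifferentiableAt_extChartAt (mem_chart_source E x₀)
    have eq : ψ ∘ f =ᶠ[𝓝 x₀] F ∘ φ := by
      have : ∀ᶠ x in 𝓝 x₀, x ∈ φ.source := extChartAt_source_mem_nhds x₀
      filter_upwards [this] with x hx
      simp only [hF, Function.comp, φ.left_inv hx]
    rw [← mfderiv_comp x₀ m3 m2, eq.mfderiv_eq, mfderiv_comp x₀ dF.mdifferentiableAt m4,
      mfderiv_eq_fderiv]
    rfl
  refine Eq.trans ?_ b2.symm
  have fin : (lieBracket K rV' rW' (ψ (f x₀)) : E') = mfderiv 𝓘(K, E') 𝓘(K, E') ψ (f x₀)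
      (mfderiv 𝓘(K, E) 𝓘(K, E') f x₀ (mlieBracket 𝓘(K, E) V W x₀)) := by
    rw [← hFx, ← bra]
    have c := DFunLike.congr_fun chain (mlieBracket 𝓘(K, E) V W x₀)
    refine Eq.trans ?_ c.symm
    have d : mfderiv 𝓘(K, E) 𝓘(K, E) φ x₀ (mlieBracket 𝓘(K, E) V W x₀) =
        (lieBracket K rV rW (φ x₀) : E) :=
      (congrArg _ b1).trans (j1.self_apply_inverse _)
    exact congrArg (fderiv K F (φ x₀)) d.symm
  exact ((j2.inverse_apply_eq).2 fin).symm

end RelatedFields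

section Derivative

variable {K : Type*} [NontriviallyNormedField K]
  {E E' E'' : Type*} [NormedAddCommGroup E] [NormedSpace K E]
  [NormedAddCommGroup E'] [NormedSpace K E'] [NormedAddCommGroup E''] [NormedSpace K E'']
  {G : Type*} [Group G] [TopologicalSpace G] [ChartedSpace E G]
  {H : Type*} [Group H] [TopologicalSpace H] [ChartedSpace E' H]
  {J : Type*} [Group J] [TopologicalSpace J] [ChartedSpace E'' J]

/-- The tangent map `T₁ f : T₁ G → T₁ H` of a homomorphism `f : G → H`. The tangent space at `f 1`
is the tangent space at `1`, because `f 1 = 1`. -/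
noncomputable def tangentMapOne (f : G →* H) :
    GroupLieAlgebra 𝓘(K, E) G →ₗ[K] GroupLieAlgebra 𝓘(K, E') H where
  toFun v := mfderiv 𝓘(K, E) 𝓘(K, E') f 1 v
  map_add' v w := (mfderiv 𝓘(K, E) 𝓘(K, E') f 1).map_add v w
  map_smul' c v := (mfderiv 𝓘(K, E) 𝓘(K, E') f 1).map_smul c v

theorem tangentMapOne_id :
    tangentMapOne (K := K) (E := E) (E' := E) (MonoidHom.id G) = LinearMap.id := by
  ext v
  change mfderiv 𝓘(K, E) 𝓘(K, E) id (1 : G) v = v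
  rw [mfderiv_id]
  rfl

theorem tangentMapOne_comp [LieGroup 𝓘(K, E) ω G] [LieGroup 𝓘(K, E') ω H]
    [LieGroup 𝓘(K, E'') ω J] {f : G →* H} {g : H →* J}
    (hf : ContMDiff 𝓘(K, E) 𝓘(K, E') ω f) (hg : ContMDiff 𝓘(K, E') 𝓘(K, E'') ω g) :
    tangentMapOne (K := K) (E := E) (E' := E'') (g.comp f) =
      (tangentMapOne (K := K) (E := E') (E' := E'') g).comp
        (tangentMapOne (K := K) (E := E) (E' := E') f) := by
  ext v
  change mfderiv 𝓘(K, E) 𝓘(K, E'') (g ∘ f) 1 v =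
    mfderiv 𝓘(K, E') 𝓘(K, E'') g 1 (mfderiv 𝓘(K, E) 𝓘(K, E') f 1 v : E')
  rw [mfderiv_comp 1 ((hg _).mdifferentiableAt (by simp)) ((hf _).mdifferentiableAt (by simp))]
  have : ∀ (y : H) (w : E'), y = 1 → (mfderiv 𝓘(K, E') 𝓘(K, E'') g y w : E'') =
      mfderiv 𝓘(K, E') 𝓘(K, E'') g 1 w := by
    rintro y w rfl
    rfl
  exact this (f 1) _ f.map_one

variable [LieGroup 𝓘(K, E) ω G] [LieGroup 𝓘(K, E') ω H]

theorem mfderiv_mulInvariantVectorField {f : G →* H} (hf : ContMDiff 𝓘(K, E) 𝓘(K, E') ω f)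
    (v : GroupLieAlgebra 𝓘(K, E) G) (x : G) :
    mfderiv 𝓘(K, E) 𝓘(K, E') f x (mulInvariantVectorField v x) =
      mulInvariantVectorField (tangentMapOne (K := K) (E := E) (E' := E') f v) (f x) := by
  have df : ∀ y : G, MDifferentiableAt 𝓘(K, E) 𝓘(K, E') f y :=
    fun y ↦ (hf y).mdifferentiableAt (by simp)
  have dG : MDifferentiableAt 𝓘(K, E) 𝓘(K, E) (x * ·) (1 : G) :=
    (contMDiff_mul_left (I := 𝓘(K, E)) (n := ω) (a := x) 1).mdifferentiableAt (by simp)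
  have dH : MDifferentiableAt 𝓘(K, E') 𝓘(K, E') (f x * ·) (f 1) :=
    (contMDiff_mul_left (I := 𝓘(K, E')) (n := ω) (a := f x) (f 1)).mdifferentiableAt (by simp)
  have comm : (f : G → H) ∘ (x * ·) = (f x * ·) ∘ f := by
    ext y
    simp
  have c1 := mfderiv_comp (1 : G) (df (x * 1)) dG
  have c2 := mfderiv_comp (1 : G) dH (df 1)
  have e1 : ∀ (y : G) (w : E), y = x → (mfderiv 𝓘(K, E) 𝓘(K, E') f y w : E') =
      mfderiv 𝓘(K, E) 𝓘(K, E') f x w := by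
    rintro y w rfl
    rfl
  have e2 : ∀ (y : H) (w : E'), y = 1 → (mfderiv 𝓘(K, E') 𝓘(K, E') (f x * ·) y w : E') =
      mfderiv 𝓘(K, E') 𝓘(K, E') (f x * ·) 1 w := by
    rintro y w rfl
    rfl
  have c3 : (mfderiv 𝓘(K, E) 𝓘(K, E') ((f : G → H) ∘ (x * ·)) 1 v : E') =
      mfderiv 𝓘(K, E) 𝓘(K, E') ((f x * ·) ∘ f) 1 v := by rw [comm]
  refine Eq.trans (e1 (x * 1) _ (mul_one x)).symm ?_
  refine Eq.trans (DFunLike.congr_fun c1 v).symm ?_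
  refine c3.trans ?_
  refine Eq.trans (DFunLike.congr_fun c2 v) ?_
  exact e2 (f 1) _ f.map_one

variable [CompleteSpace E] [CompleteSpace E']

/-- The Lie algebra homomorphism `L(f) : L(G) → L(H)` of an analytic homomorphism `f : G → H` of
analytic Lie groups: the tangent map at `1`. -/
noncomputable def lieMap (f : G →* H) (hf : ContMDiff 𝓘(K, E) 𝓘(K, E') ω f) :
    GroupLieAlgebra 𝓘(K, E) G →ₗ⁅K⁆ GroupLieAlgebra 𝓘(K, E') H :=
  { tangentMapOne (K := K) (E := E) (E' := E') f with
    map_lie' := by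
      intro v w
      have key := mfderiv_mlieBracket_of_related hf
        (mfderiv_mulInvariantVectorField hf v) (mfderiv_mulInvariantVectorField hf w) 1
        (mdifferentiableAt_mulInvariantVectorField v) (mdifferentiableAt_mulInvariantVectorField w)
        (mdifferentiableAt_mulInvariantVectorField _) (mdifferentiableAt_mulInvariantVectorField _)
      refine key.trans ?_
      have : ∀ y : H, y = 1 →
          (VectorField.mlieBracket 𝓘(K, E')
            (mulInvariantVectorField (tangentMapOne (K := K) (E := E) (E' := E') f v))
            (mulInvariantVectorField (tangentMapOne (K := K) (E := E) (E' := E') f w)) y : E') =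
          VectorField.mlieBracket 𝓘(K, E')
            (mulInvariantVectorField (tangentMapOne (K := K) (E := E) (E' := E') f v))
            (mulInvariantVectorField (tangentMapOne (K := K) (E := E) (E' := E') f w)) 1 := by
        rintro y rfl
        rfl
      exact this (f 1) f.map_one }

/-- The Lie algebra automorphism `L(α)` of an analytic automorphism `α` of an analytic Lie group. -/
noncomputable def lieAut (α : G ≃* G) (hα : ContMDiff 𝓘(K, E) 𝓘(K, E) ω α)
    (hα' : ContMDiff 𝓘(K, E) 𝓘(K, E) ω α.symm) :
    GroupLieAlgebra 𝓘(K, E) G ≃ₗ⁅K⁆ GroupLieAlgebra 𝓘(K, E) G :=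
  { lieMap α.toMonoidHom hα with
    invFun := lieMap α.symm.toMonoidHom hα'
    left_inv := by
      intro v
      have h := tangentMapOne_comp (f := α.toMonoidHom) (g := α.symm.toMonoidHom) hα hα'
      rw [show α.symm.toMonoidHom.comp α.toMonoidHom = MonoidHom.id G by ext; simp,
        tangentMapOne_id] at h
      exact (LinearMap.congr_fun h v).symm
    right_inv := by
      intro v
      have h := tangentMapOne_comp (f := α.symm.toMonoidHom) (g := α.toMonoidHom) hα' hα
      rw [show α.toMonoidHom.comp α.symm.toMonoidHom = MonoidHom.id G by ext; simp,
        tangentMapOne_id] at h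
      exact (LinearMap.congr_fun h v).symm }

end Derivative

section Categories

open CategoryTheory Filter

/-- An automorphism `α` of a topological group is contractive if `αⁿ(x) → 1` for every `x`. -/
def IsContractiveAut {G : Type*} [Group G] [TopologicalSpace G] (α : G ≃* G) : Prop :=
  ∀ x : G, Tendsto (fun n : ℕ ↦ (α : G → G)^[n] x) atTop (𝓝 1)

/-- An automorphism `β` of a Lie algebra over `K` is contractive if `βⁿ(x) → 0` for every `x`.
Convergence is with respect to the module topology, which for a finite-dimensional vector space over
a complete valued field is its unique Hausdorff vector topology. -/
def IsContractiveLieAut {K L : Type*} [NontriviallyNormedField K] [LieRing L] [LieAlgebra K L]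
    (β : L ≃ₗ⁅K⁆ L) : Prop :=
  ∀ x : L, Tendsto (fun n : ℕ ↦ (β : L → L)^[n] x) atTop (@nhds L (moduleTopology K L) 0)

/-- Pairs `(G, α)` of a finite-dimensional analytic Lie group `G` over `K` (modelled on a
finite-dimensional normed space `E`) and a contractive analytic automorphism `α` of `G`. -/
structure CLG (K : Type u) [NontriviallyNormedField K] where
  E : Type u
  G : Type u
  [normedAddCommGroup : NormedAddCommGroup E]
  [normedSpace : NormedSpace K E]
  [finiteDimensional : FiniteDimensional K E]
  [group : Group G]
  [topologicalSpace : TopologicalSpace G]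
  [chartedSpace : ChartedSpace E G]
  [lieGroup : LieGroup 𝓘(K, E) ω G]
  aut : G ≃* G
  contMDiff_aut : ContMDiff 𝓘(K, E) 𝓘(K, E) ω aut
  contMDiff_aut_symm : ContMDiff 𝓘(K, E) 𝓘(K, E) ω aut.symm
  contractive : IsContractiveAut aut

/-- Pairs `(L, β)` of a finite-dimensional Lie algebra `L` over `K` and a contractive Lie algebra
automorphism `β` of `L`. -/
structure CLA (K : Type u) [NontriviallyNormedField K] where
  L : Type u
  [lieRing : LieRing L]
  [lieAlgebra : LieAlgebra K L]
  [finiteDimensional : FiniteDimensional K L]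
  aut : L ≃ₗ⁅K⁆ L
  contractive : IsContractiveLieAut aut

attribute [instance] CLG.normedAddCommGroup CLG.normedSpace CLG.finiteDimensional CLG.group
  CLG.topologicalSpace CLG.chartedSpace CLG.lieGroup
  CLA.lieRing CLA.lieAlgebra CLA.finiteDimensional

variable {K : Type u} [NontriviallyNormedField K]

/-- Morphisms `(G₁, α₁) → (G₂, α₂)`: analytic homomorphisms `f` with `α₂ ∘ f = f ∘ α₁`. -/
@[ext]
structure CLG.Hom (X Y : CLG K) where
  hom : X.G →* Y.G
  contMDiff_hom : ContMDiff 𝓘(K, X.E) 𝓘(K, Y.E) ω hom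
  equivariant : ∀ x, Y.aut (hom x) = hom (X.aut x)

/-- Morphisms `(L₁, β₁) → (L₂, β₂)`: Lie algebra homomorphisms `f` with `β₂ ∘ f = f ∘ β₁`. -/
@[ext]
structure CLA.Hom (X Y : CLA K) where
  hom : X.L →ₗ⁅K⁆ Y.L
  equivariant : ∀ x, Y.aut (hom x) = hom (X.aut x)

instance CLG.category : Category.{u} (CLG K) where
  Hom := CLG.Hom
  id X := ⟨MonoidHom.id X.G, contMDiff_id, fun _ ↦ rfl⟩
  comp f g := ⟨g.hom.comp f.hom, g.contMDiff_hom.comp f.contMDiff_hom, fun x ↦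
    (g.equivariant (f.hom x)).trans (congrArg g.hom (f.equivariant x))⟩

instance CLA.category : Category.{u} (CLA K) where
  Hom := CLA.Hom
  id X := ⟨LieHom.id, fun _ ↦ rfl⟩
  comp f g := ⟨g.hom.comp f.hom, fun x ↦
    (g.equivariant (f.hom x)).trans (congrArg g.hom (f.equivariant x))⟩

instance CLG.completeSpace [CompleteSpace K] (X : CLG K) : CompleteSpace X.E :=
  FiniteDimensional.complete K X.E

instance CLG.finiteDimensional_lie (X : CLG K) :
    FiniteDimensional K (GroupLieAlgebra 𝓘(K, X.E) X.G) :=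
  X.finiteDimensional

/-- The Lie algebra automorphism `L(α)` of an object `(G, α)`. -/
noncomputable def CLG.lieAut [CompleteSpace K] (X : CLG K) :
    GroupLieAlgebra 𝓘(K, X.E) X.G ≃ₗ⁅K⁆ GroupLieAlgebra 𝓘(K, X.E) X.G :=
  _root_.lieAut X.aut X.contMDiff_aut X.contMDiff_aut_symm

/-- The Lie algebra homomorphism `L(f)` of a morphism `f`. -/
noncomputable def CLG.Hom.lieMap [CompleteSpace K] {X Y : CLG K} (f : CLG.Hom X Y) :
    GroupLieAlgebra 𝓘(K, X.E) X.G →ₗ⁅K⁆ GroupLieAlgebra 𝓘(K, Y.E) Y.G :=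
  _root_.lieMap f.hom f.contMDiff_hom

theorem CLG.Hom.lieMap_equivariant [CompleteSpace K] {X Y : CLG K} (f : CLG.Hom X Y)
    (v : GroupLieAlgebra 𝓘(K, X.E) X.G) :
    Y.lieAut (f.lieMap v) = f.lieMap (X.lieAut v) := by
  have h1 := tangentMapOne_comp (g := Y.aut.toMonoidHom) f.contMDiff_hom Y.contMDiff_aut
  have h2 := tangentMapOne_comp (f := X.aut.toMonoidHom) X.contMDiff_aut f.contMDiff_hom
  have h3 : Y.aut.toMonoidHom.comp f.hom = f.hom.comp X.aut.toMonoidHom := by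
    ext x
    exact f.equivariant x
  rw [h3, h2] at h1
  exact (LinearMap.congr_fun h1 v).symm

/-- The functor `(G, α) ↦ (L(G), L(α))`, `f ↦ L(f)`. That every `L(α)` is contractive, so that the
functor takes values in `CLA K`, enters as the argument `h`. -/
noncomputable def lieFunctor [CompleteSpace K] (h : ∀ X : CLG K, IsContractiveLieAut X.lieAut) :
    CLG K ⥤ CLA K where
  obj X := { L := GroupLieAlgebra 𝓘(K, X.E) X.G, aut := X.lieAut, contractive := h X }
  map f := { hom := f.lieMap, equivariant := f.lieMap_equivariant }
  map_id X := CLA.Hom.ext (LieHom.ext fun v ↦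
    LinearMap.congr_fun (tangentMapOne_id (K := K) (E := X.E) (G := X.G)) v)
  map_comp {X Y Z} f g := CLA.Hom.ext (LieHom.ext fun v ↦
    LinearMap.congr_fun (tangentMapOne_comp (K := K) (E := X.E) (E' := Y.E) (E'' := Z.E)
      f.contMDiff_hom g.contMDiff_hom) v)

end Categories

/-!
Let `(G, α)` be a Lie group with a contractive automorphism and `(L, β)` its Lie algebra. The proof
replaces the exponential map, which need not converge on a set stable under `α`, by a chart built
from a grading.

*Contractivity of `L(α)`.* By a Baire category argument the identity is a stable fixed point of `α`
(`exists_nhds_forall_iterate_mem`), and the linearization of a map at a stable attracting fixed point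
has no eigenvalue of norm `≥ 1` (`rootNormSpace_eq_bot_of_stable`).

*Gradings.* Decompose `L` according to the norms `r < 1` of the eigenvalues of `β`. The bracket
multiplies these norms, so a `ℚ`-linear functional `f` on `ℝ` with positive integer values on the
finitely many numbers `log r` gives a diagonalizable derivation `D`, with positive integer
eigenvalues, that is natural for equivariant homomorphisms (`exists_isPositiveGrading`). In
particular `D` is invertible, and `L` is nilpotent.

*The algebraic group.* For `c : L` the operator `D - [c, ·]` is conjugate to `D` by an operator `a(c)`
that is unipotent for the filtration by weights, is polynomial in `c`, and satisfies
`a(c + a(c) c') = a(c) a(c')` (`IsPositiveGrading.conjugator_mul`). Hence `c * c' = c + a(c) c'` is an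
analytic group law on `L`. Its Lie algebra is isomorphic to `L` by `D`
(`GradedGroup.lie_derivation`), and `β` is a contractive automorphism of it. This proves essential
surjectivity.

*The chart.* In any Lie group the closed `1`-form with value `Ad x (D v)` on the left invariant field
of `v` has a primitive `C` near the identity (`AnalyticAt.exists_primitive`), a cocycle for the adjoint
action with derivative `D`. So `C` is a chart. Because `Ad x` and `a(C x)` satisfy the same
differential equation, they agree (`IsAdCocycle.localAd_eq_conjugatorL`), and in this chart the group
law is `c + a(c) c'`. Equivariant homomorphisms become their tangent maps in these charts, and each
equivariant homomorphism of Lie algebras gives a germ of a homomorphism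
(`IsLocalGroupHom.map_cocycle`, `IsAdCocycle.exists_isLocalGroupHom`). As every element is contracted
into any neighbourhood of the identity, germs of equivariant homomorphisms extend uniquely
(`exists_monoidHom_of_germ`). So the functor is fully faithful.

Uniqueness for differential equations holds over `K` because the characteristic is zero and all
functions are analytic (`AnalyticAt.eventually_eq_zero_of_norm_fderiv_le`).
-/

/-! ### Uniqueness for analytic functions in characteristic zero -/

section AnalyticUniqueness

open Filter

variable {K : Type*} [NontriviallyNormedField K] [CharZero K]
  {E : Type*} [NormedAddCommGroup E] [NormedSpace K E]
  {E' : Type*} [NormedAddCommGroup E'] [NormedSpace K E']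
  {F : Type*} [NormedAddCommGroup F] [NormedSpace K F]

/-- If `f` had a zero of finite order `k` at `0`, the leading coefficient of `t f'(t) + m f(t)`
would be `k + m` times that of `f`; as `k + m ≠ 0` in characteristic zero, this contradicts the
bound. -/
theorem AnalyticAt.eventually_eq_zero_of_euler_bound [CompleteSpace F] {f : K → F}
    (hf : AnalyticAt K f 0) (m : ℕ) (h0 : m ≠ 0 ∨ f 0 = 0) (M : ℝ)
    (hb : ∀ᶠ t in 𝓝 (0 : K), ‖t • deriv f t + (m : K) • f t‖ ≤ M * ‖t‖ * ‖f t‖) :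
    ∀ᶠ t in 𝓝 (0 : K), f t = 0 := by
  by_contra hne
  obtain ⟨k, g, hg, hg0, hfg⟩ := hf.exists_eventuallyEq_pow_smul_nonzero_iff.2 hne
  simp only [sub_zero] at hfg
  have hkm : k + m ≠ 0 := by
    rcases h0 with h | h
    · omega
    · have := hfg.self_of_nhds
      intro hk
      obtain rfl : k = 0 := by omega
      simp only [pow_zero, one_smul] at this
      exact hg0 (this ▸ h)
  have hgd : ∀ᶠ t in 𝓝 (0 : K), DifferentiableAt K g t :=
    (hg.contDiffAt (n := 1)).eventually (by simp) |>.mono fun t ht ↦ ht.differentiableAt (by simp)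
  have hgc : ContinuousAt (deriv g) 0 :=
    ((hg.contDiffAt (n := 1)).fderiv_right (m := 0) (by simp)).continuousAt.clm_apply
      continuousAt_const
  -- away from `0` the common factor `t ^ k` cancels
  have key : ∀ᶠ t in 𝓝[≠] (0 : K),
      ‖((k + m : ℕ) : K) • g t + t • deriv g t‖ ≤ M * ‖t‖ * ‖g t‖ := by
    filter_upwards [self_mem_nhdsWithin, hb.filter_mono nhdsWithin_le_nhds,
      hfg.eventually_nhds.filter_mono nhdsWithin_le_nhds,
      hgd.filter_mono nhdsWithin_le_nhds] with t ht hbt hft hgt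
    have ht0 : t ≠ 0 := ht
    have hd : deriv f t = t ^ k • deriv g t + ((k : K) * t ^ (k - 1)) • g t := by
      rw [EventuallyEq.deriv_eq (f₁ := f) (f := fun z ↦ z ^ k • g z) hft]
      have := ((hasDerivAt_pow k t).smul hgt.hasDerivAt).deriv
      exact this
    have hk : t * ((k : K) * t ^ (k - 1)) = k * t ^ k := by
      rcases k with _ | k
      · simp
      · simp [pow_succ]; ring
    rw [hd, hft.self_of_nhds, smul_add, smul_smul, smul_smul, hk, norm_smul, norm_pow] at hbt
    have e : (t * t ^ k) • deriv g t + ((k : K) * t ^ k) • g t + (m : K) • t ^ k • g t =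
        t ^ k • (((k + m : ℕ) : K) • g t + t • deriv g t) := by
      push_cast
      module
    rw [e, norm_smul, norm_pow] at hbt
    have hp : 0 < ‖t‖ ^ k := pow_pos (norm_pos_iff.2 ht0) k
    refine le_of_mul_le_mul_left (hbt.trans (le_of_eq ?_)) hp
    ring
  have l1 : Tendsto (fun t ↦ ‖((k + m : ℕ) : K) • g t + t • deriv g t‖) (𝓝[≠] (0 : K))
      (𝓝 ‖((k + m : ℕ) : K) • g 0 + (0 : K) • deriv g 0‖) :=
    (((continuousAt_const.smul hg.continuousAt).add
      (continuousAt_id.smul hgc)).norm).tendsto.mono_left nhdsWithin_le_nhds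
  have l2 : Tendsto (fun t ↦ M * ‖t‖ * ‖g t‖) (𝓝[≠] (0 : K)) (𝓝 (M * ‖(0 : K)‖ * ‖g 0‖)) :=
    ((continuousAt_const.mul continuousAt_id.norm).mul hg.continuousAt.norm).tendsto.mono_left
      nhdsWithin_le_nhds
  have := le_of_tendsto_of_tendsto l1 l2 key
  simp only [zero_smul, add_zero, norm_zero, mul_zero, zero_mul, norm_le_zero_iff,
    smul_eq_zero] at this
  rcases this with h | h
  · exact hkm (by exact_mod_cast h)
  · exact hg0 h

/-- The uniqueness principle that replaces Grönwall's inequality over a field of characteristic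
zero: it is proved along each ray through `x₀`, and so holds on the whole ball of convergence. -/
theorem HasFPowerSeriesOnBall.eq_zero_of_euler_bound [CompleteSpace F] {f : E → F}
    {p : FormalMultilinearSeries K E F} {x₀ : E} {r : ENNReal} (hf : HasFPowerSeriesOnBall f p x₀ r)
    (m : ℕ) (h0 : m ≠ 0 ∨ f x₀ = 0) (M : ℝ)
    (hb : ∀ᶠ x in 𝓝 x₀, ‖fderiv K f x (x - x₀) + (m : K) • f x‖ ≤ M * ‖x - x₀‖ * ‖f x‖) :
    ∀ y ∈ Metric.eball x₀ r, f y = 0 := by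
  intro y hy
  set v := y - x₀ with hv
  set u : K →L[K] E := ContinuousLinearMap.toSpanSingleton K v with hu
  have hf0 : HasFPowerSeriesOnBall (fun z ↦ f (z + x₀)) p (u 0) r := by
    have := hf.comp_sub (-x₀)
    simpa only [sub_neg_eq_add, add_neg_cancel, map_zero] using this
  have hline := hf0.compContinuousLinearMap
  set φ : K → F := (fun z ↦ f (z + x₀)) ∘ u with hφ
  have hφv : ∀ t, φ t = f (t • v + x₀) := fun t ↦ by simp [hφ, hu]
  have htend : Tendsto (fun t : K ↦ t • v + x₀) (𝓝 0) (𝓝 x₀) := by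
    have : Continuous (fun t : K ↦ t • v + x₀) := by fun_prop
    simpa using this.tendsto 0
  have hfd : ∀ᶠ x in 𝓝 x₀, DifferentiableAt K f x :=
    hf.analyticAt.eventually_analyticAt.mono fun x hx ↦ hx.differentiableAt
  have hz : ∀ᶠ t in 𝓝 (0 : K), φ t = 0 := by
    refine AnalyticAt.eventually_eq_zero_of_euler_bound hline.analyticAt m
      (h0.imp_right fun h ↦ by simp [hφv, h]) (M * ‖v‖) ?_
    filter_upwards [htend.eventually hb, htend.eventually hfd] with t hbt hdt
    have hd : deriv φ t = fderiv K f (t • v + x₀) v := by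
      have h1 : HasDerivAt (fun t : K ↦ t • v + x₀) v t := by
        simpa using ((hasDerivAt_id t).smul_const v).add_const x₀
      have := hdt.hasFDerivAt.comp_hasDerivAt t h1
      exact (this.congr_of_eventuallyEq (Eventually.of_forall fun s ↦ hφv s)).deriv
    rw [hd, hφv, ← map_smul]
    simp only [add_sub_cancel_right, norm_smul] at hbt
    refine hbt.trans (le_of_eq ?_)
    ring
  have hp : ∀ n, (p n fun _ ↦ v) = 0 := by
    intro n
    have hzero : HasFPowerSeriesAt (0 : K → F) (p.compContinuousLinearMap u) 0 :=
      hline.hasFPowerSeriesAt.congr hz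
    have := hzero.apply_eq_zero n 1
    rw [FormalMultilinearSeries.compContinuousLinearMap_apply] at this
    simpa only [hu, Function.comp_def, ContinuousLinearMap.toSpanSingleton_apply,
      one_smul] using this
  have hs := hf.hasSum (y := v) (by
    rw [Metric.mem_eball, edist_zero_right]
    rw [Metric.mem_eball, edist_eq_enorm_sub] at hy
    exact hy)
  simp only [hp] at hs
  rw [hv, add_sub_cancel] at hs
  exact hs.unique hasSum_zero

theorem AnalyticAt.eventually_eq_zero_of_norm_fderiv_le [CompleteSpace F] {f : E → F} {x₀ : E}
    (hf : AnalyticAt K f x₀) (h0 : f x₀ = 0) (M : ℝ)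
    (hb : ∀ᶠ x in 𝓝 x₀, ‖fderiv K f x‖ ≤ M * ‖f x‖) : ∀ᶠ x in 𝓝 x₀, f x = 0 := by
  obtain ⟨p, r, hp⟩ := hf
  filter_upwards [Metric.eball_mem_nhds x₀ hp.r_pos] with y hy
  refine hp.eq_zero_of_euler_bound 0 (Or.inr h0) M ?_ y hy
  filter_upwards [hb] with x hx
  simp only [Nat.cast_zero, zero_smul, add_zero]
  calc _ ≤ ‖fderiv K f x‖ * ‖x - x₀‖ := ContinuousLinearMap.le_opNorm _ _
    _ ≤ M * ‖f x‖ * ‖x - x₀‖ := by gcongr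
    _ = _ := by ring

theorem AnalyticAt.eventually_eq_zero_of_fderiv_eq_zero [CompleteSpace F] {f : E → F} {x₀ : E}
    (hf : AnalyticAt K f x₀) (h0 : f x₀ = 0)
    (hb : ∀ᶠ x in 𝓝 x₀, fderiv K f x = 0) : ∀ᶠ x in 𝓝 x₀, f x = 0 :=
  hf.eventually_eq_zero_of_norm_fderiv_le h0 0 (hb.mono fun x hx ↦ by simp [hx])

/-- The power series of `f` at `(x, b)`, for `x` near `a`, all converge on balls of one radius. This
is what makes the neighbourhood of `b` on which `f (x, ·)` vanishes independent of `x`. -/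
theorem AnalyticAt.eventually_eq_zero_of_partial_fderiv_eq_zero [CompleteSpace F] {f : E × E' → F}
    {a : E} {b : E'} (hf : AnalyticAt K f (a, b)) (h0 : ∀ᶠ x in 𝓝 a, f (x, b) = 0)
    (hb : ∀ᶠ p in 𝓝 (a, b), fderiv K (fun y ↦ f (p.1, y)) p.2 = 0) :
    ∀ᶠ p in 𝓝 (a, b), f p = 0 := by
  obtain ⟨p, r, hp⟩ := hf
  obtain ⟨ρ, hρ, hρr⟩ : ∃ ρ : NNReal, 0 < ρ ∧ ((ρ + ρ : NNReal) : ENNReal) ≤ r := by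
    obtain ⟨s, hs0, hs⟩ := ENNReal.lt_iff_exists_nnreal_btwn.1 hp.r_pos
    refine ⟨s / 2, half_pos (by exact_mod_cast hs0), ?_⟩
    rw [add_halves]
    exact hs.le
  have hb' : ∀ᶠ x in 𝓝 a, ∀ᶠ y in 𝓝 b, fderiv K (fun y ↦ f (x, y)) y = 0 := by
    rw [nhds_prod_eq] at hb
    exact hb.curry
  have main : ∀ᶠ x in 𝓝 a, ∀ y ∈ Metric.eball b ρ, f (x, y) = 0 := by
    filter_upwards [h0, hb', Metric.eball_mem_nhds a (ε := (ρ : ENNReal)) (by exact_mod_cast hρ)]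
      with x hx0 hxb hx y hy
    have hxa : ‖(x - a, (0 : E'))‖₊ < ρ := by
      rw [Metric.mem_eball, edist_eq_enorm_sub] at hx
      have h1 : ‖x - a‖₊ < ρ := by exact_mod_cast hx
      simpa [Prod.nnnorm_def, hρ] using h1
    have h1 := hp.changeOrigin (y := (x - a, (0 : E'))) (by
      refine lt_of_lt_of_le ?_ ((ENNReal.coe_le_coe.2 (le_add_of_nonneg_left zero_le)).trans hρr)
      exact_mod_cast hxa)
    simp only [Prod.mk_add_mk, add_sub_cancel, add_zero] at h1
    -- translate to the origin, restrict to the second factor, translate back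
    have h2 : HasFPowerSeriesOnBall (fun z ↦ f (z + (x, b)))
        (p.changeOrigin (x - a, 0)) (ContinuousLinearMap.inr K E E' 0) ρ := by
      have := h1.comp_sub (-(x, b))
      simp only [sub_neg_eq_add, add_neg_cancel] at this
      rw [map_zero]
      refine this.mono (by exact_mod_cast hρ) ?_
      rw [ENNReal.le_sub_iff_add_le_left (by simp)]
      · refine le_trans ?_ hρr
        push_cast
        gcongr
      · refine le_trans ?_ ((ENNReal.coe_le_coe.2 (le_add_of_nonneg_left zero_le)).trans hρr)
        exact_mod_cast hxa.le
    have h3 := (h2.compContinuousLinearMap).comp_sub b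
    have h4 : ((fun z ↦ f (z + (x, b))) ∘ ContinuousLinearMap.inr K E E') =
        fun z ↦ f (x, z + b) := by
      ext z
      simp
    simp only [h4, zero_add, sub_add_cancel] at h3
    refine h3.eq_zero_of_euler_bound 0 (Or.inr hx0) 0 ?_ y ?_
    · filter_upwards [hxb] with y hy
      simp [hy]
    · refine Metric.eball_subset_eball ?_ hy
      refine ENNReal.le_div_iff_mul_le ?_ ?_ |>.2 ?_
      · right; simpa using hρ.ne'
      · right; simp
      · have : ‖ContinuousLinearMap.inr K E E'‖ₑ ≤ 1 := by
          have := ContinuousLinearMap.norm_inr_le_one K E E'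
          rw [← ofReal_norm]
          exact ENNReal.ofReal_le_one.2 this
        exact (mul_le_mul_right this _).trans (by simp)
  have h5 : ∀ᶠ q in 𝓝 (a, b), ∀ y ∈ Metric.eball b ρ, f (q.1, y) = 0 :=
    (continuousAt_fst (p := (a, b))).eventually main
  have h6 : ∀ᶠ q in 𝓝 (a, b), q.2 ∈ Metric.eball b ρ :=
    (continuousAt_snd (p := (a, b))).eventually
      (Metric.eball_mem_nhds b (by exact_mod_cast hρ))
  filter_upwards [h5, h6] with q h7 h8
  exact h7 q.2 h8

end AnalyticUniqueness

/-! ### Primitives of closed one-forms -/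

section Primitive

open Filter

/-- With `p` the least positive integer of norm `< 1`, if there is one, `‖n‖ = 1` unless `p ∣ n`,
and `‖p a‖ = ‖p‖ ‖a‖`. -/
theorem exists_norm_natCast_inv_le_pow (K : Type*) [NontriviallyNormedField K]
    [IsUltrametricDist K] [CharZero K] :
    ∃ C : ℝ, 1 ≤ C ∧ ∀ n : ℕ, n ≠ 0 → ‖(n : K)‖⁻¹ ≤ C ^ n := by
  classical
  by_cases h : ∃ m : ℕ, m ≠ 0 ∧ ‖(m : K)‖ < 1
  · set p := Nat.find h with hp
    obtain ⟨hp0, hp1⟩ := Nat.find_spec h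
    have hppos : 0 < ‖(p : K)‖ := norm_pos_iff.2 (by exact_mod_cast hp0)
    have hlt : ∀ b : ℕ, b ≠ 0 → b < p → ‖(b : K)‖ = 1 := fun b hb hbp ↦
      le_antisymm (IsUltrametricDist.norm_natCast_le_one K b)
        (not_lt.1 fun hb1 ↦ Nat.find_min h hbp ⟨hb, hb1⟩)
    have hp2 : 2 ≤ p := by
      by_contra hcon
      have : p = 1 := by omega
      rw [← hp, this] at hp1
      simp at hp1
    have hC : 1 ≤ ‖(p : K)‖⁻¹ := (one_le_inv₀ hppos).2 hp1.le
    refine ⟨‖(p : K)‖⁻¹, hC, fun n ↦ ?_⟩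
    induction n using Nat.strong_induction_on with
    | _ n ih =>
      intro hn
      by_cases hb : n % p = 0
      · obtain ⟨a, rfl⟩ := Nat.dvd_of_mod_eq_zero hb
        have ha : a ≠ 0 := by rintro rfl; simp at hn
        have hlta : a < p * a := by nlinarith [Nat.pos_of_ne_zero ha]
        rw [Nat.cast_mul, norm_mul, mul_inv]
        calc ‖(p : K)‖⁻¹ * ‖(a : K)‖⁻¹ ≤ ‖(p : K)‖⁻¹ * ‖(p : K)‖⁻¹ ^ a := by
              gcongr
              exact ih a hlta ha
          _ = ‖(p : K)‖⁻¹ ^ (a + 1) := by rw [pow_succ, mul_comm]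
          _ ≤ ‖(p : K)‖⁻¹ ^ (p * a) := pow_le_pow_right₀ hC hlta
      · have h1 : ‖((n % p : ℕ) : K)‖ = 1 := hlt _ hb (Nat.mod_lt _ (by omega))
        have h2 : ‖((p * (n / p) : ℕ) : K)‖ < 1 := by
          rw [Nat.cast_mul, norm_mul]
          calc _ ≤ ‖(p : K)‖ * 1 := by
                gcongr
                exact IsUltrametricDist.norm_natCast_le_one K _
            _ < 1 := by simpa using hp1
        have h3 : ‖(n : K)‖ = 1 := by
          conv_lhs => rw [← Nat.mod_add_div n p]
          rw [Nat.cast_add, IsUltrametricDist.norm_add_eq_max_of_norm_ne_norm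
            (by rw [h1]; exact h2.ne'), h1, max_eq_left h2.le]
        rw [h3, inv_one]
        exact one_le_pow₀ hC
  · push Not at h
    refine ⟨1, le_rfl, fun n hn ↦ ?_⟩
    rw [one_pow]
    exact inv_le_one_of_one_le₀ (h n hn)

variable {K : Type*} [NontriviallyNormedField K] [CharZero K] [IsUltrametricDist K]
  {E : Type*} [NormedAddCommGroup E] [NormedSpace K E]
  {F : Type*} [NormedAddCommGroup F] [NormedSpace K F]

/-- The power series of the radial primitive `x ↦ ∫₀¹ η (t x) x dt` of a `1`-form with power series
`q`. -/
noncomputable def FormalMultilinearSeries.radialPrimitive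
    (q : FormalMultilinearSeries K E (E →L[K] F)) : FormalMultilinearSeries K E F
  | 0 => 0
  | n + 1 => ((n + 1 : ℕ) : K)⁻¹ • (q n).uncurryRight

theorem FormalMultilinearSeries.radialPrimitive_radius_pos
    {q : FormalMultilinearSeries K E (E →L[K] F)} (hq : 0 < q.radius) :
    0 < q.radialPrimitive.radius := by
  obtain ⟨C, hC1, hC⟩ := exists_norm_natCast_inv_le_pow K
  obtain ⟨s, hs0, hs⟩ := ENNReal.lt_iff_exists_nnreal_btwn.1 hq
  obtain ⟨B, hB0, hB⟩ := q.norm_mul_pow_le_of_lt_radius hs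
  have hs0' : (0 : ℝ) < s := by exact_mod_cast hs0
  have hCpos : 0 < C := by linarith
  set t : NNReal := ⟨s / C, by positivity⟩ with ht
  have ht0 : 0 < t := by
    rw [← NNReal.coe_pos]
    exact div_pos hs0' hCpos
  refine lt_of_lt_of_le (ENNReal.coe_pos.2 ht0) (q.radialPrimitive.le_radius_of_bound (B * s) ?_)
  rintro (_ | n)
  · simp only [FormalMultilinearSeries.radialPrimitive, norm_zero, zero_mul]
    positivity
  · simp only [FormalMultilinearSeries.radialPrimitive]
    rw [norm_smul, norm_inv, ContinuousMultilinearMap.uncurryRight_norm]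
    have e : (t : ℝ) = s / C := rfl
    calc ‖((n + 1 : ℕ) : K)‖⁻¹ * ‖q n‖ * (t : ℝ) ^ (n + 1)
        ≤ C ^ (n + 1) * ‖q n‖ * (t : ℝ) ^ (n + 1) := by
          gcongr
          exact hC _ (by simp)
      _ = ‖q n‖ * (s : ℝ) ^ n * s := by
          rw [e, div_pow, pow_succ (s : ℝ)]
          field_simp
      _ ≤ B * s := by
          gcongr
          exact hB n

/-- The Poincaré lemma for analytic `1`-forms. If `C` is the radial primitive of `η` at `x₀`, then
`ζ = dC - η` is closed and `ζ x (x - x₀) = 0`; differentiating this, `ζ' x (x - x₀) + ζ x = 0`, so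
`ζ = 0`. -/
theorem AnalyticAt.exists_primitive [CompleteSpace F] {η : E → E →L[K] F} {x₀ : E}
    (hη : AnalyticAt K η x₀)
    (hclosed : ∀ᶠ x in 𝓝 x₀, ∀ v w, fderiv K η x v w = fderiv K η x w v) :
    ∃ C : E → F, AnalyticAt K C x₀ ∧ C x₀ = 0 ∧ ∀ᶠ x in 𝓝 x₀, fderiv K C x = η x := by
  obtain ⟨q, r, hq⟩ := hη
  set p := q.radialPrimitive with hpdef
  have hp0 : 0 < p.radius :=
    FormalMultilinearSeries.radialPrimitive_radius_pos (lt_of_lt_of_le hq.r_pos hq.r_le)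
  have hps : HasFPowerSeriesOnBall (fun x ↦ p.sum (x - x₀)) p x₀ p.radius := by
    simpa using (p.hasFPowerSeriesOnBall hp0).comp_sub x₀
  set C : E → F := fun x ↦ p.sum (x - x₀) with hC
  have hCan : AnalyticAt K C x₀ := hps.analyticAt
  have hC0 : C x₀ = 0 := by
    have := hps.coeff_zero 0
    rw [← this, hpdef]
    rfl
  refine ⟨C, hCan, hC0, ?_⟩
  -- `C` is a primitive along rays
  have hrad : ∀ᶠ x in 𝓝 x₀, fderiv K C x (x - x₀) = η x (x - x₀) := by
    filter_upwards [Metric.eball_mem_nhds x₀ hp0, Metric.eball_mem_nhds x₀ hq.r_pos] with x h1 h2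
    rw [Metric.mem_eball, edist_eq_enorm_sub] at h1 h2
    have s1 := hps.fderiv.hasSum (y := x - x₀) (by simpa using h1)
    have s2 := hq.hasSum (y := x - x₀) (by simpa using h2)
    rw [add_sub_cancel] at s1 s2
    have s1' := (ContinuousLinearMap.apply K F (x - x₀)).hasSum s1
    have s2' := (ContinuousLinearMap.apply K F (x - x₀)).hasSum s2
    simp only [ContinuousLinearMap.apply_apply] at s1' s2'
    refine s1'.unique (s2'.congr_fun ?_)
    intro n
    rw [FormalMultilinearSeries.derivSeries_apply_diag, hpdef]
    simp only [FormalMultilinearSeries.radialPrimitive, smul_apply,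
      ContinuousMultilinearMap.uncurryRight_apply]
    rw [← Nat.cast_smul_eq_nsmul K, smul_smul, mul_inv_cancel₀ (by exact_mod_cast n.succ_ne_zero),
      one_smul]
    rfl
  set ζ : E → E →L[K] F := fun x ↦ fderiv K C x - η x with hζ
  have hηan : AnalyticAt K η x₀ := hq.analyticAt
  have hζan : AnalyticAt K ζ x₀ := hCan.fderiv.sub hηan
  have hζ0 : ∀ᶠ x in 𝓝 x₀, fderiv K ζ x (x - x₀) + ((1 : ℕ) : K) • ζ x = 0 := by
    filter_upwards [hrad.eventually_nhds, hclosed, hζan.eventually_analyticAt,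
      hηan.eventually_analyticAt, hCan.eventually_analyticAt] with x hx hcl hζx hηx hCx
    have d1 : HasFDerivAt (fun y ↦ ζ y (y - x₀))
        ((ζ x).comp (ContinuousLinearMap.id K E) + (fderiv K ζ x).flip (x - x₀)) x :=
      hζx.differentiableAt.hasFDerivAt.clm_apply ((hasFDerivAt_id x).sub_const x₀)
    have d2 : HasFDerivAt (fun y ↦ ζ y (y - x₀)) (0 : E →L[K] F) x := by
      refine (hasFDerivAt_const (0 : F) x).congr_of_eventuallyEq ?_
      filter_upwards [hx] with y hy
      simp [hζ, hy]
    have d3 := d1.unique d2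
    have sym : ∀ v w, fderiv K ζ x v w = fderiv K ζ x w v := by
      intro v w
      have hs := (hCx.contDiffAt (n := ω)).isSymmSndFDerivAt (by simp)
      have e : fderiv K ζ x = fderiv K (fderiv K C) x - fderiv K η x :=
        fderiv_sub hCx.fderiv.differentiableAt hηx.differentiableAt
      rw [e]
      simp only [sub_apply]
      rw [hcl v w, hs.eq v w]
    ext v
    have d4 := DFunLike.congr_fun d3 v
    simp only [add_apply, ContinuousLinearMap.comp_apply,
      ContinuousLinearMap.flip_apply, ContinuousLinearMap.id_apply,
      zero_apply] at d4
    simp only [Nat.cast_one, one_smul, add_apply,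
      zero_apply]
    rw [sym, add_comm, d4]
  obtain ⟨pz, rz, hz⟩ := hζan
  filter_upwards [Metric.eball_mem_nhds x₀ hz.r_pos] with x hx
  have := hz.eq_zero_of_euler_bound 1 (Or.inl one_ne_zero) 0 (by
    filter_upwards [hζ0] with y hy
    rw [hy]
    simp) x hx
  exact sub_eq_zero.1 this

end Primitive

/-! ### Sequences annihilated by polynomials in the shift -/

section LinearRecurrence

open Filter Polynomial

variable {F : Type*} [NormedField F]

/-- The shift `(s n) ↦ (s (n + 1))` on two-sided sequences. -/
def shift (F : Type*) [NormedField F] : Module.End F (ℤ → F) where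
  toFun s n := s (n + 1)
  map_add' _ _ := rfl
  map_smul' _ _ := rfl

/-- Splitting off one factor `X - θ` of a characteristic polynomial: `n ↦ s (n + 1) - θ s n` solves
the linear recurrence of the remaining roots. -/
theorem aeval_shift_cons {θ : F} {m : Multiset F} {s : ℤ → F}
    (h : aeval (shift F) (((θ ::ₘ m).map fun a ↦ X - C a).prod) s = 0) :
    aeval (shift F) ((m.map fun a ↦ X - C a).prod) (fun n ↦ s (n + 1) - θ * s n) = 0 := by
  rw [Multiset.map_cons, Multiset.prod_cons, mul_comm, map_mul, Module.End.mul_apply] at h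
  convert h using 2
  ext n
  simp [shift]

/-- Solutions of a linear recurrence whose characteristic roots have norm at most `r` grow at most
like `r ^ n`. There are no polynomial factors, since the norm is ultrametric. -/
theorem norm_le_of_shift_forward [IsUltrametricDist F] {r : ℝ} (hr : 0 < r) (m : Multiset F)
    (hm : ∀ θ ∈ m, ‖θ‖ ≤ r) (s : ℤ → F)
    (h : aeval (shift F) ((m.map fun a ↦ X - C a).prod) s = 0) :
    ∃ B : ℝ, ∀ n : ℕ, ‖s n‖ ≤ B * r ^ n := by
  induction m using Multiset.induction_on generalizing s with
  | empty =>
    obtain rfl : s = 0 := by simpa using h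
    exact ⟨0, by simp⟩
  | cons θ m ih =>
    obtain ⟨B, hB⟩ := ih (fun a ha ↦ hm a (Multiset.mem_cons_of_mem ha)) _ (aeval_shift_cons h)
    have hθ := hm θ (Multiset.mem_cons_self θ m)
    refine ⟨max ‖s 0‖ (B / r), fun n ↦ ?_⟩
    induction n with
    | zero => simp
    | succ n ihn =>
      have e : s ((n + 1 : ℕ) : ℤ) = θ * s n + (s (n + 1) - θ * s n) := by push_cast; ring
      rw [e]
      refine (IsUltrametricDist.norm_add_le_max _ _).trans (max_le ?_ ?_)
      · rw [norm_mul, pow_succ, ← mul_assoc, mul_comm]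
        gcongr
      · refine (hB n).trans ?_
        rw [pow_succ, mul_comm (r ^ n), ← mul_assoc]
        gcongr
        rw [← div_le_iff₀ hr]
        exact le_max_right _ _

theorem norm_le_of_shift_backward [IsUltrametricDist F] {r : ℝ} (hr : 0 < r) (m : Multiset F)
    (hm : ∀ θ ∈ m, r ≤ ‖θ‖) (s : ℤ → F)
    (h : aeval (shift F) ((m.map fun a ↦ X - C a).prod) s = 0) :
    ∃ B : ℝ, ∀ n : ℕ, ‖s (-n)‖ ≤ B * r⁻¹ ^ n := by
  induction m using Multiset.induction_on generalizing s with
  | empty =>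
    obtain rfl : s = 0 := by simpa using h
    exact ⟨0, by simp⟩
  | cons θ m ih =>
    obtain ⟨B, hB⟩ := ih (fun a ha ↦ hm a (Multiset.mem_cons_of_mem ha)) _ (aeval_shift_cons h)
    have hθ := hm θ (Multiset.mem_cons_self θ m)
    have hθ0 : θ ≠ 0 := norm_pos_iff.1 (hr.trans_le hθ)
    have hθi : ‖θ‖⁻¹ ≤ r⁻¹ := inv_anti₀ hr hθ
    refine ⟨max ‖s 0‖ (B * r⁻¹), fun n ↦ ?_⟩
    induction n with
    | zero => simp
    | succ n ihn =>
      have e : s (-((n + 1 : ℕ) : ℤ)) = θ⁻¹ * s (-n) + -(θ⁻¹ *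
          (s (-((n + 1 : ℕ) : ℤ) + 1) - θ * s (-((n + 1 : ℕ) : ℤ)))) := by
        have : (-((n + 1 : ℕ) : ℤ) + 1) = -n := by push_cast; ring
        rw [this]
        field_simp
        ring
      rw [e]
      refine (IsUltrametricDist.norm_add_le_max _ _).trans (max_le ?_ ?_)
      · rw [norm_mul, norm_inv, pow_succ, ← mul_assoc, mul_comm]
        gcongr
      · rw [norm_neg, norm_mul, norm_inv]
        have hBn := hB (n + 1)
        have hB0 : 0 ≤ B * r⁻¹ ^ (n + 1) := (norm_nonneg _).trans hBn
        calc _ ≤ r⁻¹ * (B * r⁻¹ ^ (n + 1)) := by gcongr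
          _ = B * r⁻¹ * r⁻¹ ^ (n + 1) := by ring
          _ ≤ _ := by
            gcongr
            exact le_max_right _ _

/-- A bounded solution of growth rate `t` vanishes if no characteristic root has norm `t`. -/
theorem eq_zero_of_shift_of_norm_ne {t : ℝ} (ht : 0 < t) (m : Multiset F)
    (hm : ∀ θ ∈ m, ‖θ‖ ≠ t) (s : ℤ → F)
    (h : aeval (shift F) ((m.map fun a ↦ X - C a).prod) s = 0)
    (hs : ∃ B : ℝ, ∀ n : ℤ, ‖s n‖ ≤ B * t ^ n) : s = 0 := by
  induction m using Multiset.induction_on generalizing s with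
  | empty => simpa using h
  | cons θ m ih =>
    obtain ⟨B, hB⟩ := hs
    have hB0 : 0 ≤ B := by simpa using (norm_nonneg _).trans (hB 0)
    have h1 := ih (fun a ha ↦ hm a (Multiset.mem_cons_of_mem ha)) _ (aeval_shift_cons h)
      ⟨B * t + ‖θ‖ * B, fun n ↦ by
        refine (norm_sub_le _ _).trans ?_
        rw [add_mul, norm_mul]
        refine add_le_add ((hB _).trans (le_of_eq ?_)) ?_
        · rw [zpow_add_one₀ ht.ne']; ring
        · rw [mul_assoc]
          gcongr
          exact hB n⟩
    have h2 : ∀ n, s (n + 1) = θ * s n := fun n ↦ sub_eq_zero.1 (congrFun h1 n)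
    have hθ := hm θ (Multiset.mem_cons_self θ m)
    by_cases hθ0 : θ = 0
    · ext n
      have := h2 (n - 1)
      simpa [hθ0] using this
    have h3 : ∀ n : ℤ, ∀ k : ℕ, s (n + k) = θ ^ k * s n := by
      intro n k
      induction k with
      | zero => simp
      | succ k ihk =>
        rw [Nat.cast_succ, ← add_assoc, h2, ihk]
        ring
    ext n
    by_contra hn
    have hn' : 0 < ‖s n‖ := norm_pos_iff.2 hn
    have hθp : 0 < ‖θ‖ := norm_pos_iff.2 hθ0
    have hbound : ∀ ρ : ℝ, 1 < ρ → ¬ ∀ k : ℕ, ρ ^ k * ‖s n‖ ≤ B * t ^ n := by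
      intro ρ hρ hk
      obtain ⟨k, hk'⟩ := pow_unbounded_of_one_lt (B * t ^ n / ‖s n‖) hρ
      exact absurd (hk k) (not_le.2 ((div_lt_iff₀ hn').1 hk'))
    rcases lt_or_gt_of_ne hθ with hlt | hgt
    · refine hbound (t / ‖θ‖) ((one_lt_div hθp).2 hlt) fun k ↦ ?_
      have h4 := h3 (n - k) k
      rw [sub_add_cancel] at h4
      have h5 := hB (n - k)
      rw [h4, norm_mul, norm_pow, div_pow]
      rw [zpow_sub₀ ht.ne', zpow_natCast] at h5
      have : t ^ k / ‖θ‖ ^ k * (‖θ‖ ^ k * ‖s (n - k)‖) = t ^ k * ‖s (n - k)‖ := by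
        field_simp
      rw [this]
      calc t ^ k * ‖s (n - k)‖ ≤ t ^ k * (B * (t ^ n / t ^ k)) := by gcongr
        _ = _ := by field_simp
    · refine hbound (‖θ‖ / t) ((one_lt_div ht).2 hgt) fun k ↦ ?_
      have h5 := hB (n + k)
      rw [h3, norm_mul, norm_pow, zpow_add₀ ht.ne', zpow_natCast] at h5
      rw [div_pow, div_mul_eq_mul_div, div_le_iff₀ (by positivity)]
      linarith

/-- A solution that tends to zero vanishes if all characteristic roots have norm at least `1`. -/
theorem eq_zero_of_shift_of_tendsto (m : Multiset F)
    (hm : ∀ θ ∈ m, 1 ≤ ‖θ‖) (s : ℤ → F)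
    (h : aeval (shift F) ((m.map fun a ↦ X - C a).prod) s = 0)
    (hs : Tendsto (fun n : ℕ ↦ s n) atTop (𝓝 0)) : s = 0 := by
  induction m using Multiset.induction_on generalizing s with
  | empty => simpa using h
  | cons θ m ih =>
    have h1 := ih (fun a ha ↦ hm a (Multiset.mem_cons_of_mem ha)) _ (aeval_shift_cons h) (by
      have := (hs.comp (tendsto_add_atTop_nat 1)).sub (hs.const_mul θ)
      simpa using this)
    have h2 : ∀ n, s (n + 1) = θ * s n := fun n ↦ sub_eq_zero.1 (congrFun h1 n)
    have hθ := hm θ (Multiset.mem_cons_self θ m)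
    have hmono : ∀ n : ℤ, ∀ k : ℕ, ‖s n‖ ≤ ‖s (n + k)‖ := by
      intro n k
      induction k with
      | zero => simp
      | succ k ihk =>
        rw [Nat.cast_succ, ← add_assoc, h2, norm_mul]
        exact ihk.trans (le_mul_of_one_le_left (norm_nonneg _) hθ)
    ext n
    rw [Pi.zero_apply, ← norm_le_zero_iff]
    refine ge_of_tendsto (by simpa using hs.norm) ?_
    filter_upwards [eventually_ge_atTop n.toNat] with k hk
    have h4 := hmono n (k - n).toNat
    rwa [Int.toNat_of_nonneg (by omega), add_sub_cancel] at h4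

end LinearRecurrence

section RootNorm

open Polynomial

variable {K : Type*} [NontriviallyNormedField K]

/-- `P` is nonzero and the norms of its roots in an algebraic closure all satisfy `p`. -/
def RootNorms (P : K[X]) (p : ℝ → Prop) : Prop :=
  P ≠ 0 ∧ ∀ θ : AlgebraicClosure K, aeval θ P = 0 → p (spectralNorm K (AlgebraicClosure K) θ)

theorem RootNorms.mul {P Q : K[X]} {p : ℝ → Prop} (hP : RootNorms P p) (hQ : RootNorms Q p) :
    RootNorms (P * Q) p := by
  refine ⟨mul_ne_zero hP.1 hQ.1, fun θ hθ ↦ ?_⟩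
  rw [map_mul, mul_eq_zero] at hθ
  exact hθ.elim (hP.2 θ) (hQ.2 θ)

theorem RootNorms.mono {P : K[X]} {p q : ℝ → Prop} (hP : RootNorms P p) (h : ∀ t, p t → q t) :
    RootNorms P q :=
  ⟨hP.1, fun θ hθ ↦ h _ (hP.2 θ hθ)⟩

theorem RootNorms.isCoprime {P Q : K[X]} {p q : ℝ → Prop} (hP : RootNorms P p)
    (hQ : RootNorms Q q) (h : ∀ t, p t → ¬ q t) : IsCoprime P Q := by
  rw [Polynomial.isCoprime_iff_aeval_ne_zero_of_isAlgClosed K (AlgebraicClosure K)]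
  intro θ
  by_contra! hcon
  exact h _ (hP.2 θ hcon.1) (hQ.2 θ hcon.2)

/-- The roots of an irreducible polynomial share their norm, so a polynomial splits over the base
field according to any condition on the norms of its roots. -/
theorem exists_rootNorms_mul (p : ℝ → Prop) (P : K[X]) (hP : P ≠ 0) :
    ∃ P₁ P₂ : K[X], P = P₁ * P₂ ∧ RootNorms P₁ p ∧ RootNorms P₂ (fun t ↦ ¬ p t) := by
  induction P using UniqueFactorizationMonoid.induction_on_prime with
  | h₁ => exact absurd rfl hP
  | h₂ P hu =>
    refine ⟨P, 1, (mul_one P).symm, ⟨hP, fun θ hθ ↦ ?_⟩, ⟨one_ne_zero, fun θ hθ ↦ by simp at hθ⟩⟩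
    exact absurd hθ (hu.map (aeval θ)).ne_zero
  | h₃ P q hP0 hq ih =>
    obtain ⟨P₁, P₂, rfl, h1, h2⟩ := ih hP0
    have hsame : ∀ θ θ' : AlgebraicClosure K, aeval θ q = 0 → aeval θ' q = 0 →
        spectralNorm K (AlgebraicClosure K) θ = spectralNorm K (AlgebraicClosure K) θ' := by
      intro θ θ' hθ hθ'
      rw [spectralNorm, spectralNorm, ← minpoly.eq_of_irreducible hq.irreducible hθ,
        ← minpoly.eq_of_irreducible hq.irreducible hθ']
    by_cases hp : ∃ θ : AlgebraicClosure K, aeval θ q = 0 ∧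
        p (spectralNorm K (AlgebraicClosure K) θ)
    · obtain ⟨θ, hθ, hpθ⟩ := hp
      refine ⟨q * P₁, P₂, by ring, RootNorms.mul ⟨hq.ne_zero, fun θ' hθ' ↦ ?_⟩ h1, h2⟩
      rwa [hsame θ' θ hθ' hθ]
    · refine ⟨P₁, q * P₂, by ring, h1, RootNorms.mul ⟨hq.ne_zero, fun θ' hθ' hpθ ↦ ?_⟩ h2⟩
      exact hp ⟨θ', hθ', hpθ⟩

end RootNorm

/-! ### Growth of orbits of linear automorphisms -/

section Orbits

open Filter Polynomial

section Generic

variable {K : Type*} [NontriviallyNormedField K]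
  {F : Type*} [NormedField F] [NormedAlgebra K F]
  {L : Type*} [AddCommGroup L] [Module K L]

theorem aeval_eq_zero_of_mem_roots_map {P : K[X]} {θ : F}
    (hθ : θ ∈ (P.map (algebraMap K F)).roots) : aeval θ P = 0 := by
  have := isRoot_of_mem_roots hθ
  rwa [IsRoot, eval_map_algebraMap] at this

/-- The two-sided sequence `n ↦ ℓ (βⁿ x)`, with values in an extension field. -/
noncomputable def orbitSeq (F : Type*) [NormedField F] [NormedAlgebra K F] (β : L ≃ₗ[K] L)
    (ℓ : L →ₗ[K] K) : L →ₗ[K] (ℤ → F) where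
  toFun x n := algebraMap K F (ℓ ((β ^ n) x))
  map_add' x y := by ext n; simp
  map_smul' c x := by ext n; simp [Algebra.smul_def]

theorem aeval_shift_orbitSeq [IsAlgClosed F] {β : L ≃ₗ[K] L} {ℓ : L →ₗ[K] K} {P : K[X]}
    (hP : P ≠ 0) {x : L}
    (hx : aeval (β : Module.End K L) P x = 0) :
    aeval (shift F) (((P.map (algebraMap K F)).roots.map fun a ↦ X - C a).prod)
      (orbitSeq F β ℓ x) = 0 := by
  have h1 : ∀ Q : K[X], aeval (shift F) (Q.map (algebraMap K F)) (orbitSeq F β ℓ x) =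
      orbitSeq F β ℓ (aeval (β : Module.End K L) Q x) := by
    intro Q
    induction Q using Polynomial.induction_on' generalizing x with
    | add p q hp hq => simp only [Polynomial.map_add, map_add, LinearMap.add_apply, hp hx, hq hx]
    | monomial n a =>
      have h2 : ∀ (n : ℕ) (x : L), ((shift F) ^ n) (orbitSeq F β ℓ x) =
          orbitSeq F β ℓ (((β : Module.End K L) ^ n) x) := by
        intro n
        induction n with
        | zero => intro x; simp
        | succ n ih =>
          intro x
          rw [pow_succ, pow_succ, Module.End.mul_apply, Module.End.mul_apply, ← ih]
          congr 1
          ext k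
          simp [shift, orbitSeq, zpow_add_one]
      rw [Polynomial.map_monomial, aeval_monomial, aeval_monomial]
      simp only [Module.End.mul_apply, Module.algebraMap_end_apply, h2, map_smul]
      ext k
      simp [Algebra.smul_def]
  have h2 := h1 P
  rw [hx, map_zero] at h2
  have hP' : P.map (algebraMap K F) ≠ 0 := (Polynomial.map_ne_zero_iff
    (algebraMap K F).injective).2 hP
  rw [(IsAlgClosed.splits (P.map (algebraMap K F))).eq_prod_roots, map_mul, aeval_C,
    Module.End.mul_apply, Module.algebraMap_end_apply] at h2
  exact (smul_eq_zero.1 h2).resolve_left (leadingCoeff_ne_zero.2 hP')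

end Generic

variable {K : Type*} [NontriviallyNormedField K] [IsUltrametricDist K] [CompleteSpace K]
  {L : Type*} [AddCommGroup L] [Module K L] {β : L ≃ₗ[K] L} {P : K[X]} {x : L}

theorem RootNorms.norm_forward_le {r : ℝ} (hr : 0 < r) (hP : RootNorms P (· ≤ r))
    (hx : aeval (β : Module.End K L) P x = 0) (ℓ : L →ₗ[K] K) :
    ∃ B : ℝ, ∀ n : ℕ, ‖ℓ ((β ^ (n : ℤ)) x)‖ ≤ B * r ^ n := by
  let := spectralNorm.normedField K (AlgebraicClosure K)
  let := spectralNorm.normedAlgebra K (AlgebraicClosure K)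
  have : IsUltrametricDist (AlgebraicClosure K) :=
    IsUltrametricDist.isUltrametricDist_of_isNonarchimedean_norm isNonarchimedean_spectralNorm
  obtain ⟨B, hB⟩ := norm_le_of_shift_forward hr _
    (fun θ hθ ↦ hP.2 θ (aeval_eq_zero_of_mem_roots_map hθ)) _
    (aeval_shift_orbitSeq (F := AlgebraicClosure K) (ℓ := ℓ) hP.1 hx)
  exact ⟨B, fun n ↦ by
    simpa only [orbitSeq, LinearMap.coe_mk, AddHom.coe_mk, norm_algebraMap'] using hB n⟩

theorem RootNorms.norm_backward_le {r : ℝ} (hr : 0 < r) (hP : RootNorms P (r ≤ ·))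
    (hx : aeval (β : Module.End K L) P x = 0) (ℓ : L →ₗ[K] K) :
    ∃ B : ℝ, ∀ n : ℕ, ‖ℓ ((β ^ (-(n : ℤ))) x)‖ ≤ B * r⁻¹ ^ n := by
  let := spectralNorm.normedField K (AlgebraicClosure K)
  let := spectralNorm.normedAlgebra K (AlgebraicClosure K)
  have : IsUltrametricDist (AlgebraicClosure K) :=
    IsUltrametricDist.isUltrametricDist_of_isNonarchimedean_norm isNonarchimedean_spectralNorm
  obtain ⟨B, hB⟩ := norm_le_of_shift_backward hr _
    (fun θ hθ ↦ hP.2 θ (aeval_eq_zero_of_mem_roots_map hθ)) _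
    (aeval_shift_orbitSeq (F := AlgebraicClosure K) (ℓ := ℓ) hP.1 hx)
  exact ⟨B, fun n ↦ by
    simpa only [orbitSeq, LinearMap.coe_mk, AddHom.coe_mk, norm_algebraMap'] using hB n⟩

theorem RootNorms.eq_zero_of_growth {t : ℝ} (ht : 0 < t) (hP : RootNorms P (· ≠ t))
    (hx : aeval (β : Module.End K L) P x = 0)
    (hg : ∀ ℓ : L →ₗ[K] K, ∃ B : ℝ, ∀ n : ℤ, ‖ℓ ((β ^ n) x)‖ ≤ B * t ^ n) : x = 0 := by
  let := spectralNorm.normedField K (AlgebraicClosure K)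
  let := spectralNorm.normedAlgebra K (AlgebraicClosure K)
  rw [← Module.forall_dual_apply_eq_zero_iff K]
  intro ℓ
  obtain ⟨B, hB⟩ := hg ℓ
  have := eq_zero_of_shift_of_norm_ne ht _
    (fun θ hθ ↦ hP.2 θ (aeval_eq_zero_of_mem_roots_map hθ)) _
    (aeval_shift_orbitSeq (F := AlgebraicClosure K) (ℓ := ℓ) hP.1 hx) ⟨B, fun n ↦ by
      simpa only [orbitSeq, LinearMap.coe_mk, AddHom.coe_mk, norm_algebraMap'] using hB n⟩
  simpa [orbitSeq] using congrFun this 0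

theorem RootNorms.eq_zero_of_tendsto (hP : RootNorms P (1 ≤ ·))
    (hx : aeval (β : Module.End K L) P x = 0)
    (hg : ∀ ℓ : L →ₗ[K] K, Tendsto (fun n : ℕ ↦ ℓ ((β ^ (n : ℤ)) x)) atTop (𝓝 0)) : x = 0 := by
  let := spectralNorm.normedField K (AlgebraicClosure K)
  let := spectralNorm.normedAlgebra K (AlgebraicClosure K)
  rw [← Module.forall_dual_apply_eq_zero_iff K]
  intro ℓ
  have := eq_zero_of_shift_of_tendsto _
    (fun θ hθ ↦ hP.2 θ (aeval_eq_zero_of_mem_roots_map hθ)) _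
    (aeval_shift_orbitSeq (F := AlgebraicClosure K) (ℓ := ℓ) hP.1 hx) (by
      rw [tendsto_zero_iff_norm_tendsto_zero]
      simpa only [orbitSeq, LinearMap.coe_mk, AddHom.coe_mk, norm_algebraMap'] using
        (tendsto_zero_iff_norm_tendsto_zero.1 (hg ℓ)))
  simpa [orbitSeq] using congrFun this 0

end Orbits

section RootNormSpace

open Filter Polynomial

theorem map_aeval_of_intertwine {K L L' : Type*} [Field K] [AddCommGroup L] [Module K L]
    [AddCommGroup L'] [Module K L'] {f : Module.End K L} {f' : Module.End K L'} {φ : L →ₗ[K] L'}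
    (hφ : ∀ x, φ (f x) = f' (φ x)) (Q : K[X]) (x : L) :
    φ (aeval f Q x) = aeval f' Q (φ x) := by
  induction Q using Polynomial.induction_on' with
  | add p q hp hq => simp [hp, hq]
  | monomial n a =>
    have h2 : ∀ (n : ℕ), φ ((f ^ n) x) = (f' ^ n) (φ x) := by
      intro n
      induction n with
      | zero => simp
      | succ n ih =>
        rw [pow_succ', pow_succ', Module.End.mul_apply, Module.End.mul_apply, ← ih]
        exact hφ _
    rw [aeval_monomial, aeval_monomial]
    simp [Module.End.mul_apply, Module.algebraMap_end_apply, h2]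

section Algebra

variable {K : Type*} [NontriviallyNormedField K]
  {L : Type*} [AddCommGroup L] [Module K L]
  {L' : Type*} [AddCommGroup L'] [Module K L']

/-- The sum of the generalized eigenspaces of `β`, over an algebraic closure, for the eigenvalues
whose norms satisfy `p`; it is defined over the base field. -/
def rootNormSpace (β : L ≃ₗ[K] L) (p : ℝ → Prop) : Submodule K L where
  carrier := {x | ∃ P : K[X], RootNorms P p ∧ aeval (β : Module.End K L) P x = 0}
  add_mem' := by
    rintro x y ⟨P, hP, hx⟩ ⟨Q, hQ, hy⟩
    refine ⟨P * Q, hP.mul hQ, ?_⟩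
    rw [map_add, map_mul, Module.End.mul_apply, Module.End.mul_apply, hy, map_zero, add_zero,
      ← Module.End.mul_apply, ← map_mul, mul_comm, map_mul, Module.End.mul_apply, hx, map_zero]
  zero_mem' := ⟨1, ⟨one_ne_zero, fun θ hθ ↦ by simp at hθ⟩, map_zero _⟩
  smul_mem' := by
    rintro c x ⟨P, hP, hx⟩
    exact ⟨P, hP, by rw [map_smul, hx, smul_zero]⟩

theorem rootNormSpace_mono {β : L ≃ₗ[K] L} {p q : ℝ → Prop} (h : ∀ t, p t → q t) :
    rootNormSpace β p ≤ rootNormSpace β q :=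
  fun _ ⟨P, hP, hx⟩ ↦ ⟨P, hP.mono h, hx⟩

theorem disjoint_rootNormSpace {β : L ≃ₗ[K] L} {p q : ℝ → Prop} (h : ∀ t, p t → ¬ q t) :
    Disjoint (rootNormSpace β p) (rootNormSpace β q) := by
  rw [Submodule.disjoint_def]
  rintro x ⟨P, hP, hx⟩ ⟨Q, hQ, hy⟩
  have := disjoint_ker_aeval_of_isCoprime (β : Module.End K L) (hP.isCoprime hQ h)
  exact Submodule.disjoint_def.1 this x hx hy

theorem map_mem_rootNormSpace {β : L ≃ₗ[K] L} {β' : L' ≃ₗ[K] L'} {φ : L →ₗ[K] L'}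
    (hφ : ∀ x, φ (β x) = β' (φ x)) {p : ℝ → Prop} {x : L} (hx : x ∈ rootNormSpace β p) :
    φ x ∈ rootNormSpace β' p := by
  obtain ⟨P, hP, hx⟩ := hx
  exact ⟨P, hP, by rw [← map_aeval_of_intertwine (f := (β : Module.End K L)) hφ, hx, map_zero]⟩

theorem mem_iSup_rootNormSpace_of_aeval (β : L ≃ₗ[K] L) (P : K[X]) (hP : P ≠ 0) (x : L)
    (hx : aeval (β : Module.End K L) P x = 0) : x ∈ ⨆ r : ℝ, rootNormSpace β (· = r) := by
  induction hn : P.natDegree using Nat.strong_induction_on generalizing P x with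
  | _ n ih =>
    subst hn
    by_cases hdeg : P.degree = 0
    · rw [eq_C_of_degree_eq_zero hdeg, aeval_C, Module.algebraMap_end_apply] at hx
      have h0 : P.coeff 0 ≠ 0 := by
        intro h
        rw [eq_C_of_degree_eq_zero hdeg, h, C_0] at hP
        exact hP rfl
      rw [(smul_eq_zero.1 hx).resolve_left h0]
      exact zero_mem _
    obtain ⟨θ, hθ⟩ := IsAlgClosed.exists_aeval_eq_zero (AlgebraicClosure K) P hdeg
    set r := spectralNorm K (AlgebraicClosure K) θ with hr
    obtain ⟨P₁, P₂, rfl, h1, h2⟩ := exists_rootNorms_mul (· = r) P hP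
    have hθ2 : aeval θ P₂ ≠ 0 := fun h ↦ h2.2 θ h rfl
    have hθ1 : aeval θ P₁ = 0 := by
      rw [map_mul] at hθ
      exact (mul_eq_zero.1 hθ).resolve_right hθ2
    have hd1 : 0 < P₁.natDegree := by
      rw [pos_iff_ne_zero]
      intro h
      rw [eq_C_of_natDegree_eq_zero h, aeval_C] at hθ1
      have := (map_eq_zero _).1 hθ1
      rw [eq_C_of_natDegree_eq_zero h, this, C_0] at h1
      exact h1.1 rfl
    obtain ⟨u, v, huv⟩ := h1.isCoprime h2 fun t ht hn ↦ hn ht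
    have e : x = aeval (β : Module.End K L) (u * P₁) x + aeval (β : Module.End K L) (v * P₂) x := by
      rw [← LinearMap.add_apply, ← map_add, huv, map_one, Module.End.one_apply]
    have kill : ∀ Q R : K[X], P₁ * P₂ ∣ Q * R →
        aeval (β : Module.End K L) Q (aeval (β : Module.End K L) R x) = 0 := by
      rintro Q R ⟨S, hS⟩
      rw [← Module.End.mul_apply, ← map_mul, hS, mul_comm, map_mul, Module.End.mul_apply, hx,
        map_zero]
    rw [e]
    refine add_mem (ih P₂.natDegree ?_ P₂ h2.1 _ (kill _ _ ⟨u, by ring⟩) rfl) ?_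
    · rw [natDegree_mul h1.1 h2.1]
      omega
    · exact Submodule.mem_iSup_of_mem r ⟨P₁, h1, kill _ _ ⟨v, by ring⟩⟩

theorem iSup_rootNormSpace [FiniteDimensional K L] (β : L ≃ₗ[K] L) :
    ⨆ r : ℝ, rootNormSpace β (· = r) = ⊤ := by
  rw [eq_top_iff]
  intro x _
  exact mem_iSup_rootNormSpace_of_aeval β _ (LinearMap.charpoly_monic (β : Module.End K L)).ne_zero
    x (by rw [LinearMap.aeval_self_charpoly, LinearMap.zero_apply])

theorem iSupIndep_rootNormSpace (β : L ≃ₗ[K] L) :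
    iSupIndep fun r : ℝ ↦ rootNormSpace β (· = r) := by
  intro r
  refine (disjoint_rootNormSpace (q := (· ≠ r)) fun t ht hn ↦ hn ht).mono_right ?_
  exact iSup₂_le fun s hs ↦ rootNormSpace_mono fun t ht ↦ ht ▸ hs

theorem rootNorms_charpoly [FiniteDimensional K L] (β : L ≃ₗ[K] L) :
    RootNorms (β : Module.End K L).charpoly (0 < ·) := by
  refine ⟨(LinearMap.charpoly_monic _).ne_zero, fun θ hθ ↦
    spectralNorm_zero_lt ?_ (Algebra.IsAlgebraic.isAlgebraic θ)⟩
  rintro rfl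
  rw [aeval_def, eval₂_at_zero, map_eq_zero] at hθ
  have h1 := LinearMap.det_eq_sign_charpoly_coeff (β : Module.End K L)
  rw [hθ, mul_zero] at h1
  exact (LinearEquiv.isUnit_det' β).ne_zero h1

theorem rootNormSpace_eq_bot_of_nonpos [FiniteDimensional K L] (β : L ≃ₗ[K] L) {r : ℝ}
    (hr : r ≤ 0) : rootNormSpace β (· = r) = ⊥ := by
  rw [← (disjoint_rootNormSpace (β := β) (p := (· = r)) (q := (0 < ·))
    fun t ht hn ↦ by linarith).eq_bot]
  refine le_antisymm (le_inf le_rfl fun x _ ↦ ⟨_, rootNorms_charpoly β, ?_⟩) inf_le_left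
  rw [LinearMap.aeval_self_charpoly, LinearMap.zero_apply]

end Algebra

variable {K : Type*} [NontriviallyNormedField K] [IsUltrametricDist K] [CompleteSpace K]
  {L : Type*} [AddCommGroup L] [Module K L] {β : L ≃ₗ[K] L}

theorem exists_norm_zpow_le_of_mem_rootNormSpace {r : ℝ} (hr : 0 < r) {x : L}
    (hx : x ∈ rootNormSpace β (· = r)) (ℓ : L →ₗ[K] K) :
    ∃ B : ℝ, 0 ≤ B ∧ ∀ n : ℤ, ‖ℓ ((β ^ n) x)‖ ≤ B * r ^ n := by
  obtain ⟨P, hP, hx⟩ := hx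
  obtain ⟨B₁, h1⟩ := (hP.mono fun t ht ↦ ht.le).norm_forward_le hr hx ℓ
  obtain ⟨B₂, h2⟩ := (hP.mono fun t ht ↦ ht.ge).norm_backward_le hr hx ℓ
  refine ⟨max B₁ B₂, ?_, fun n ↦ ?_⟩
  · exact le_max_of_le_left (by simpa using (norm_nonneg _).trans (h1 0))
  · obtain ⟨n, rfl | rfl⟩ := n.eq_nat_or_neg
    · refine (h1 n).trans ?_
      rw [zpow_natCast]
      gcongr
      exact le_max_left _ _
    · refine (h2 n).trans ?_
      rw [zpow_neg, zpow_natCast, inv_pow]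
      gcongr
      exact le_max_right _ _

/-- An invariant bilinear map multiplies growth rates. -/
theorem bilin_mem_rootNormSpace [FiniteDimensional K L] {b : L →ₗ[K] L →ₗ[K] L}
    (hb : ∀ x y, β (b x y) = b (β x) (β y)) {r s : ℝ} (hr : 0 < r) (hs : 0 < s) {x y : L}
    (hx : x ∈ rootNormSpace β (· = r)) (hy : y ∈ rootNormSpace β (· = s)) :
    b x y ∈ rootNormSpace β (· = r * s) := by
  have hbn : ∀ (n : ℤ) x y, (β ^ n) (b x y) = b ((β ^ n) x) ((β ^ n) y) := by
    have hnat : ∀ (n : ℕ) x y, (β ^ n) (b x y) = b ((β ^ n) x) ((β ^ n) y) := by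
      intro n
      induction n with
      | zero => simp
      | succ n ih =>
        intro x y
        simp only [pow_succ, LinearEquiv.mul_apply, hb, ih]
    intro n x y
    obtain ⟨n, rfl | rfl⟩ := n.eq_nat_or_neg
    · simpa using hnat n x y
    · have h1 : ∀ z, (β ^ n) ((β ^ (-(n : ℤ))) z) = z := fun z ↦ by
        rw [← LinearEquiv.mul_apply, ← zpow_natCast, ← zpow_add, add_neg_cancel, zpow_zero]
        rfl
      apply (β ^ n).injective
      rw [hnat, h1, h1, h1]
  have hgrow : ∀ ℓ : L →ₗ[K] K, ∃ B : ℝ, ∀ n : ℤ, ‖ℓ ((β ^ n) (b x y))‖ ≤ B * (r * s) ^ n := by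
    intro ℓ
    let e := Module.finBasis K L
    choose B hB0 hB using fun i ↦ exists_norm_zpow_le_of_mem_rootNormSpace hr hx (e.coord i)
    choose B' hB0' hB' using fun i ↦ exists_norm_zpow_le_of_mem_rootNormSpace hs hy (e.coord i)
    refine ⟨∑ i, ∑ j, B i * B' j * ‖ℓ (b (e i) (e j))‖, fun n ↦ ?_⟩
    have key : ℓ ((β ^ n) (b x y)) = ∑ i, ∑ j,
        e.coord i ((β ^ n) x) * e.coord j ((β ^ n) y) * ℓ (b (e i) (e j)) := by
      rw [hbn]
      conv_lhs => rw [← e.sum_repr ((β ^ n) x), ← e.sum_repr ((β ^ n) y)]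
      simp only [map_sum, map_smul, LinearMap.sum_apply, LinearMap.smul_apply, smul_eq_mul,
        Module.Basis.coord_apply, Finset.mul_sum, mul_assoc]
      rw [Finset.sum_comm]
      refine Finset.sum_congr rfl fun i _ ↦ Finset.sum_congr rfl fun j _ ↦ ?_
      ring
    rw [key, Finset.sum_mul]
    refine (norm_sum_le _ _).trans (Finset.sum_le_sum fun i _ ↦ ?_)
    rw [Finset.sum_mul]
    refine (norm_sum_le _ _).trans (Finset.sum_le_sum fun j _ ↦ ?_)
    rw [norm_mul, norm_mul, mul_zpow]
    calc _ ≤ (B i * r ^ n) * (B' j * s ^ n) * ‖ℓ (b (e i) (e j))‖ := by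
          gcongr
          · exact mul_nonneg (hB0 i) (zpow_nonneg hr.le n)
          · exact hB i n
          · exact hB' j n
      _ = _ := by ring
  -- the part of `b x y` away from the rate `r * s` vanishes
  obtain ⟨P₁, P₂, hP, h1, h2⟩ := exists_rootNorms_mul (· = r * s) _
    (LinearMap.charpoly_monic (β : Module.End K L)).ne_zero
  refine ⟨P₁, h1, h2.eq_zero_of_growth (β := β) (mul_pos hr hs) ?_ fun ℓ ↦ ?_⟩
  · rw [← Module.End.mul_apply, ← map_mul, mul_comm, ← hP, LinearMap.aeval_self_charpoly,
      LinearMap.zero_apply]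
  · obtain ⟨B, hB⟩ := hgrow (ℓ ∘ₗ aeval (β : Module.End K L) P₁)
    refine ⟨B, fun n ↦ ?_⟩
    have hcomm : (β ^ n) (aeval (β : Module.End K L) P₁ (b x y)) =
        aeval (β : Module.End K L) P₁ ((β ^ n) (b x y)) := by
      refine map_aeval_of_intertwine (φ := ((β ^ n : L ≃ₗ[K] L) : L →ₗ[K] L)) (fun z ↦ ?_) P₁ _
      simp only [LinearEquiv.coe_coe, ← LinearEquiv.mul_apply]
      rw [(Commute.self_zpow β n).eq]
    rw [hcomm]
    exact hB n

theorem lt_one_of_rootNormSpace_ne_bot [FiniteDimensional K L]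
    (hβ : ∀ (x : L) (ℓ : L →ₗ[K] K), Tendsto (fun n : ℕ ↦ ℓ ((β ^ (n : ℤ)) x)) atTop (𝓝 0))
    {r : ℝ} (hr : rootNormSpace β (· = r) ≠ ⊥) : r < 1 := by
  by_contra hcon
  refine hr ((Submodule.eq_bot_iff _).2 ?_)
  rintro x ⟨P, hP, hx⟩
  exact (hP.mono fun t ht ↦ by linarith).eq_zero_of_tendsto hx (hβ x)

end RootNormSpace

/-! ### Positive gradings of Lie algebras with a contractive automorphism -/

section Weights

open Filter Polynomial

/-- Perturbing real coordinates to rational ones: a `ℚ`-basis of the span of `S` consists of real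
numbers, and replacing these by nearby rationals keeps the finitely many signs. -/
theorem exists_rat_linear_pos (S : Finset ℝ) (hS : ∀ x ∈ S, x < 0) :
    ∃ f : ℝ →ₗ[ℚ] ℚ, ∀ x ∈ S, 0 < f x := by
  classical
  let V : Submodule ℚ ℝ := Submodule.span ℚ (S : Set ℝ)
  have : FiniteDimensional ℚ V := FiniteDimensional.span_finset ℚ S
  let e := Module.finBasis ℚ V
  let Φ : S → (Fin (Module.finrank ℚ V) → ℝ) → ℝ := fun x t ↦
    ∑ i, ((e.repr ⟨x, Submodule.subset_span x.2⟩ i : ℚ) : ℝ) * t i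
  have hopen : IsOpen {t | ∀ x : S, Φ x t < 0} := by
    simp only [Set.ofPred_forall]
    refine isOpen_iInter_of_finite fun x ↦ isOpen_lt ?_ continuous_const
    fun_prop
  have hne : (fun i ↦ ((e i : V) : ℝ)) ∈ {t | ∀ x : S, Φ x t < 0} := by
    intro x
    have h := congrArg (Subtype.val) (e.sum_repr ⟨x, Submodule.subset_span x.2⟩)
    simp only [Submodule.coe_sum, Submodule.coe_smul, Rat.smul_def] at h
    simp only [Φ, h]
    exact hS x x.2
  have hdense : DenseRange (Pi.map fun (_ : Fin (Module.finrank ℚ V)) (q : ℚ) ↦ (q : ℝ)) :=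
    DenseRange.piMap fun _ ↦ Rat.denseRange_cast
  obtain ⟨q, hq⟩ := hdense.exists_mem_open hopen ⟨_, hne⟩
  let g : V →ₗ[ℚ] ℚ := e.constr ℚ fun i ↦ -q i
  obtain ⟨f, hf⟩ := g.exists_extend
  refine ⟨f, fun x hx ↦ ?_⟩
  have h1 : f x = g ⟨x, Submodule.subset_span hx⟩ := by rw [← hf]; rfl
  have h2 := hq ⟨x, hx⟩
  rw [h1, Module.Basis.constr_apply_fintype]
  simp only [Φ, Pi.map] at h2
  have h3 : ((∑ i, e.repr ⟨x, Submodule.subset_span hx⟩ i * q i : ℚ) : ℝ) < 0 := by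
    push_cast
    exact h2
  have h4 : (∑ i, e.repr ⟨x, Submodule.subset_span hx⟩ i * q i : ℚ) < 0 := by exact_mod_cast h3
  simpa [Module.Basis.equivFun_apply] using h4

/-- This turns the logarithms of growth rates into weights that are positive integers, in a way that
is compatible with products of growth rates. -/
theorem exists_nat_linear_pos (S : Finset ℝ) (hS : ∀ x ∈ S, x < 0) :
    ∃ (f : ℝ →ₗ[ℚ] ℚ) (n : ℕ), ∀ x ∈ S, ∃ k ∈ Finset.Icc 1 n, f x = k := by
  obtain ⟨f, hf⟩ := exists_rat_linear_pos S hS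
  set N : ℕ := ∏ x ∈ S, (f x).den with hN
  have hNpos : 0 < N := Finset.prod_pos fun x _ ↦ (f x).den_pos
  have key : ∀ x ∈ S, ∃ k : ℕ, 1 ≤ k ∧ (N : ℚ) * f x = k := by
    intro x hx
    obtain ⟨m, hm⟩ := Finset.dvd_prod_of_mem (fun x ↦ (f x).den) hx
    have hm0 : 0 < m := by
      rcases Nat.eq_zero_or_pos m with rfl | h
      · rw [mul_zero] at hm; omega
      · exact h
    have h1 : (N : ℚ) * f x = ((f x).num.toNat * m : ℕ) := by
      have h2 : ((f x).num.toNat : ℤ) = (f x).num :=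
        Int.toNat_of_nonneg (Rat.num_pos.2 (hf x hx)).le
      have h3 : ((f x).num.toNat : ℚ) = ((f x).num : ℚ) := by exact_mod_cast h2
      rw [hN, hm, Nat.cast_mul, Nat.cast_mul, h3, mul_right_comm, Rat.den_mul_eq_num]
    refine ⟨_, ?_, h1⟩
    have h4 : (0 : ℚ) < ((f x).num.toNat * m : ℕ) := by
      rw [← h1]
      exact mul_pos (by exact_mod_cast hNpos) (hf x hx)
    exact_mod_cast h4
  choose! k hk1 hk using key
  refine ⟨(N : ℚ) • f, S.sup k, fun x hx ↦ ⟨k x, Finset.mem_Icc.2 ⟨hk1 x hx, Finset.le_sup hx⟩, ?_⟩⟩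
  simpa using hk x hx

/-- An alternating bilinear bracket satisfying the Jacobi identity, with a derivation `D` that is
diagonalizable with eigenvalues among `1, …, n`: a finite grading of a Lie algebra by positive
integers. -/
structure IsPositiveGrading {K L : Type*} [Field K] [AddCommGroup L] [Module K L]
    (b : L →ₗ[K] L →ₗ[K] L) (n : ℕ) (D : Module.End K L) : Prop where
  alt : ∀ x, b x x = 0
  jacobi : ∀ x y z, b x (b y z) = b (b x y) z + b y (b x z)
  derivation : ∀ x y, D (b x y) = b (D x) y + b x (D y)
  annihilates : aeval D (∏ i ∈ Finset.Icc 1 n, (X - C (i : K))) = 0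

variable {K : Type*} [NontriviallyNormedField K]
  {L : Type*} [AddCommGroup L] [Module K L]
  {L' : Type*} [AddCommGroup L'] [Module K L']

/-- `D` multiplies each vector of growth rate `r` under `β` by `w r`. -/
def IsWeightOperator (β : L ≃ₗ[K] L) (w : ℝ → K) (D : Module.End K L) : Prop :=
  ∀ r, ∀ x ∈ rootNormSpace β (· = r), D x = w r • x

theorem exists_isWeightOperator [FiniteDimensional K L] (β : L ≃ₗ[K] L) (w : ℝ → K) :
    ∃ D, IsWeightOperator β w D := by
  classical
  let N : ℝ → Submodule K L := fun r ↦ rootNormSpace β (· = r)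
  have hint : DirectSum.IsInternal N := DirectSum.isInternal_submodule_of_iSupIndep_of_iSup_eq_top
    (iSupIndep_rootNormSpace β) (iSup_rootNormSpace β)
  let e := LinearEquiv.ofBijective (DirectSum.coeLinearMap N) hint
  refine ⟨(DirectSum.toModule K ℝ L fun r ↦ w r • (N r).subtype) ∘ₗ e.symm.toLinearMap,
    fun r x hx ↦ ?_⟩
  have h : e.symm x = DirectSum.lof K ℝ (fun r ↦ N r) r ⟨x, hx⟩ := by
    rw [LinearEquiv.symm_apply_eq]
    exact (DirectSum.coeLinearMap_lof N r ⟨x, hx⟩).symm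
  rw [LinearMap.comp_apply, LinearEquiv.coe_coe, h]
  simp

theorem rootNormSpace_induction [FiniteDimensional K L] (β : L ≃ₗ[K] L) {p : L → Prop}
    (h0 : p 0) (hadd : ∀ x y, p x → p y → p (x + y))
    (hmem : ∀ r, ∀ x ∈ rootNormSpace β (· = r), p x) (x : L) : p x :=
  Submodule.iSup_induction (motive := p) (fun r : ℝ ↦ rootNormSpace β (· = r)) (x := x)
    (by rw [iSup_rootNormSpace]; trivial) hmem h0 hadd

theorem IsWeightOperator.map_comm [FiniteDimensional K L] {β : L ≃ₗ[K] L} {β' : L' ≃ₗ[K] L'}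
    {w : ℝ → K} {D : Module.End K L} {D' : Module.End K L'} (hD : IsWeightOperator β w D)
    (hD' : IsWeightOperator β' w D') {φ : L →ₗ[K] L'} (hφ : ∀ x, φ (β x) = β' (φ x)) (x : L) :
    φ (D x) = D' (φ x) := by
  induction x using rootNormSpace_induction β with
  | h0 => simp
  | hadd x y hx hy => simp [hx, hy]
  | hmem r x hx => rw [hD r x hx, hD' r _ (map_mem_rootNormSpace hφ hx), map_smul]

theorem finite_rootNormSpace_ne_bot [FiniteDimensional K L] (β : L ≃ₗ[K] L) :
    {r : ℝ | rootNormSpace β (· = r) ≠ ⊥}.Finite :=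
  WellFoundedGT.finite_ne_bot_of_iSupIndep (iSupIndep_rootNormSpace β)

variable [IsUltrametricDist K] [CompleteSpace K] [CharZero K]
  [FiniteDimensional K L] [FiniteDimensional K L']

theorem IsWeightOperator.isPositiveGrading {β : L ≃ₗ[K] L} {f : ℝ →ₗ[ℚ] ℚ} {n : ℕ}
    (hf : ∀ r, rootNormSpace β (· = r) ≠ ⊥ → ∃ k ∈ Finset.Icc 1 n, f (Real.log r) = k)
    {D : Module.End K L} (hD : IsWeightOperator β (fun r ↦ (f (Real.log r) : K)) D)
    {b : L →ₗ[K] L →ₗ[K] L} (halt : ∀ x, b x x = 0)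
    (hjac : ∀ x y z, b x (b y z) = b (b x y) z + b y (b x z))
    (hb : ∀ x y, β (b x y) = b (β x) (β y)) : IsPositiveGrading b n D where
  alt := halt
  jacobi := hjac
  derivation x y := by
    induction x using rootNormSpace_induction β with
    | h0 => simp
    | hadd x x' hx hx' =>
      simp only [map_add, LinearMap.add_apply, hx, hx']
      abel
    | hmem r x hx =>
      induction y using rootNormSpace_induction β with
      | h0 => simp
      | hadd y y' hy hy' =>
        simp only [map_add, hy, hy']
        abel
      | hmem s y hy =>
        rcases le_or_gt r 0 with hr | hr
        · rw [rootNormSpace_eq_bot_of_nonpos β hr, Submodule.mem_bot] at hx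
          simp [hx]
        rcases le_or_gt s 0 with hs | hs
        · rw [rootNormSpace_eq_bot_of_nonpos β hs, Submodule.mem_bot] at hy
          simp [hy]
        rw [hD r x hx, hD s y hy, hD (r * s) _ (bilin_mem_rootNormSpace hb hr hs hx hy)]
        simp [Real.log_mul hr.ne' hs.ne', add_smul]
  annihilates := by
    ext x
    rw [LinearMap.zero_apply]
    induction x using rootNormSpace_induction β with
    | h0 => simp
    | hadd x y hx hy => rw [map_add, hx, hy, add_zero]
    | hmem r x hx =>
      by_cases hr : rootNormSpace β (· = r) = ⊥
      · rw [hr, Submodule.mem_bot] at hx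
        rw [hx, map_zero]
      obtain ⟨k, hk, hfk⟩ := hf r hr
      rw [← Finset.prod_erase_mul _ _ hk, map_mul, Module.End.mul_apply]
      have : aeval D (X - C (k : K)) x = 0 := by
        simp [hD r x hx, hfk, Nat.cast_smul_eq_nsmul]
      rw [this, map_zero]

/-- Contractive automorphisms of two Lie algebras give positive gradings of both which all
intertwining maps preserve. The grading is by growth rates, turned into positive integers by one
`ℚ`-linear functional applied to their logarithms. -/
theorem exists_isPositiveGrading {β : L ≃ₗ[K] L} {b : L →ₗ[K] L →ₗ[K] L}
    (hβ : ∀ (x : L) (ℓ : L →ₗ[K] K), Tendsto (fun n : ℕ ↦ ℓ ((β ^ (n : ℤ)) x)) atTop (𝓝 0))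
    (halt : ∀ x, b x x = 0) (hjac : ∀ x y z, b x (b y z) = b (b x y) z + b y (b x z))
    (hb : ∀ x y, β (b x y) = b (β x) (β y))
    {β' : L' ≃ₗ[K] L'} {b' : L' →ₗ[K] L' →ₗ[K] L'}
    (hβ' : ∀ (x : L') (ℓ : L' →ₗ[K] K), Tendsto (fun n : ℕ ↦ ℓ ((β' ^ (n : ℤ)) x)) atTop (𝓝 0))
    (halt' : ∀ x, b' x x = 0) (hjac' : ∀ x y z, b' x (b' y z) = b' (b' x y) z + b' y (b' x z))
    (hb' : ∀ x y, β' (b' x y) = b' (β' x) (β' y)) :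
    ∃ (n : ℕ) (D : Module.End K L) (D' : Module.End K L'),
      IsPositiveGrading b n D ∧ IsPositiveGrading b' n D' ∧
      (∀ x, β (D x) = D (β x)) ∧ (∀ x, β' (D' x) = D' (β' x)) ∧
      ∀ φ : L →ₗ[K] L', (∀ x, φ (β x) = β' (φ x)) → ∀ x, φ (D x) = D' (φ x) := by
  classical
  let S : Finset ℝ := ((finite_rootNormSpace_ne_bot β).union
    (finite_rootNormSpace_ne_bot β')).toFinset
  have hS : ∀ r, r ∈ S ↔ rootNormSpace β (· = r) ≠ ⊥ ∨ rootNormSpace β' (· = r) ≠ ⊥ := by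
    intro r
    simp [S]
  obtain ⟨f, n, hf⟩ := exists_nat_linear_pos (S.image Real.log) (by
    intro x hx
    obtain ⟨r, hr, rfl⟩ := Finset.mem_image.1 hx
    rcases (hS r).1 hr with h | h
    · exact Real.log_neg (not_le.1 fun h0 ↦ h (rootNormSpace_eq_bot_of_nonpos β h0))
        (lt_one_of_rootNormSpace_ne_bot hβ h)
    · exact Real.log_neg (not_le.1 fun h0 ↦ h (rootNormSpace_eq_bot_of_nonpos β' h0))
        (lt_one_of_rootNormSpace_ne_bot hβ' h))
  obtain ⟨D, hD⟩ := exists_isWeightOperator β fun r ↦ (f (Real.log r) : K)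
  obtain ⟨D', hD'⟩ := exists_isWeightOperator β' fun r ↦ (f (Real.log r) : K)
  exact ⟨n, D, D',
    hD.isPositiveGrading (fun r hr ↦ hf _ (Finset.mem_image_of_mem _ ((hS r).2 (Or.inl hr))))
      halt hjac hb,
    hD'.isPositiveGrading (fun r hr ↦ hf _ (Finset.mem_image_of_mem _ ((hS r).2 (Or.inr hr))))
      halt' hjac' hb',
    hD.map_comm hD (φ := β.toLinearMap) fun _ ↦ rfl,
    hD'.map_comm hD' (φ := β'.toLinearMap) fun _ ↦ rfl,
    fun φ hφ ↦ hD.map_comm hD' hφ⟩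

end Weights

/-! ### Conjugators -/

section GradedGroup

open Polynomial

variable {K L : Type*} [Field K] [AddCommGroup L] [Module K L]
  {L' : Type*} [AddCommGroup L'] [Module K L']

theorem aeval_apply_of_apply_eq_smul {f : Module.End K L} {μ : K} {y : L} (hy : f y = μ • y)
    (P : K[X]) : aeval f P y = P.eval μ • y := by
  induction P using Polynomial.induction_on' with
  | add p q hp hq => simp [hp, hq, add_smul]
  | monomial n a =>
    have h : (f ^ n) y = μ ^ n • y := by
      induction n with
      | zero => simp
      | succ n ih => rw [pow_succ, Module.End.mul_apply, hy, map_smul, ih, smul_smul, pow_succ']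
    rw [aeval_monomial, Module.End.mul_apply, h]
    simp [Module.algebraMap_end_apply, smul_smul, mul_comm]

/-- The sum of the eigenspaces of `D` for the integers `≥ k`. -/
def weightFiltration (D : Module.End K L) (k : ℕ) : Submodule K L :=
  ⨆ i : {i : ℕ // k ≤ i}, Module.End.eigenspace D (i : K)

theorem mem_weightFiltration_of_apply_eq_smul {D : Module.End K L} {k i : ℕ} (hi : k ≤ i) {y : L}
    (hy : D y = (i : K) • y) : y ∈ weightFiltration D k :=
  Submodule.mem_iSup_of_mem ⟨i, hi⟩ (Module.End.mem_eigenspace_iff.2 hy)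

theorem weightFiltration_induction {D : Module.End K L} {k : ℕ} {p : L → Prop} (h0 : p 0)
    (hadd : ∀ x y, p x → p y → p (x + y))
    (hmem : ∀ i, k ≤ i → ∀ y, D y = (i : K) • y → p y) {x : L} (hx : x ∈ weightFiltration D k) :
    p x :=
  Submodule.iSup_induction (motive := p)
    (fun i : {i : ℕ // k ≤ i} ↦ Module.End.eigenspace D (i : K)) hx
    (fun i y hy ↦ hmem i i.2 y (Module.End.mem_eigenspace_iff.1 hy)) h0 hadd

theorem weightFiltration_antitone (D : Module.End K L) : Antitone (weightFiltration D) :=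
  fun _ _ hkl _ hx ↦ weightFiltration_induction (zero_mem _) (fun _ _ ↦ add_mem)
    (fun _ hi _ hy ↦ mem_weightFiltration_of_apply_eq_smul (hkl.trans hi) hy) hx

theorem apply_mem_weightFiltration {D : Module.End K L} {k : ℕ} {x : L}
    (hx : x ∈ weightFiltration D k) : D x ∈ weightFiltration D k :=
  weightFiltration_induction (p := fun x ↦ D x ∈ weightFiltration D k) (by simp)
    (fun x y hx hy ↦ by rw [map_add]; exact add_mem hx hy)
    (fun i hi y hy ↦ by
      rw [hy]
      exact Submodule.smul_mem _ _ (mem_weightFiltration_of_apply_eq_smul hi hy)) hx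

/-- The derivation `D` twisted by the inner derivation of `c`. -/
def twist (b : L →ₗ[K] L →ₗ[K] L) (D : Module.End K L) (c : L) : Module.End K L := D - b c

/-- The operator that carries each eigenspace of `D` to the eigenspace of `D - b c` for the same
eigenvalue. It is given by Lagrange interpolation: the `i`-th summand projects to the `i`-th
eigenspace of `D`, then to that of `D - b c`. -/
noncomputable def conjugator (b : L →ₗ[K] L →ₗ[K] L) (n : ℕ) (D : Module.End K L) (c : L) :
    Module.End K L :=
  ∑ i ∈ Finset.Icc 1 n,
    aeval (twist b D c) (Lagrange.basis (Finset.Icc 1 n) (fun j : ℕ ↦ (j : K)) i) *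
      aeval D (Lagrange.basis (Finset.Icc 1 n) (fun j : ℕ ↦ (j : K)) i)

theorem map_conjugator {b : L →ₗ[K] L →ₗ[K] L} {b' : L' →ₗ[K] L' →ₗ[K] L'} {n : ℕ}
    {D : Module.End K L} {D' : Module.End K L'} {φ : L →ₗ[K] L'}
    (hb : ∀ x y, φ (b x y) = b' (φ x) (φ y)) (hD : ∀ x, φ (D x) = D' (φ x)) (c y : L) :
    φ (conjugator b n D c y) = conjugator b' n D' (φ c) (φ y) := by
  simp only [conjugator, LinearMap.sum_apply, map_sum, Module.End.mul_apply]
  refine Finset.sum_congr rfl fun i _ ↦ ?_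
  rw [map_aeval_of_intertwine (f' := twist b' D' (φ c)) (fun x ↦ by simp [twist, hb, hD]),
    map_aeval_of_intertwine hD]

theorem X_sub_C_mul_basis (s : Finset ℕ) {i : ℕ} (hi : i ∈ s) :
    ∃ a : K, (X - C (i : K)) * Lagrange.basis s (fun j : ℕ ↦ (j : K)) i =
      C a * ∏ j ∈ s, (X - C (j : K)) := by
  refine ⟨∏ j ∈ s.erase i, ((i : K) - j)⁻¹, ?_⟩
  simp only [Lagrange.basis, Lagrange.basisDivisor, Finset.prod_mul_distrib, ← map_prod]
  rw [← Finset.mul_prod_erase s _ hi]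
  ring

namespace IsPositiveGrading

variable {b : L →ₗ[K] L →ₗ[K] L} {n : ℕ} {D : Module.End K L}
  (h : IsPositiveGrading b n D)

include h

theorem bracket_mem {k l : ℕ} {x y : L} (hx : x ∈ weightFiltration D k)
    (hy : y ∈ weightFiltration D l) : b x y ∈ weightFiltration D (k + l) := by
  refine weightFiltration_induction (p := fun x ↦ b x y ∈ weightFiltration D (k + l)) (by simp)
    (fun x x' hx hx' ↦ by rw [map_add]; exact add_mem hx hx') (fun i hi x hx ↦ ?_) hx
  refine weightFiltration_induction (p := fun y ↦ b x y ∈ weightFiltration D (k + l)) (by simp)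
    (fun y y' hy hy' ↦ by rw [map_add]; exact add_mem hy hy') (fun j hj y hy ↦ ?_) hy
  refine mem_weightFiltration_of_apply_eq_smul (add_le_add hi hj) ?_
  rw [h.derivation, hx, hy]
  simp [add_smul]

theorem twist_derivation (c x y : L) :
    twist b D c (b x y) = b (twist b D c x) y + b x (twist b D c y) := by
  simp only [twist, LinearMap.sub_apply, h.derivation, h.jacobi c x y, map_sub]
  abel

variable [CharZero K]

theorem weightFiltration_eq_top : weightFiltration D 1 = ⊤ := by
  rw [eq_top_iff]
  intro y _
  have hq := h.annihilates
  have hinj : Set.InjOn (fun j : ℕ ↦ (j : K)) (Finset.Icc 1 n) := Nat.cast_injective.injOn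
  rcases (Finset.Icc 1 n).eq_empty_or_nonempty with he | hne
  · rw [he] at hq
    have : y = 0 := by simpa using LinearMap.congr_fun hq y
    rw [this]
    exact zero_mem _
  · have h1 : y = ∑ i ∈ Finset.Icc 1 n,
        aeval D (Lagrange.basis (Finset.Icc 1 n) (fun j : ℕ ↦ (j : K)) i) y := by
      rw [← LinearMap.sum_apply, ← map_sum, Lagrange.sum_basis hinj hne, map_one,
        Module.End.one_apply]
    rw [h1]
    refine sum_mem fun i hi ↦ mem_weightFiltration_of_apply_eq_smul (Finset.mem_Icc.1 hi).1 ?_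
    obtain ⟨a, ha⟩ := X_sub_C_mul_basis (K := K) _ hi
    have h2 := LinearMap.congr_fun (congrArg (aeval D) ha) y
    rw [map_mul, map_mul, hq, mul_zero, LinearMap.zero_apply, Module.End.mul_apply] at h2
    simp only [map_sub, aeval_X, aeval_C, LinearMap.sub_apply, Module.algebraMap_end_apply] at h2
    exact sub_eq_zero.1 h2

theorem induction {p : L → Prop} (h0 : p 0) (hadd : ∀ x y, p x → p y → p (x + y))
    (hmem : ∀ i : ℕ, 1 ≤ i → ∀ y, D y = (i : K) • y → p y) (x : L) : p x :=
  weightFiltration_induction (k := 1) h0 hadd hmem (by rw [h.weightFiltration_eq_top]; trivial)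

theorem eq_zero_of_apply_eq_smul {i : ℕ} (hi : i ∉ Finset.Icc 1 n) {y : L}
    (hy : D y = (i : K) • y) : y = 0 := by
  have h1 := LinearMap.congr_fun h.annihilates y
  rw [aeval_apply_of_apply_eq_smul hy, LinearMap.zero_apply, eval_prod, smul_eq_zero,
    Finset.prod_eq_zero_iff] at h1
  refine h1.resolve_left ?_
  rintro ⟨j, hj, hij⟩
  simp only [eval_sub, eval_X, eval_C, sub_eq_zero, Nat.cast_inj] at hij
  exact hi (hij ▸ hj)

theorem weightFiltration_eq_bot {k : ℕ} (hk : n < k) : weightFiltration D k = ⊥ := by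
  rw [Submodule.eq_bot_iff]
  intro x hx
  refine weightFiltration_induction (p := fun x : L ↦ x = (0 : L)) rfl
    (fun x y hx hy ↦ by rw [hx, hy, add_zero])
    (fun i hi y hy ↦ h.eq_zero_of_apply_eq_smul ?_ hy) hx
  simp only [Finset.mem_Icc, not_and, not_le]
  omega

theorem bracket_mem_succ {k : ℕ} (x : L) {y : L} (hy : y ∈ weightFiltration D k) :
    b x y ∈ weightFiltration D (k + 1) := by
  rw [add_comm]
  exact h.bracket_mem (by rw [h.weightFiltration_eq_top]; trivial) hy

theorem twist_mem (c : L) {k : ℕ} {y : L} (hy : y ∈ weightFiltration D k) :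
    twist b D c y ∈ weightFiltration D k := by
  rw [twist, LinearMap.sub_apply]
  exact sub_mem (apply_mem_weightFiltration hy)
    (weightFiltration_antitone D (Nat.le_succ k) (h.bracket_mem_succ c hy))

theorem twist_sub_mem (c : L) {k : ℕ} {y : L} (hy : y ∈ weightFiltration D k) :
    twist b D c y - (k : K) • y ∈ weightFiltration D (k + 1) := by
  have h1 : D y - (k : K) • y ∈ weightFiltration D (k + 1) := by
    refine weightFiltration_induction (p := fun y ↦ D y - (k : K) • y ∈ weightFiltration D (k + 1))
      (by simp) (fun x y hx hy ↦ ?_) (fun i hi y hy ↦ ?_) hy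
    · have := add_mem hx hy
      rw [map_add, smul_add]
      convert! this using 1
      abel
    · rcases hi.eq_or_lt with rfl | hlt
      · rw [hy, sub_self]
        exact zero_mem _
      · rw [hy, ← sub_smul]
        exact Submodule.smul_mem _ _ (mem_weightFiltration_of_apply_eq_smul hlt hy)
  have h2 := sub_mem h1 (h.bracket_mem_succ c hy)
  rw [twist, LinearMap.sub_apply]
  convert! h2 using 1
  abel

/-- An eigenvector of `D - b c` in the `k`-th step of the filtration has one of the eigenvalues
`k, k + 1, …`. -/
theorem eq_zero_of_twist_eq_smul (c : L) {k : ℕ} {μ : K} (hμ : ∀ j : ℕ, k ≤ j → μ ≠ j) {z : L}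
    (hz : z ∈ weightFiltration D k) (hTz : twist b D c z = μ • z) : z = 0 := by
  have key : ∀ m, k ≤ m → z ∈ weightFiltration D m := by
    intro m hm
    induction m, hm using Nat.le_induction with
    | base => exact hz
    | succ m hm ih =>
      have h1 := h.twist_sub_mem c ih
      rw [hTz, ← sub_smul] at h1
      exact (Submodule.smul_mem_iff _ (sub_ne_zero.2 (hμ m hm))).1 h1
  have h1 := key (max k (n + 1)) (le_max_left _ _)
  rwa [h.weightFiltration_eq_bot (lt_of_lt_of_le (Nat.lt_succ_self n) (le_max_right _ _)),
    Submodule.mem_bot] at h1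

/-- `D - b c` is diagonalizable with eigenvalues among those of `D`, since it differs from `D` by an
operator that raises the filtration. -/
theorem aeval_twist_prod (c : L) :
    aeval (twist b D c) (∏ i ∈ Finset.Icc 1 n, (X - C (i : K))) = 0 := by
  have key : ∀ d m, m + d = n + 1 → ∀ y ∈ weightFiltration D m,
      aeval (twist b D c) (∏ i ∈ Finset.Icc m n, (X - C (i : K))) y = 0 := by
    intro d
    induction d with
    | zero =>
      intro m hm y hy
      rw [h.weightFiltration_eq_bot (by omega), Submodule.mem_bot] at hy
      rw [hy, map_zero]
    | succ d ih =>
      intro m hm y hy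
      have e : Finset.Icc m n = insert m (Finset.Icc (m + 1) n) := by
        ext i
        simp only [Finset.mem_insert, Finset.mem_Icc]
        omega
      rw [e, Finset.prod_insert (by simp), mul_comm, map_mul, Module.End.mul_apply]
      refine ih (m + 1) (by omega) _ ?_
      simpa [Module.algebraMap_end_apply, Nat.cast_smul_eq_nsmul] using h.twist_sub_mem c hy
  ext y
  exact key n 1 (by omega) y (by rw [h.weightFiltration_eq_top]; trivial)

/-- The conjugator carries eigenspaces of `D` to eigenspaces of `D - b c`. -/
theorem twist_conjugator (c y : L) :
    twist b D c (conjugator b n D c y) = conjugator b n D c (D y) := by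
  simp only [conjugator, LinearMap.sum_apply, map_sum, Module.End.mul_apply]
  refine Finset.sum_congr rfl fun i hi ↦ ?_
  obtain ⟨a, ha⟩ := X_sub_C_mul_basis (K := K) _ hi
  have h1 : ∀ {f : Module.End K L}, aeval f (∏ i ∈ Finset.Icc 1 n, (X - C (i : K))) = 0 → ∀ z,
      f (aeval f (Lagrange.basis (Finset.Icc 1 n) (fun j : ℕ ↦ (j : K)) i) z) =
        (i : K) • aeval f (Lagrange.basis (Finset.Icc 1 n) (fun j : ℕ ↦ (j : K)) i) z := by
    intro f hf z
    have h2 := LinearMap.congr_fun (congrArg (aeval f) ha) z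
    rw [map_mul, map_mul, hf, mul_zero, LinearMap.zero_apply, Module.End.mul_apply] at h2
    simp only [map_sub, aeval_X, aeval_C, LinearMap.sub_apply, Module.algebraMap_end_apply] at h2
    exact sub_eq_zero.1 h2
  rw [h1 (h.aeval_twist_prod c), ← map_aeval_of_intertwine (φ := D) (f := D) (fun _ ↦ rfl),
    h1 h.annihilates, map_smul]

theorem conjugator_sub_mem_of_apply_eq_smul (c : L) {i : ℕ} {y : L} (hy : D y = (i : K) • y) :
    conjugator b n D c y - y ∈ weightFiltration D (i + 1) := by
  by_cases hi : i ∈ Finset.Icc 1 n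
  · have e : conjugator b n D c y =
        aeval (twist b D c) (Lagrange.basis (Finset.Icc 1 n) (fun j : ℕ ↦ (j : K)) i) y := by
      simp only [conjugator, LinearMap.sum_apply, Module.End.mul_apply]
      rw [Finset.sum_eq_single_of_mem i hi]
      · rw [aeval_apply_of_apply_eq_smul hy, Lagrange.eval_basis_self Nat.cast_injective.injOn hi,
          one_smul]
      · intro j hj hji
        rw [aeval_apply_of_apply_eq_smul hy,
          Lagrange.eval_basis_of_ne (v := fun j : ℕ ↦ (j : K)) hji hi, zero_smul, map_zero]
    have key : ∀ P : K[X], aeval (twist b D c) P y - P.eval (i : K) • y ∈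
        weightFiltration D (i + 1) := by
      have hyi := mem_weightFiltration_of_apply_eq_smul le_rfl hy
      intro P
      induction P using Polynomial.induction_on' with
      | add p q hp hq =>
        have := add_mem hp hq
        rw [map_add, eval_add, add_smul, LinearMap.add_apply]
        convert! this using 1
        abel
      | monomial k a =>
        have h2 : ((twist b D c) ^ k) y - (i : K) ^ k • y ∈ weightFiltration D (i + 1) := by
          induction k with
          | zero => simp
          | succ k ih =>
            have h3 := add_mem (h.twist_mem c ih)
              (Submodule.smul_mem _ ((i : K) ^ k) (h.twist_sub_mem c hyi))
            rw [pow_succ', Module.End.mul_apply]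
            convert! h3 using 1
            rw [map_sub, map_smul]
            module
        have := Submodule.smul_mem _ a h2
        rw [aeval_monomial, Module.End.mul_apply, eval_monomial]
        simpa [Module.algebraMap_end_apply, smul_sub, smul_smul] using this
    have := key (Lagrange.basis (Finset.Icc 1 n) (fun j : ℕ ↦ (j : K)) i)
    rwa [Lagrange.eval_basis_self (v := fun j : ℕ ↦ (j : K)) Nat.cast_injective.injOn hi, one_smul,
      ← e] at this
  · rw [h.eq_zero_of_apply_eq_smul hi hy]
    simp

theorem conjugator_sub_mem (c : L) {k : ℕ} {y : L} (hy : y ∈ weightFiltration D k) :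
    conjugator b n D c y - y ∈ weightFiltration D (k + 1) := by
  refine weightFiltration_induction
    (p := fun y ↦ conjugator b n D c y - y ∈ weightFiltration D (k + 1)) (by simp)
    (fun x y hx hy ↦ ?_) (fun i hi y hy ↦ weightFiltration_antitone D (Nat.succ_le_succ hi)
      (h.conjugator_sub_mem_of_apply_eq_smul c hy)) hy
  rw [map_add, add_sub_add_comm]
  exact add_mem hx hy

theorem conjugator_mem (c : L) {k : ℕ} {y : L} (hy : y ∈ weightFiltration D k) :
    conjugator b n D c y ∈ weightFiltration D k := by
  have := add_mem (weightFiltration_antitone D (Nat.le_succ k) (h.conjugator_sub_mem c hy)) hy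
  rwa [sub_add_cancel] at this

theorem eq_conjugator {c : L} {f : Module.End K L} (hf : ∀ y, twist b D c (f y) = f (D y))
    (hu : ∀ (i : ℕ) (y : L), D y = (i : K) • y → f y - y ∈ weightFiltration D (i + 1)) :
    f = conjugator b n D c := by
  ext x
  induction x using h.induction with
  | h0 => simp
  | hadd x y hx hy => rw [map_add, map_add, hx, hy]
  | hmem i hi y hy =>
    rw [← sub_eq_zero]
    refine h.eq_zero_of_twist_eq_smul c (k := i + 1) (μ := i) ?_ ?_ ?_
    · rintro j hj hij
      rw [Nat.cast_inj] at hij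
      omega
    · have := sub_mem (hu i y hy) (h.conjugator_sub_mem_of_apply_eq_smul c hy)
      rwa [sub_sub_sub_cancel_right] at this
    · rw [map_sub, hf, h.twist_conjugator, hy, map_smul, map_smul, smul_sub]

theorem conjugator_zero : conjugator b n D 0 = 1 :=
  (h.eq_conjugator (by simp [twist]) (by simp)).symm

theorem conjugator_bracket (c x y : L) :
    conjugator b n D c (b x y) = b (conjugator b n D c x) (conjugator b n D c y) := by
  induction x using h.induction with
  | h0 => simp
  | hadd x x' hx hx' => simp only [map_add, LinearMap.add_apply, hx, hx']
  | hmem i hi x hx =>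
    induction y using h.induction with
    | h0 => simp
    | hadd y y' hy hy' => simp only [map_add, hy, hy']
    | hmem j hj y hy =>
      have hx' := mem_weightFiltration_of_apply_eq_smul le_rfl hx
      have hy' := mem_weightFiltration_of_apply_eq_smul le_rfl hy
      have hxy : D (b x y) = ((i + j : ℕ) : K) • b x y := by
        rw [h.derivation, hx, hy]
        simp [add_smul]
      rw [← sub_eq_zero]
      refine h.eq_zero_of_twist_eq_smul c (k := i + j + 1) (μ := ((i + j : ℕ) : K)) ?_ ?_ ?_
      · rintro m hm hij
        rw [Nat.cast_inj] at hij
        omega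
      · have h1 := h.conjugator_sub_mem_of_apply_eq_smul c hxy
        have h2 := h.bracket_mem (h.conjugator_sub_mem c hx') (h.conjugator_mem c hy')
        have h3 := h.bracket_mem hx' (h.conjugator_sub_mem c hy')
        rw [add_right_comm] at h2
        have := sub_mem (sub_mem h1 h2) h3
        convert! this using 1
        simp only [map_sub, LinearMap.sub_apply]
        abel
      · rw [map_sub, h.twist_conjugator, h.twist_derivation, h.twist_conjugator,
          h.twist_conjugator, hxy, hx, hy]
        simp [smul_sub, add_smul]

/-- Associativity of the group law `c * c' = c + a(c) c'`, where `a(c)` is the conjugator. -/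
theorem conjugator_mul (c c' : L) :
    conjugator b n D (c + conjugator b n D c c') = conjugator b n D c * conjugator b n D c' := by
  refine (h.eq_conjugator (fun y ↦ ?_) fun i y hy ↦ ?_).symm
  · have h1 := h.twist_conjugator c (conjugator b n D c' y)
    have h2 := h.twist_conjugator c' y
    simp only [twist, LinearMap.sub_apply] at h1 h2
    simp only [twist, LinearMap.sub_apply, Module.End.mul_apply, map_add, LinearMap.add_apply]
    rw [← sub_sub, h1, ← h2, map_sub, h.conjugator_bracket]
  · have h1 := h.conjugator_sub_mem c (h.conjugator_mem c'
      (mem_weightFiltration_of_apply_eq_smul le_rfl hy))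
    have h2 := h.conjugator_sub_mem_of_apply_eq_smul c' hy
    have := add_mem h1 h2
    rwa [sub_add_sub_cancel] at this

theorem conjugator_injective (c : L) : Function.Injective (conjugator b n D c) := by
  rw [← LinearMap.ker_eq_bot, LinearMap.ker_eq_bot']
  intro y hy
  have key : ∀ m, 1 ≤ m → y ∈ weightFiltration D m := by
    intro m hm
    induction m, hm using Nat.le_induction with
    | base => rw [h.weightFiltration_eq_top]; trivial
    | succ m hm ih =>
      have := h.conjugator_sub_mem c ih
      rwa [hy, zero_sub, neg_mem_iff] at this
  have h1 := key (n + 1) (by omega)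
  rwa [h.weightFiltration_eq_bot (Nat.lt_succ_self n), Submodule.mem_bot] at h1

theorem derivation_injective : Function.Injective D := by
  rw [← LinearMap.ker_eq_bot, LinearMap.ker_eq_bot']
  intro y hy
  exact h.eq_zero_of_apply_eq_smul (i := 0) (by simp) (by simpa using hy)

/-- A map that raises the grading is determined by its commutator with `D`. -/
theorem eq_bracket_of_commutator {u : L} {f : Module.End K L}
    (hf : ∀ y, D (f y) - f (D y) = b (D u) y)
    (hu : ∀ (i : ℕ) (y : L), D y = (i : K) • y → f y ∈ weightFiltration D (i + 1)) :
    f = b u := by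
  ext x
  induction x using h.induction with
  | h0 => simp
  | hadd x y hx hy => rw [map_add, map_add, hx, hy]
  | hmem i hi y hy =>
    rw [← sub_eq_zero]
    refine h.eq_zero_of_twist_eq_smul 0 (k := i + 1) (μ := i) ?_ ?_ ?_
    · rintro j hj hij
      rw [Nat.cast_inj] at hij
      omega
    · exact sub_mem (hu i y hy)
        (h.bracket_mem_succ u (mem_weightFiltration_of_apply_eq_smul le_rfl hy))
    · have h1 := hf y
      rw [hy, map_smul] at h1
      have h2 : D (f y) = (i : K) • f y + b (D u) y := by rw [← h1]; abel
      simp only [twist, map_zero, sub_zero, map_sub, h2, h.derivation, hy, map_smul, smul_sub]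
      abel

end IsPositiveGrading

end GradedGroup

/-! ### Germs of analytic groups -/

section LocalGroup

open Filter

variable {K : Type*} [NontriviallyNormedField K]
  {E : Type*} [NormedAddCommGroup E] [NormedSpace K E]
  {E' : Type*} [NormedAddCommGroup E'] [NormedSpace K E']

/-- The germ at `(e, e)` of an analytic group law with identity `e`. Inverses are not part of the
structure, since they exist near `e` by the inverse function theorem. -/
structure IsLocalGroup (K : Type*) [NontriviallyNormedField K] {E : Type*} [NormedAddCommGroup E]
    [NormedSpace K E] (μ : E × E → E) (e : E) : Prop where
  analyticAt : AnalyticAt K μ (e, e)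
  one_mul : ∀ᶠ x in 𝓝 e, μ (e, x) = x
  mul_one : ∀ᶠ x in 𝓝 e, μ (x, e) = x
  assoc : ∀ᶠ t : E × E × E in 𝓝 (e, e, e), μ (μ (t.1, t.2.1), t.2.2) = μ (t.1, μ (t.2.1, t.2.2))

/-- The derivative of `μ` in its first variable. -/
noncomputable def dfst (K : Type*) [NontriviallyNormedField K] {E : Type*} [NormedAddCommGroup E]
    [NormedSpace K E] (μ : E × E → E) (p : E × E) : E →L[K] E :=
  (fderiv K μ p).comp (ContinuousLinearMap.inl K E E)

/-- The derivative of `μ` in its second variable. -/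
noncomputable def dsnd (K : Type*) [NontriviallyNormedField K] {E : Type*} [NormedAddCommGroup E]
    [NormedSpace K E] (μ : E × E → E) (p : E × E) : E →L[K] E :=
  (fderiv K μ p).comp (ContinuousLinearMap.inr K E E)

/-- The adjoint action of a local group, from `x y = (x y x⁻¹) x`: the tangent map at `e` of left
translation by `x` is that of conjugation followed by that of right translation. -/
noncomputable def localAd (K : Type*) [NontriviallyNormedField K] {E : Type*} [NormedAddCommGroup E]
    [NormedSpace K E] (μ : E × E → E) (e x : E) : E →L[K] E :=
  (dfst K μ (e, x)).inverse.comp (dsnd K μ (x, e))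

/-- The Lie bracket `ad v w` of a local group: the bracket at `e` of the left invariant vector
fields `x ↦ dsnd μ (x, e) v` and `x ↦ dsnd μ (x, e) w`. -/
noncomputable def localBracket (K : Type*) [NontriviallyNormedField K] {E : Type*}
    [NormedAddCommGroup E] [NormedSpace K E] (μ : E × E → E) (e : E) : E →L[K] E →L[K] E :=
  fderiv K (fun x ↦ dsnd K μ (x, e)) e - (fderiv K (fun x ↦ dsnd K μ (x, e)) e).flip

theorem localBracket_apply (μ : E × E → E) (e v w : E) :
    localBracket K μ e v w = fderiv K (fun x ↦ dsnd K μ (x, e)) e v w -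
      fderiv K (fun x ↦ dsnd K μ (x, e)) e w v := rfl

theorem hasFDerivAt_comp_pair {F : Type*} [NormedAddCommGroup F] [NormedSpace K F] {μ : E × E → E}
    {a b : F → E} {a' b' : F →L[K] E} {z : F} (hμ : DifferentiableAt K μ (a z, b z))
    (ha : HasFDerivAt a a' z) (hb : HasFDerivAt b b' z) :
    HasFDerivAt (fun z ↦ μ (a z, b z))
      ((dfst K μ (a z, b z)).comp a' + (dsnd K μ (a z, b z)).comp b') z := by
  have h := HasFDerivAt.comp z (f := fun z ↦ (a z, b z)) hμ.hasFDerivAt (ha.prodMk hb)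
  convert! h using 1
  ext v
  simp only [dfst, dsnd, add_apply, ContinuousLinearMap.comp_apply,
    ContinuousLinearMap.inl_apply, ContinuousLinearMap.inr_apply, ContinuousLinearMap.prod_apply]
  rw [← map_add, Prod.mk_add_mk, add_zero, zero_add]

theorem hasFDerivAt_dsnd {μ : E × E → E} {x y : E} (hμ : DifferentiableAt K μ (x, y)) :
    HasFDerivAt (fun y ↦ μ (x, y)) (dsnd K μ (x, y)) y := by
  simpa using hasFDerivAt_comp_pair (a := fun _ ↦ x) (b := id) hμ (hasFDerivAt_const x y)
    (hasFDerivAt_id y)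

theorem hasFDerivAt_dfst {μ : E × E → E} {x y : E} (hμ : DifferentiableAt K μ (x, y)) :
    HasFDerivAt (fun x ↦ μ (x, y)) (dfst K μ (x, y)) x := by
  simpa using hasFDerivAt_comp_pair (a := id) (b := fun _ ↦ y) hμ (hasFDerivAt_id x)
    (hasFDerivAt_const y x)

theorem eventually_isInvertible [CompleteSpace E] {X : Type*} [TopologicalSpace X]
    {f : X → E →L[K] E} {x : X} (hf : ContinuousAt f x) (h1 : f x = ContinuousLinearMap.id K E) :
    ∀ᶠ y in 𝓝 x, (f y).IsInvertible := by
  refine hf.eventually ?_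
  rw [h1]
  exact ContinuousLinearEquiv.nhds (ContinuousLinearEquiv.refl K E)

namespace IsLocalGroup

variable {μ : E × E → E} {e : E} (hμ : IsLocalGroup K μ e)

include hμ

theorem mul_base : μ (e, e) = e := hμ.one_mul.self_of_nhds

theorem tendsto_mul : Tendsto μ (𝓝 (e, e)) (𝓝 e) := by
  simpa only [ContinuousAt, hμ.mul_base] using hμ.analyticAt.continuousAt

theorem eventually_assoc {g : (E × E) × E → E × E × E} (hg : Continuous g)
    (hg0 : g ((e, e), e) = (e, e, e)) : ∀ᶠ p in 𝓝 (e, e), ∀ᶠ z in 𝓝 e,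
      μ (μ ((g (p, z)).1, (g (p, z)).2.1), (g (p, z)).2.2) =
        μ ((g (p, z)).1, μ ((g (p, z)).2.1, (g (p, z)).2.2)) := by
  have h1 : Tendsto g (𝓝 ((e, e), e)) (𝓝 (e, e, e)) := hg0 ▸ hg.tendsto _
  have h2 := h1.eventually hμ.assoc
  rw [nhds_prod_eq] at h2
  exact h2.curry

theorem dsnd_base : dsnd K μ (e, e) = ContinuousLinearMap.id K E := by
  have h1 := hasFDerivAt_dsnd hμ.analyticAt.differentiableAt
  exact h1.unique ((hasFDerivAt_id e).congr_of_eventuallyEq hμ.one_mul)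

theorem dfst_base : dfst K μ (e, e) = ContinuousLinearMap.id K E := by
  have h1 := hasFDerivAt_dfst hμ.analyticAt.differentiableAt
  exact h1.unique ((hasFDerivAt_id e).congr_of_eventuallyEq hμ.mul_one)

variable [CompleteSpace E]

theorem eventually_differentiableAt : ∀ᶠ p in 𝓝 (e, e), DifferentiableAt K μ p :=
  hμ.analyticAt.eventually_analyticAt.mono fun _ h ↦ h.differentiableAt

theorem eventually_differentiableAt_left :
    ∀ᶠ x in 𝓝 e, DifferentiableAt K μ (x, e) ∧ DifferentiableAt K μ (e, x) := by
  have h1 : Tendsto (fun x : E ↦ (x, e)) (𝓝 e) (𝓝 (e, e)) :=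
    (Continuous.prodMk_left e).tendsto e
  have h2 : Tendsto (fun x : E ↦ (e, x)) (𝓝 e) (𝓝 (e, e)) :=
    (Continuous.prodMk_right e).tendsto e
  exact (h1.eventually hμ.eventually_differentiableAt).and
    (h2.eventually hμ.eventually_differentiableAt)

theorem analyticAt_dsnd' : AnalyticAt K (dsnd K μ) (e, e) :=
  (ContinuousLinearMap.analyticAt ((ContinuousLinearMap.compL K E (E × E) E).flip
    (ContinuousLinearMap.inr K E E)) _).comp hμ.analyticAt.fderiv

theorem analyticAt_dfst' : AnalyticAt K (dfst K μ) (e, e) :=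
  (ContinuousLinearMap.analyticAt ((ContinuousLinearMap.compL K E (E × E) E).flip
    (ContinuousLinearMap.inl K E E)) _).comp hμ.analyticAt.fderiv

theorem analyticAt_dsnd : AnalyticAt K (fun x ↦ dsnd K μ (x, e)) e :=
  hμ.analyticAt_dsnd'.comp (f := fun x ↦ (x, e)) (analyticAt_id.prod analyticAt_const)

theorem analyticAt_dfst : AnalyticAt K (fun x ↦ dfst K μ (e, x)) e :=
  hμ.analyticAt_dfst'.comp (f := fun x ↦ (e, x)) (analyticAt_const.prod analyticAt_id)

theorem isInvertible_dsnd : ∀ᶠ x in 𝓝 e, (dsnd K μ (x, e)).IsInvertible :=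
  eventually_isInvertible hμ.analyticAt_dsnd.continuousAt hμ.dsnd_base

theorem isInvertible_dfst : ∀ᶠ x in 𝓝 e, (dfst K μ (e, x)).IsInvertible :=
  eventually_isInvertible hμ.analyticAt_dfst.continuousAt hμ.dfst_base

/-- Left invariance of the fields `x ↦ dsnd μ (x, e) v`, by differentiating `(x y) z = x (y z)` in
`z` at `e`. -/
theorem dsnd_comp : ∀ᶠ p in 𝓝 (e, e),
    (dsnd K μ p).comp (dsnd K μ (p.2, e)) = dsnd K μ (μ p, e) := by
  filter_upwards [hμ.eventually_assoc (g := fun q ↦ (q.1.1, q.1.2, q.2)) (by fun_prop) rfl,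
    hμ.eventually_differentiableAt,
    (continuousAt_snd (p := (e, e))).eventually hμ.eventually_differentiableAt_left,
    (continuousAt_snd (p := (e, e))).eventually hμ.mul_one,
    hμ.tendsto_mul.eventually hμ.eventually_differentiableAt_left] with p h1 h2 h3 h4 h5
  have d1 := hasFDerivAt_dsnd h3.1
  have d2 := hasFDerivAt_comp_pair (a := fun _ ↦ p.1) (b := fun z ↦ μ (p.2, z)) (z := e)
    (by convert! h2 using 1; simp [h4]) (hasFDerivAt_const p.1 e) d1
  have d3 := (hasFDerivAt_dsnd h5.1).congr_of_eventuallyEq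
    (h1.mono fun z hz ↦ hz.symm)
  have d4 := d2.unique d3
  simpa [h4] using d4

theorem dfst_comp : ∀ᶠ p in 𝓝 (e, e),
    (dfst K μ p).comp (dfst K μ (e, p.1)) = dfst K μ (e, μ p) := by
  filter_upwards [hμ.eventually_assoc (g := fun q ↦ (q.2, q.1.1, q.1.2)) (by fun_prop) rfl,
    hμ.eventually_differentiableAt,
    (continuousAt_fst (p := (e, e))).eventually hμ.eventually_differentiableAt_left,
    (continuousAt_fst (p := (e, e))).eventually hμ.one_mul,
    hμ.tendsto_mul.eventually hμ.eventually_differentiableAt_left] with p h1 h2 h3 h4 h5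
  have d1 := hasFDerivAt_dfst h3.2
  have d2 := hasFDerivAt_comp_pair (a := fun z ↦ μ (z, p.1)) (b := fun _ ↦ p.2) (z := e)
    (by convert! h2 using 1; simp [h4]) d1 (hasFDerivAt_const p.2 e)
  have d3 := (hasFDerivAt_dfst h5.2).congr_of_eventuallyEq h1
  have d4 := d2.unique d3
  simpa [h4] using d4

/-- Left and right translations commute. -/
theorem dsnd_comp_dfst : ∀ᶠ p in 𝓝 (e, e),
    (dsnd K μ p).comp (dfst K μ (e, p.2)) = (dfst K μ p).comp (dsnd K μ (p.1, e)) := by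
  filter_upwards [hμ.eventually_assoc (g := fun q ↦ (q.1.1, q.2, q.1.2)) (by fun_prop) rfl,
    hμ.eventually_differentiableAt,
    (continuousAt_fst (p := (e, e))).eventually hμ.eventually_differentiableAt_left,
    (continuousAt_snd (p := (e, e))).eventually hμ.eventually_differentiableAt_left,
    (continuousAt_fst (p := (e, e))).eventually hμ.mul_one,
    (continuousAt_snd (p := (e, e))).eventually hμ.one_mul] with p h1 h2 h3 h4 h5 h6
  have d2 := hasFDerivAt_comp_pair (a := fun z ↦ μ (p.1, z)) (b := fun _ ↦ p.2) (z := e)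
    (by convert! h2 using 1; simp [h5]) (hasFDerivAt_dsnd h3.1) (hasFDerivAt_const p.2 e)
  have d3 := hasFDerivAt_comp_pair (a := fun _ ↦ p.1) (b := fun z ↦ μ (z, p.2)) (z := e)
    (by convert! h2 using 1; simp [h6]) (hasFDerivAt_const p.1 e) (hasFDerivAt_dfst h4.2)
  have d4 := (d3.congr_of_eventuallyEq h1).unique d2
  simpa [h5, h6] using d4

theorem analyticAt_localAd : AnalyticAt K (localAd K μ e) e := by
  have h1 : AnalyticAt K (fun x ↦ (dfst K μ (e, x)).inverse) e := by
    refine AnalyticAt.comp (g := ContinuousLinearMap.inverse) ?_ hμ.analyticAt_dfst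
    have h0 := hμ.dfst_base
    rw [h0]
    exact (contDiffAt_map_inverse (n := ω) (ContinuousLinearEquiv.refl K E)).analyticAt
  have h2 := h1.prod hμ.analyticAt_dsnd
  have h3 := (ContinuousLinearMap.analyticAt_bilinear (ContinuousLinearMap.compL K E E E)
    ((dfst K μ (e, e)).inverse, dsnd K μ (e, e))).comp_of_eq h2 rfl
  exact h3

omit [CompleteSpace E] in
theorem localAd_base : localAd K μ e e = ContinuousLinearMap.id K E := by
  rw [localAd, hμ.dfst_base, hμ.dsnd_base, ContinuousLinearMap.inverse_id]
  rfl

theorem dfst_comp_localAd : ∀ᶠ x in 𝓝 e,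
    (dfst K μ (e, x)).comp (localAd K μ e x) = dsnd K μ (x, e) := by
  filter_upwards [hμ.isInvertible_dfst] with x hx
  ext v
  exact hx.self_apply_inverse _

theorem localAd_mul : ∀ᶠ p in 𝓝 (e, e),
    localAd K μ e (μ p) = (localAd K μ e p.1).comp (localAd K μ e p.2) := by
  have hinv : ∀ᶠ p in 𝓝 (e, e), (dfst K μ p).IsInvertible :=
    eventually_isInvertible hμ.analyticAt_dfst'.continuousAt hμ.dfst_base
  filter_upwards [hμ.dsnd_comp, hμ.dfst_comp, hμ.dsnd_comp_dfst,
    (continuousAt_fst (p := (e, e))).eventually hμ.isInvertible_dfst, hinv,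
    (continuousAt_fst (p := (e, e))).eventually hμ.dfst_comp_localAd,
    (continuousAt_snd (p := (e, e))).eventually hμ.dfst_comp_localAd,
    hμ.tendsto_mul.eventually hμ.dfst_comp_localAd] with p h1 h2 h3 h4 h5 h6 h7 h8
  ext v
  -- both sides agree after the injective maps of right translation
  apply h4.injective
  apply h5.injective
  have e1 := DFunLike.congr_fun h1 v
  have e2 := DFunLike.congr_fun h2 (localAd K μ e (μ p) v)
  have e3 := DFunLike.congr_fun h3 (localAd K μ e p.2 v)
  have e6 := DFunLike.congr_fun h6 (localAd K μ e p.2 v)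
  have e7 := DFunLike.congr_fun h7 v
  have e8 := DFunLike.congr_fun h8 v
  simp only [ContinuousLinearMap.comp_apply] at e1 e2 e3 e6 e7 e8 ⊢
  rw [e2, e8, e6, ← e3, e7, e1]

theorem fderiv_localAd_base : fderiv K (localAd K μ e) e = localBracket K μ e := by
  have h1 : (fun x ↦ (dfst K μ (e, x)).comp (localAd K μ e x)) =ᶠ[𝓝 e]
      fun x ↦ dsnd K μ (x, e) := hμ.dfst_comp_localAd
  have d1 := (hμ.analyticAt_dfst.differentiableAt.hasFDerivAt.clm_comp
    hμ.analyticAt_localAd.differentiableAt.hasFDerivAt).unique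
    (hμ.analyticAt_dsnd.differentiableAt.hasFDerivAt.congr_of_eventuallyEq h1)
  -- the mixed second derivatives of `μ` agree
  have hs := (hμ.analyticAt.contDiffAt (n := ω)).isSymmSndFDerivAt (by simp)
  have e1 : ∀ v w, fderiv K (fun x ↦ dsnd K μ (x, e)) e v w =
      fderiv K (fderiv K μ) (e, e) (v, 0) (0, w) := by
    intro v w
    have h2 : HasFDerivAt (fun x : E ↦ fderiv K μ (x, e))
        ((fderiv K (fderiv K μ) (e, e)).comp (ContinuousLinearMap.inl K E E)) e :=
      HasFDerivAt.comp e (f := fun x : E ↦ (x, e)) hμ.analyticAt.fderiv.differentiableAt.hasFDerivAt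
        (hasFDerivAt_prodMk_left e e)
    have h3 : HasFDerivAt (fun x : E ↦ dsnd K μ (x, e)) _ e :=
      h2.clm_comp (hasFDerivAt_const (ContinuousLinearMap.inr K E E) e)
    have h4 := DFunLike.congr_fun (DFunLike.congr_fun h3.fderiv v) w
    simpa using h4
  have e2 : ∀ v w, fderiv K (fun x ↦ dfst K μ (e, x)) e v w =
      fderiv K (fderiv K μ) (e, e) (0, v) (w, 0) := by
    intro v w
    have h2 : HasFDerivAt (fun x : E ↦ fderiv K μ (e, x))
        ((fderiv K (fderiv K μ) (e, e)).comp (ContinuousLinearMap.inr K E E)) e :=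
      HasFDerivAt.comp e (f := fun x : E ↦ (e, x)) hμ.analyticAt.fderiv.differentiableAt.hasFDerivAt
        (hasFDerivAt_prodMk_right e e)
    have h3 : HasFDerivAt (fun x : E ↦ dfst K μ (e, x)) _ e :=
      h2.clm_comp (hasFDerivAt_const (ContinuousLinearMap.inl K E E) e)
    have h4 := DFunLike.congr_fun (DFunLike.congr_fun h3.fderiv v) w
    simpa using h4
  ext v w
  have h4 := DFunLike.congr_fun (DFunLike.congr_fun d1 v) w
  simp only [hμ.dfst_base, hμ.localAd_base] at h4
  rw [localBracket_apply, e1 w v, hs.eq, ← e2 v w, ← h4]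
  simp

/-- The adjoint action satisfies the differential equation `d Ad = Ad ∘ ad` along left invariant
fields. -/
theorem fderiv_localAd : ∀ᶠ x in 𝓝 e, ∀ v,
    fderiv K (localAd K μ e) x (dsnd K μ (x, e) v) =
      (localAd K μ e x).comp (localBracket K μ e v) := by
  have h1 := hμ.localAd_mul
  rw [nhds_prod_eq] at h1
  filter_upwards [h1.curry, hμ.analyticAt_localAd.eventually_analyticAt, hμ.mul_one,
    hμ.eventually_differentiableAt_left] with x h1 h2 h3 h4 v
  have h2' : HasFDerivAt (localAd K μ e) (fderiv K (localAd K μ e) x) (μ (x, e)) := by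
    rw [h3]
    exact h2.differentiableAt.hasFDerivAt
  have d1 := HasFDerivAt.comp e (f := fun y ↦ μ (x, y)) h2' (hasFDerivAt_dsnd h4.1)
  have d2 := ((hasFDerivAt_const (localAd K μ e x) e).clm_comp
    hμ.analyticAt_localAd.differentiableAt.hasFDerivAt)
  have d3 := DFunLike.congr_fun (d1.unique (d2.congr_of_eventuallyEq h1)) v
  rw [← hμ.fderiv_localAd_base]
  simpa using d3

/-- The bracket of left invariant vector fields is left invariant. -/
theorem bracket_leftInvariant : ∀ᶠ x in 𝓝 e, ∀ v w,
    fderiv K (fun x ↦ dsnd K μ (x, e)) x (dsnd K μ (x, e) v) w -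
      fderiv K (fun x ↦ dsnd K μ (x, e)) x (dsnd K μ (x, e) w) v =
    dsnd K μ (x, e) (localBracket K μ e v w) := by
  have h1 := hμ.dsnd_comp
  rw [nhds_prod_eq] at h1
  have hpair : Tendsto (fun x : E ↦ (x, e)) (𝓝 e) (𝓝 (e, e)) :=
    (Continuous.prodMk_left e).tendsto e
  filter_upwards [h1.curry, hμ.analyticAt_dsnd.eventually_analyticAt, hμ.mul_one,
    hμ.eventually_differentiableAt_left,
    hpair.eventually hμ.analyticAt.eventually_analyticAt] with x h1 h2 h3 h4 h5
  have h2' : HasFDerivAt (fun x ↦ dsnd K μ (x, e)) (fderiv K (fun x ↦ dsnd K μ (x, e)) x)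
      (μ (x, e)) := by
    rw [h3]
    exact h2.differentiableAt.hasFDerivAt
  have d1 := HasFDerivAt.comp e (f := fun y ↦ μ (x, y)) h2' (hasFDerivAt_dsnd h4.1)
  have hs := (h5.contDiffAt (n := ω)).isSymmSndFDerivAt (by simp)
  have d0 : HasFDerivAt (fun y : E ↦ fderiv K μ (x, y))
      ((fderiv K (fderiv K μ) (x, e)).comp (ContinuousLinearMap.inr K E E)) e :=
    HasFDerivAt.comp e (f := fun y : E ↦ (x, y)) h5.fderiv.differentiableAt.hasFDerivAt
      (hasFDerivAt_prodMk_right x e)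
  have d0' : HasFDerivAt (fun y : E ↦ dsnd K μ (x, y)) _ e :=
    d0.clm_comp (hasFDerivAt_const (ContinuousLinearMap.inr K E E) e)
  have d2 := d0'.clm_comp hμ.analyticAt_dsnd.differentiableAt.hasFDerivAt
  have d3 := d2.unique (d1.congr_of_eventuallyEq h1)
  have key : ∀ v w, fderiv K (fun x ↦ dsnd K μ (x, e)) x (dsnd K μ (x, e) v) w =
      fderiv K (fderiv K μ) (x, e) (0, v) (0, w) +
        dsnd K μ (x, e) (fderiv K (fun x ↦ dsnd K μ (x, e)) e v w) := by
    intro v w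
    have h6 := DFunLike.congr_fun (DFunLike.congr_fun d3 v) w
    simp only [hμ.dsnd_base] at h6
    simp only [ContinuousLinearMap.comp_apply] at h6
    rw [← h6]
    simp [add_comm]
  intro v w
  rw [key, key, hs.eq (0, v) (0, w), localBracket_apply, map_sub]
  abel

end IsLocalGroup

end LocalGroup

/-! ### Cocycles for the adjoint action -/

section LocalCocycle

open Filter

variable {K : Type*} [NontriviallyNormedField K]
  {E : Type*} [NormedAddCommGroup E] [NormedSpace K E]
  {E' : Type*} [NormedAddCommGroup E'] [NormedSpace K E']

theorem AnalyticAt.exists_localInverse [CompleteSpace E] {f : E → E'} {a : E}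
    (hf : AnalyticAt K f a) {f' : E ≃L[K] E'} (h : fderiv K f a = f') :
    ∃ g : E' → E, AnalyticAt K g (f a) ∧ g (f a) = a ∧ (∀ᶠ x in 𝓝 a, g (f x) = x) ∧
      (∀ᶠ y in 𝓝 (f a), f (g y) = y) ∧ HasFDerivAt g (f'.symm : E' →L[K] E) (f a) := by
  have hs : HasStrictFDerivAt f (f' : E →L[K] E') a := h ▸ hf.hasStrictFDerivAt
  have ha : a ∈ (hs.toOpenPartialHomeomorph f).source := hs.mem_toOpenPartialHomeomorph_source
  exact ⟨(hs.toOpenPartialHomeomorph f).symm,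
    (hs.toOpenPartialHomeomorph f).analyticAt_symm' (i := f') ha hf h,
    (hs.toOpenPartialHomeomorph f).left_inv ha, hs.eventually_left_inverse,
    hs.eventually_right_inverse, hs.to_localInverse.hasFDerivAt⟩

/-- An analytic germ that is compatible with two germs of group laws. -/
structure IsLocalGroupHom (K : Type*) [NontriviallyNormedField K] {E E' : Type*}
    [NormedAddCommGroup E] [NormedSpace K E] [NormedAddCommGroup E'] [NormedSpace K E']
    (μ : E × E → E) (e : E) (μ' : E' × E' → E') (e' : E') (f : E → E') : Prop where
  analyticAt : AnalyticAt K f e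
  map_base : f e = e'
  map_mul : ∀ᶠ p in 𝓝 (e, e), f (μ p) = μ' (f p.1, f p.2)

/-- A `1`-cocycle `C` for the adjoint action whose derivative at the identity is `D`, given
infinitesimally: its derivative at `x` in the direction of the left invariant field of `v` is
`Ad x (D v)`. When `D` is an invertible derivation, this `C` is a chart that takes the place of a
logarithm. -/
structure IsAdCocycle (K : Type*) [NontriviallyNormedField K] {E : Type*} [NormedAddCommGroup E]
    [NormedSpace K E] (μ : E × E → E) (e : E) (D : E →L[K] E) (C : E → E) : Prop where
  analyticAt : AnalyticAt K C e
  map_base : C e = 0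
  fderiv_apply : ∀ᶠ x in 𝓝 e, ∀ v, fderiv K C x (dsnd K μ (x, e) v) = localAd K μ e x (D v)

variable {μ : E × E → E} {e : E} {μ' : E' × E' → E'} {e' : E'} {f : E → E'}
  {D : E →L[K] E} {D' : E' →L[K] E'} {C : E → E} {C' : E' → E'}

theorem IsLocalGroupHom.tendsto (hf : IsLocalGroupHom K μ e μ' e' f) : Tendsto f (𝓝 e) (𝓝 e') := by
  simpa only [ContinuousAt, hf.map_base] using hf.analyticAt.continuousAt

section Hom

variable [CompleteSpace E] [CompleteSpace E'] (hμ : IsLocalGroup K μ e)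
  (hμ' : IsLocalGroup K μ' e')

include hμ hμ'

theorem IsLocalGroupHom.fderiv_comp_dsnd (hf : IsLocalGroupHom K μ e μ' e' f) :
    ∀ᶠ x in 𝓝 e, (fderiv K f x).comp (dsnd K μ (x, e)) =
      (dsnd K μ' (f x, e')).comp (fderiv K f e) := by
  have h1 := hf.map_mul
  rw [nhds_prod_eq] at h1
  filter_upwards [h1.curry, hμ.mul_one, hμ.eventually_differentiableAt_left,
    hf.analyticAt.eventually_analyticAt,
    hf.tendsto.eventually hμ'.eventually_differentiableAt_left] with x h1 h2 h3 h4 h5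
  have h4' : HasFDerivAt f (fderiv K f x) (μ (x, e)) := by
    rw [h2]
    exact h4.differentiableAt.hasFDerivAt
  have h5' : DifferentiableAt K μ' (f x, f e) := by
    rw [hf.map_base]
    exact h5.1
  have d1 := HasFDerivAt.comp e (f := fun y ↦ μ (x, y)) h4' (hasFDerivAt_dsnd h3.1)
  have d2 := hasFDerivAt_comp_pair (a := fun _ ↦ f x) (b := f) (z := e) h5'
    (hasFDerivAt_const (f x) e) hf.analyticAt.differentiableAt.hasFDerivAt
  have d3 := d1.unique (d2.congr_of_eventuallyEq h1)
  simpa [hf.map_base] using d3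

theorem IsLocalGroupHom.fderiv_comp_dfst (hf : IsLocalGroupHom K μ e μ' e' f) :
    ∀ᶠ x in 𝓝 e, (fderiv K f x).comp (dfst K μ (e, x)) =
      (dfst K μ' (e', f x)).comp (fderiv K f e) := by
  have hswap : Tendsto (fun p : E × E ↦ (p.2, p.1)) (𝓝 (e, e)) (𝓝 (e, e)) :=
    continuous_swap.tendsto (e, e)
  have h1 := hswap.eventually hf.map_mul
  rw [nhds_prod_eq] at h1
  filter_upwards [h1.curry, hμ.one_mul, hμ.eventually_differentiableAt_left,
    hf.analyticAt.eventually_analyticAt,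
    hf.tendsto.eventually hμ'.eventually_differentiableAt_left] with x h1 h2 h3 h4 h5
  have h4' : HasFDerivAt f (fderiv K f x) (μ (e, x)) := by
    rw [h2]
    exact h4.differentiableAt.hasFDerivAt
  have h5' : DifferentiableAt K μ' (f e, f x) := by
    rw [hf.map_base]
    exact h5.2
  have d1 := HasFDerivAt.comp e (f := fun y ↦ μ (y, x)) h4' (hasFDerivAt_dfst h3.2)
  have d2 := hasFDerivAt_comp_pair (a := f) (b := fun _ ↦ f x) (z := e) h5'
    hf.analyticAt.differentiableAt.hasFDerivAt (hasFDerivAt_const (f x) e)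
  have d3 := d1.unique (d2.congr_of_eventuallyEq h1)
  simpa [hf.map_base] using d3

theorem IsLocalGroupHom.fderiv_comp_localAd (hf : IsLocalGroupHom K μ e μ' e' f) :
    ∀ᶠ x in 𝓝 e, (fderiv K f e).comp (localAd K μ e x) =
      (localAd K μ' e' (f x)).comp (fderiv K f e) := by
  filter_upwards [hf.fderiv_comp_dfst hμ hμ', hf.fderiv_comp_dsnd hμ hμ', hμ.dfst_comp_localAd,
    hf.tendsto.eventually hμ'.dfst_comp_localAd,
    hf.tendsto.eventually hμ'.isInvertible_dfst] with x h1 h2 h3 h4 h5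
  ext v
  apply h5.injective
  have e1 := DFunLike.congr_fun h1 (localAd K μ e x v)
  have e2 := DFunLike.congr_fun h2 v
  have e3 := DFunLike.congr_fun h3 v
  have e4 := DFunLike.congr_fun h4 (fderiv K f e v)
  simp only [ContinuousLinearMap.comp_apply] at e1 e2 e3 e4 ⊢
  rw [← e1, e3, e2, e4]

/-- Cocycles are natural: both sides of the equation have the same derivative and vanish at the
identity. In the charts given by cocycles, homomorphisms are thus linear. -/
theorem IsLocalGroupHom.map_cocycle [CharZero K] (hf : IsLocalGroupHom K μ e μ' e' f)
    (hC : IsAdCocycle K μ e D C) (hC' : IsAdCocycle K μ' e' D' C')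
    (hD : ∀ v, fderiv K f e (D v) = D' (fderiv K f e v)) :
    ∀ᶠ x in 𝓝 e, C' (f x) = fderiv K f e (C x) := by
  have ha : AnalyticAt K (fun x ↦ C' (f x)) e :=
    hC'.analyticAt.comp_of_eq hf.analyticAt hf.map_base
  have hb : AnalyticAt K (fun x ↦ fderiv K f e (C x)) e :=
    (ContinuousLinearMap.analyticAt (fderiv K f e) _).comp hC.analyticAt
  have key := (ha.sub hb).eventually_eq_zero_of_fderiv_eq_zero
    (by simp [hf.map_base, hC.map_base, hC'.map_base]) ?_
  · exact key.mono fun x hx ↦ sub_eq_zero.1 hx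
  filter_upwards [hf.fderiv_comp_dsnd hμ hμ', hf.fderiv_comp_localAd hμ hμ', hC.fderiv_apply,
    hf.tendsto.eventually hC'.fderiv_apply, hμ.isInvertible_dsnd,
    hC.analyticAt.eventually_analyticAt, hf.analyticAt.eventually_analyticAt,
    hf.tendsto.eventually hC'.analyticAt.eventually_analyticAt] with x h1 h2 h3 h4 h5 h6 h7 h8
  have d1 : HasFDerivAt (fun x ↦ C' (f x)) _ x :=
    h8.differentiableAt.hasFDerivAt.comp x h7.differentiableAt.hasFDerivAt
  have d2 : HasFDerivAt (fun x ↦ fderiv K f e (C x)) _ x :=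
    (fderiv K f e).hasFDerivAt.comp x h6.differentiableAt.hasFDerivAt
  refine (d1.sub d2).fderiv.trans ?_
  ext w
  obtain ⟨v, rfl⟩ := h5.surjective w
  have e1 := DFunLike.congr_fun h1 v
  have e2 := DFunLike.congr_fun h2 (D v)
  simp only [ContinuousLinearMap.comp_apply] at e1 e2
  simp only [sub_apply, ContinuousLinearMap.comp_apply, e1, h4, h3, e2, hD, sub_self, zero_apply]

end Hom

section Cocycle

variable [CompleteSpace E] (hμ : IsLocalGroup K μ e)

include hμ

theorem IsLocalGroup.analyticAt_inverse_dsnd :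
    AnalyticAt K (fun x ↦ (dsnd K μ (x, e)).inverse) e := by
  refine AnalyticAt.comp (g := ContinuousLinearMap.inverse) ?_ hμ.analyticAt_dsnd
  rw [hμ.dsnd_base]
  exact (contDiffAt_map_inverse (n := ω) (ContinuousLinearEquiv.refl K E)).analyticAt

/-- A derivation `D` of the bracket integrates to a cocycle: the `1`-form that prescribes the
derivative of the cocycle is closed exactly because `D` is a derivation. -/
theorem IsLocalGroup.exists_isAdCocycle [IsUltrametricDist K] [CompleteSpace K] [CharZero K]
    (hD : ∀ v w, D (localBracket K μ e v w) =
      localBracket K μ e (D v) w + localBracket K μ e v (D w)) :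
    ∃ C, IsAdCocycle K μ e D C := by
  let η : E → E →L[K] E := fun x ↦ (localAd K μ e x).comp (D.comp (dsnd K μ (x, e)).inverse)
  have hη : AnalyticAt K η e := by
    have h2 := hμ.analyticAt_localAd.prod
      ((ContinuousLinearMap.analyticAt (ContinuousLinearMap.compL K E E E D) _).comp
      hμ.analyticAt_inverse_dsnd)
    exact (ContinuousLinearMap.analyticAt_bilinear (ContinuousLinearMap.compL K E E E)
      (localAd K μ e e, D.comp (dsnd K μ (e, e)).inverse)).comp_of_eq h2 rfl
  have hηM : ∀ᶠ x in 𝓝 e, (η x).comp (dsnd K μ (x, e)) = (localAd K μ e x).comp D := by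
    filter_upwards [hμ.isInvertible_dsnd] with x hx
    ext v
    exact congrArg (fun w ↦ localAd K μ e x (D w)) (hx.inverse_apply_self v)
  suffices hclosed : ∀ᶠ x in 𝓝 e, ∀ v w, fderiv K η x v w = fderiv K η x w v by
    obtain ⟨C, h1, h2, h3⟩ := hη.exists_primitive hclosed
    refine ⟨C, h1, h2, ?_⟩
    filter_upwards [h3, hηM] with x hx hx' v
    rw [hx]
    exact DFunLike.congr_fun hx' v
  filter_upwards [hηM.eventually_nhds, hη.eventually_analyticAt,
    hμ.analyticAt_dsnd.eventually_analyticAt, hμ.analyticAt_localAd.eventually_analyticAt,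
    hμ.fderiv_localAd, hμ.bracket_leftInvariant, hμ.isInvertible_dsnd, hηM]
    with x h1 h2 h3 h4 h5 h6 h7 h8 v' w'
  obtain ⟨v, rfl⟩ := h7.surjective v'
  obtain ⟨w, rfl⟩ := h7.surjective w'
  have d := ((h2.differentiableAt.hasFDerivAt.clm_comp h3.differentiableAt.hasFDerivAt).unique
    ((h4.differentiableAt.hasFDerivAt.clm_comp (hasFDerivAt_const D x)).congr_of_eventuallyEq h1))
  have key : ∀ v w, fderiv K η x (dsnd K μ (x, e) v) (dsnd K μ (x, e) w) =
      localAd K μ e x (localBracket K μ e v (D w)) -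
        η x (fderiv K (fun x ↦ dsnd K μ (x, e)) x (dsnd K μ (x, e) v) w) := by
    intro v w
    have e1 := DFunLike.congr_fun (DFunLike.congr_fun d (dsnd K μ (x, e) v)) w
    have e2 := DFunLike.congr_fun (h5 v) (D w)
    simp only [add_apply, ContinuousLinearMap.comp_apply, ContinuousLinearMap.compL_apply,
      ContinuousLinearMap.flip_apply, zero_apply, map_zero, zero_add] at e1
    exact eq_sub_of_add_eq ((add_comm _ _).trans (e1.trans e2))
  have e3 := congrArg (η x) (h6 v w)
  have e4 := DFunLike.congr_fun h8 (localBracket K μ e v w)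
  simp only [ContinuousLinearMap.comp_apply] at e4
  rw [e4, hD, map_sub, map_add] at e3
  have e5 : localBracket K μ e w (D v) = - localBracket K μ e (D v) w := by
    simp only [localBracket_apply, neg_sub]
  rw [key, key, e5, map_neg, sub_eq_iff_eq_add]
  rw [sub_eq_iff_eq_add] at e3
  rw [e3]
  abel

/-- The cocycle identity. Both sides agree for `p.2 = e` and have the same derivative in `p.2`. -/
theorem IsAdCocycle.map_mul [CharZero K] (hC : IsAdCocycle K μ e D C) :
    ∀ᶠ p in 𝓝 (e, e), C (μ p) = C p.1 + localAd K μ e p.1 (C p.2) := by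
  have hfst : AnalyticAt K (fun p : E × E ↦ p.1) (e, e) := analyticAt_fst
  have hsnd : AnalyticAt K (fun p : E × E ↦ p.2) (e, e) := analyticAt_snd
  have a1 : AnalyticAt K (fun p ↦ C (μ p)) (e, e) :=
    hC.analyticAt.comp_of_eq hμ.analyticAt hμ.mul_base
  have a2 : AnalyticAt K (fun p : E × E ↦ C p.1) (e, e) := hC.analyticAt.comp_of_eq hfst rfl
  have a3 : AnalyticAt K (fun p : E × E ↦ localAd K μ e p.1 (C p.2)) (e, e) :=
    (ContinuousLinearMap.analyticAt_bilinear (ContinuousLinearMap.id K (E →L[K] E))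
      (localAd K μ e e, C e)).comp_of_eq ((hμ.analyticAt_localAd.comp_of_eq hfst rfl).prod
      (hC.analyticAt.comp_of_eq hsnd rfl)) rfl
  have key := ((a1.sub a2).sub a3).eventually_eq_zero_of_partial_fderiv_eq_zero ?_ ?_
  · filter_upwards [key] with p hp
    rw [← sub_eq_zero, ← sub_sub]
    exact hp
  · filter_upwards [hμ.mul_one] with x hx
    simp [hx, hC.map_base]
  filter_upwards [hμ.dsnd_comp, hμ.localAd_mul, hμ.tendsto_mul.eventually hC.fderiv_apply,
    (continuousAt_snd (p := (e, e))).eventually hC.fderiv_apply,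
    (continuousAt_snd (p := (e, e))).eventually hμ.isInvertible_dsnd,
    hμ.eventually_differentiableAt,
    (continuousAt_snd (p := (e, e))).eventually hC.analyticAt.eventually_analyticAt,
    hμ.tendsto_mul.eventually hC.analyticAt.eventually_analyticAt]
    with p h1 h2 h3 h4 h5 h6 h7 h8
  have d1 : HasFDerivAt (fun y ↦ C (μ (p.1, y))) _ p.2 :=
    HasFDerivAt.comp p.2 (f := fun y ↦ μ (p.1, y)) h8.differentiableAt.hasFDerivAt
      (hasFDerivAt_dsnd h6)
  have d2 : HasFDerivAt (fun y ↦ localAd K μ e p.1 (C y)) _ p.2 :=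
    (localAd K μ e p.1).hasFDerivAt.comp p.2 h7.differentiableAt.hasFDerivAt
  refine ((d1.sub (hasFDerivAt_const (C p.1) p.2)).sub d2).fderiv.trans ?_
  ext w
  obtain ⟨v, rfl⟩ := h5.surjective w
  have e1 := DFunLike.congr_fun h1 v
  simp only [ContinuousLinearMap.comp_apply] at e1
  simp only [sub_apply, ContinuousLinearMap.comp_apply, zero_apply, sub_zero, Prod.mk.eta, e1, h3,
    h4, h2, sub_self]

omit [CompleteSpace E] in
theorem IsAdCocycle.fderiv_base (hC : IsAdCocycle K μ e D C) : fderiv K C e = D := by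
  have h1 := hC.fderiv_apply.self_of_nhds
  rw [hμ.dsnd_base, hμ.localAd_base] at h1
  ext v
  exact h1 v

end Cocycle

end LocalCocycle

/-! ### The local equivalence -/

section ConjugatorAnalytic

open Filter Polynomial

variable {K : Type*} [NontriviallyNormedField K] [CompleteSpace K]
  {E : Type*} [NormedAddCommGroup E] [NormedSpace K E] [FiniteDimensional K E]
  {b : E →ₗ[K] E →ₗ[K] E} {n : ℕ} {D : Module.End K E}

/-- The conjugator as a continuous linear map. -/
noncomputable def conjugatorL (b : E →ₗ[K] E →ₗ[K] E) (n : ℕ) (D : Module.End K E) (c : E) :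
    E →L[K] E :=
  Module.End.toContinuousLinearMap E (conjugator b n D c)

theorem conjugatorL_apply (b : E →ₗ[K] E →ₗ[K] E) (n : ℕ) (D : Module.End K E) (c x : E) :
    conjugatorL b n D c x = conjugator b n D c x := rfl

theorem LinearMap.analyticAt_toFun {F : Type*} [NormedAddCommGroup F] [NormedSpace K F]
    (f : E →ₗ[K] F) (x : E) : AnalyticAt K f x :=
  (LinearMap.toContinuousLinearMap f).analyticAt x

theorem analyticAt_conjugatorL (c : E) : AnalyticAt K (conjugatorL b n D) c := by
  have : CompleteSpace E := FiniteDimensional.complete K E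
  have h1 : AnalyticAt K (fun c ↦ Module.End.toContinuousLinearMap E (twist b D c)) c := by
    simp only [twist, map_sub]
    exact analyticAt_const.sub
      (((Module.End.toContinuousLinearMap E).toLinearMap.comp b).analyticAt_toFun c)
  have h2 : ∀ P : K[X], AnalyticAt K
      (fun c ↦ aeval (Module.End.toContinuousLinearMap E (twist b D c)) P) c := by
    intro P
    simp only [aeval_eq_sum_range]
    exact Finset.analyticAt_fun_sum _ fun i _ ↦ analyticAt_const.fun_smul (h1.fun_pow i)
  unfold conjugatorL conjugator
  simp only [map_sum, map_mul]
  refine Finset.analyticAt_fun_sum _ fun i _ ↦ AnalyticAt.mul ?_ analyticAt_const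
  convert! h2 _ using 2 with c
  exact (Polynomial.aeval_algHom_apply
    (Module.End.toContinuousLinearMap (𝕜 := K) E).toAlgHom _ _).symm

namespace IsPositiveGrading

variable [CharZero K] (h : IsPositiveGrading b n D)

include h

theorem conjugatorL_zero : conjugatorL b n D 0 = 1 := by
  rw [conjugatorL, h.conjugator_zero, map_one]

theorem fderiv_conjugatorL_zero (u : E) :
    fderiv K (conjugatorL b n D) 0 (D u) = Module.End.toContinuousLinearMap E (b u) := by
  have h0 : HasFDerivAt (conjugatorL b n D) (fderiv K (conjugatorL b n D) 0) 0 :=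
    (analyticAt_conjugatorL 0).differentiableAt.hasFDerivAt
  have hy : ∀ y, HasFDerivAt (fun c ↦ conjugatorL b n D c y)
      ((fderiv K (conjugatorL b n D) 0).flip y) 0 := by
    intro y
    have := h0.clm_apply (hasFDerivAt_const y (0 : E))
    simpa using this
  suffices hs : ((fderiv K (conjugatorL b n D) 0 (D u) : E →L[K] E) : E →ₗ[K] E) = b u by
    ext v
    exact LinearMap.congr_fun hs v
  refine h.eq_bracket_of_commutator (fun y ↦ ?_) fun i y hy' ↦ ?_
  · -- differentiate the relation `(D - b c) a(c) = a(c) D` at `c = 0`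
    have d1 : HasFDerivAt (fun c ↦ D (conjugatorL b n D c y)) _ 0 :=
      (LinearMap.toContinuousLinearMap D).hasFDerivAt.comp (0 : E) (hy y)
    have d2 : HasFDerivAt (fun c ↦ b c (conjugatorL b n D c y)) _ 0 :=
      (((Module.End.toContinuousLinearMap E).toLinearMap.comp b).toContinuousLinearMap.hasFDerivAt
        (x := (0 : E))).clm_apply (hy y)
    have d3 : (fun c ↦ D (conjugatorL b n D c y) - b c (conjugatorL b n D c y)) =
        fun c ↦ conjugatorL b n D c (D y) := by
      funext c
      exact h.twist_conjugator c y
    have d4 := (d1.sub d2).unique (d3 ▸ hy (D y))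
    have d5 := DFunLike.congr_fun d4 (D u)
    have e : conjugatorL b n D 0 y = y := by rw [h.conjugatorL_zero]; rfl
    simp only [sub_apply, ContinuousLinearMap.comp_apply, add_apply,
      ContinuousLinearMap.flip_apply, LinearMap.coe_toContinuousLinearMap', e, map_zero,
      zero_apply, zero_add] at d5
    exact sub_eq_iff_eq_add'.2 (sub_eq_iff_eq_add.1 d5)
  · -- the derivative of a curve in a subspace lies in the subspace
    obtain ⟨V, hV⟩ := Submodule.exists_isCompl (weightFiltration D (i + 1))
    have d1 : HasFDerivAt
        (fun c ↦ (Submodule.projection V _ hV.symm) (conjugatorL b n D c y - y)) _ 0 :=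
      (LinearMap.toContinuousLinearMap (Submodule.projection V _ hV.symm)).hasFDerivAt.comp (0 : E)
        ((hy y).sub_const y)
    have d2 : (fun c ↦ (Submodule.projection V _ hV.symm) (conjugatorL b n D c y - y)) =
        fun _ ↦ (0 : E) := by
      funext c
      exact (Submodule.projection_apply_eq_zero_iff hV.symm).2
        (h.conjugator_sub_mem_of_apply_eq_smul c hy')
    rw [d2] at d1
    have d3 := DFunLike.congr_fun (d1.unique (hasFDerivAt_const (0 : E) (0 : E))) (D u)
    exact (Submodule.projection_apply_eq_zero_iff hV.symm).1 d3

theorem fderiv_conjugatorL (c u : E) :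
    fderiv K (conjugatorL b n D) c (conjugatorL b n D c (D u)) =
      (conjugatorL b n D c).comp (Module.End.toContinuousLinearMap E (b u)) := by
  have h1 : (fun c' ↦ conjugatorL b n D (c + conjugatorL b n D c c')) =
      fun c' ↦ (conjugatorL b n D c).comp (conjugatorL b n D c') := by
    funext c'
    ext x
    exact LinearMap.congr_fun (h.conjugator_mul c c') x
  have h2 : HasFDerivAt (conjugatorL b n D) (fderiv K (conjugatorL b n D) c)
      (c + conjugatorL b n D c 0) := by
    rw [map_zero, add_zero]
    exact (analyticAt_conjugatorL c).differentiableAt.hasFDerivAt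
  have d1 := HasFDerivAt.comp (0 : E) (f := fun c' ↦ c + conjugatorL b n D c c') h2
    ((conjugatorL b n D c).hasFDerivAt.const_add c)
  have d2 := (hasFDerivAt_const (conjugatorL b n D c) (0 : E)).clm_comp
    (analyticAt_conjugatorL (b := b) (n := n) (D := D) (0 : E)).differentiableAt.hasFDerivAt
  have d1' : HasFDerivAt (fun c' ↦ conjugatorL b n D (c + conjugatorL b n D c c')) _ 0 := d1
  rw [h1] at d1'
  have d3 := DFunLike.congr_fun (d1'.unique d2) (D u)
  simp [h.fderiv_conjugatorL_zero] at d3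
  exact d3

end IsPositiveGrading

end ConjugatorAnalytic

section LocalEquivalence

open Filter

variable {K : Type*} [NontriviallyNormedField K] [CompleteSpace K] [CharZero K]
  {E : Type*} [NormedAddCommGroup E] [NormedSpace K E] [FiniteDimensional K E]
  {E' : Type*} [NormedAddCommGroup E'] [NormedSpace K E'] [FiniteDimensional K E']
  {μ : E × E → E} {e : E} {μ' : E' × E' → E'} {e' : E'}
  {b : E →ₗ[K] E →ₗ[K] E} {b' : E' →ₗ[K] E' →ₗ[K] E'} {n : ℕ}
  {D : Module.End K E} {D' : Module.End K E'} {C : E → E} {C' : E' → E'}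

/-- The adjoint action, read in the chart `C`, is the conjugator. Both sides satisfy the same linear
differential equation, and agree at the identity. -/
theorem IsAdCocycle.localAd_eq_conjugatorL (hμ : IsLocalGroup K μ e)
    (hb : ∀ v w, localBracket K μ e v w = b v w) (h : IsPositiveGrading b n D)
    (hC : IsAdCocycle K μ e (Module.End.toContinuousLinearMap E D) C) :
    ∀ᶠ x in 𝓝 e, localAd K μ e x = conjugatorL b n D (C x) := by
  have : CompleteSpace E := FiniteDimensional.complete K E
  set DL := Module.End.toContinuousLinearMap E D with hDL
  set a := conjugatorL b n D with ha
  have haC : AnalyticAt K (fun x ↦ a (C x)) e :=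
    (analyticAt_conjugatorL (C e)).comp_of_eq hC.analyticAt rfl
  set Y : E → E →L[K] E := localAd K μ e - fun x ↦ a (C x) with hY
  set B₁ := ‖(dsnd K μ (e, e)).inverse‖ + 1 with hB₁
  set B₂ := ‖fderiv K a (C e)‖ + 1 with hB₂
  have hb₁ : ∀ᶠ x in 𝓝 e, ‖(dsnd K μ (x, e)).inverse‖ < B₁ :=
    hμ.analyticAt_inverse_dsnd.continuousAt.norm.eventually_lt continuousAt_const (lt_add_one _)
  have hb₂ : ∀ᶠ x in 𝓝 e, ‖fderiv K a (C x)‖ < B₂ :=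
    ((analyticAt_conjugatorL (C e)).fderiv.continuousAt.comp
      hC.analyticAt.continuousAt).norm.eventually_lt continuousAt_const (lt_add_one _)
  have key := (hμ.analyticAt_localAd.sub haC).eventually_eq_zero_of_norm_fderiv_le
    (by simp [hμ.localAd_base, hC.map_base, ha, h.conjugatorL_zero, ContinuousLinearMap.one_def])
    ((‖localBracket K μ e‖ + B₂ * ‖DL‖) * B₁) ?_
  · exact key.mono fun x hx ↦ sub_eq_zero.1 hx
  filter_upwards [hb₁, hb₂, hμ.analyticAt_localAd.eventually_analyticAt,
    hC.analyticAt.eventually_analyticAt, hμ.fderiv_localAd, hC.fderiv_apply, hμ.isInvertible_dsnd]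
    with x h1 h2 h3 h4 h5 h6 h7
  have d0 : HasFDerivAt a (fderiv K a (C x)) (C x) :=
    (analyticAt_conjugatorL (C x)).differentiableAt.hasFDerivAt
  have d1 := HasFDerivAt.comp x (f := C) d0 h4.differentiableAt.hasFDerivAt
  have d2 : fderiv K Y x = _ := (h3.differentiableAt.hasFDerivAt.sub d1).fderiv
  have hder : ∀ v, fderiv K Y x (dsnd K μ (x, e) v) =
      (Y x).comp (localBracket K μ e v) - fderiv K a (C x) (Y x (DL v)) := by
    intro v
    have e1 : fderiv K a (C x) (a (C x) (DL v)) = (a (C x)).comp (localBracket K μ e v) := by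
      refine (h.fderiv_conjugatorL (C x) v).trans ?_
      congr 1
      ext w
      exact (hb v w).symm
    rw [d2, sub_apply, ContinuousLinearMap.comp_apply, h5, h6, hY, Pi.sub_apply, sub_apply,
      map_sub, e1, ContinuousLinearMap.sub_comp]
    abel
  have hB₂0 : 0 ≤ B₂ := by positivity
  refine ContinuousLinearMap.opNorm_le_bound _ (by positivity) fun w ↦ ?_
  have hw : dsnd K μ (x, e) ((dsnd K μ (x, e)).inverse w) = w := h7.self_apply_inverse w
  set v := (dsnd K μ (x, e)).inverse w with hv
  have hvw : ‖v‖ ≤ B₁ * ‖w‖ := (ContinuousLinearMap.le_opNorm _ _).trans (by gcongr)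
  rw [← hw, hder, hw]
  calc ‖(Y x).comp (localBracket K μ e v) - fderiv K a (C x) (Y x (DL v))‖
      ≤ ‖(Y x).comp (localBracket K μ e v)‖ + ‖fderiv K a (C x) (Y x (DL v))‖ := norm_sub_le _ _
    _ ≤ ‖Y x‖ * (‖localBracket K μ e‖ * ‖v‖) + B₂ * (‖Y x‖ * (‖DL‖ * ‖v‖)) := by
        refine add_le_add ((ContinuousLinearMap.opNorm_comp_le _ _).trans ?_)
          ((ContinuousLinearMap.le_opNorm _ _).trans ?_)
        · gcongr
          exact ContinuousLinearMap.le_opNorm _ _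
        · refine mul_le_mul h2.le ((ContinuousLinearMap.le_opNorm _ _).trans ?_)
            (norm_nonneg _) hB₂0
          gcongr
          exact ContinuousLinearMap.le_opNorm _ _
    _ = (‖localBracket K μ e‖ + B₂ * ‖DL‖) * ‖Y x‖ * ‖v‖ := by ring
    _ ≤ (‖localBracket K μ e‖ + B₂ * ‖DL‖) * ‖Y x‖ * (B₁ * ‖w‖) := by gcongr
    _ = _ := by ring

/-- An invertible derivation makes the cocycle a chart. -/
theorem IsAdCocycle.exists_localInverse (hμ : IsLocalGroup K μ e) (h : IsPositiveGrading b n D)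
    (hC : IsAdCocycle K μ e (Module.End.toContinuousLinearMap E D) C) :
    ∃ g : E → E, AnalyticAt K g 0 ∧ g 0 = e ∧ (∀ᶠ x in 𝓝 e, g (C x) = x) ∧
      (∀ᶠ y in 𝓝 0, C (g y) = y) ∧ ∃ g' : E →L[K] E, HasFDerivAt g g' 0 ∧ ∀ v, g' (D v) = v := by
  have : CompleteSpace E := FiniteDimensional.complete K E
  let Φ : E ≃L[K] E :=
    (LinearEquiv.ofInjectiveEndo D h.derivation_injective).toContinuousLinearEquiv
  obtain ⟨g, h1, h2, h3, h4, h5⟩ := hC.analyticAt.exists_localInverse (f' := Φ)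
    (by rw [hC.fderiv_base hμ]; rfl)
  rw [hC.map_base] at h1 h2 h4 h5
  exact ⟨g, h1, h2, h3, h4, _, h5, Φ.symm_apply_apply⟩

theorem IsAdCocycle.exists_injOn (hμ : IsLocalGroup K μ e) (h : IsPositiveGrading b n D)
    (hC : IsAdCocycle K μ e (Module.End.toContinuousLinearMap E D) C) :
    ∃ U ∈ 𝓝 e, Set.InjOn C U := by
  obtain ⟨g, -, -, hg, -⟩ := hC.exists_localInverse hμ h
  exact ⟨_, hg, fun x hx y hy hxy ↦ hx.symm.trans ((congrArg g hxy).trans hy)⟩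

/-- In the chart `C` the group law depends on the graded Lie algebra only. -/
theorem IsAdCocycle.map_mul_conjugatorL (hμ : IsLocalGroup K μ e)
    (hb : ∀ v w, localBracket K μ e v w = b v w) (h : IsPositiveGrading b n D)
    (hC : IsAdCocycle K μ e (Module.End.toContinuousLinearMap E D) C) :
    ∀ᶠ p in 𝓝 (e, e), C (μ p) = C p.1 + conjugator b n D (C p.1) (C p.2) := by
  have : CompleteSpace E := FiniteDimensional.complete K E
  filter_upwards [hC.map_mul hμ, (continuousAt_fst (p := (e, e))).eventually
    (hC.localAd_eq_conjugatorL hμ hb h)] with p h1 h2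
  rw [h1, h2, conjugatorL_apply]

/-- Homomorphisms of Lie algebras that respect the gradings integrate to germs of homomorphisms. In
the charts given by the cocycles, the germ is the linear map itself. -/
theorem IsAdCocycle.exists_isLocalGroupHom (hμ : IsLocalGroup K μ e) (hμ' : IsLocalGroup K μ' e')
    (hb : ∀ v w, localBracket K μ e v w = b v w) (hb' : ∀ v w, localBracket K μ' e' v w = b' v w)
    (h : IsPositiveGrading b n D) (h' : IsPositiveGrading b' n D')
    (hC : IsAdCocycle K μ e (Module.End.toContinuousLinearMap E D) C)
    (hC' : IsAdCocycle K μ' e' (Module.End.toContinuousLinearMap E' D') C')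
    {φ : E →ₗ[K] E'} (hφ : ∀ x y, φ (b x y) = b' (φ x) (φ y)) (hφD : ∀ x, φ (D x) = D' (φ x)) :
    ∃ f, IsLocalGroupHom K μ e μ' e' f ∧ (∀ v, fderiv K f e v = φ v) ∧
      ∀ᶠ x in 𝓝 e, C' (f x) = φ (C x) := by
  have : CompleteSpace E := FiniteDimensional.complete K E
  have : CompleteSpace E' := FiniteDimensional.complete K E'
  obtain ⟨g, hg, hg0, hgC, hCg, g', hg', hg'D⟩ := hC'.exists_localInverse hμ' h'
  set f : E → E' := fun x ↦ g (φ (C x)) with hf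
  have hφC : AnalyticAt K (fun x ↦ φ (C x)) e := (φ.analyticAt_toFun _).comp hC.analyticAt
  have hφC0 : φ (C e) = 0 := by rw [hC.map_base, map_zero]
  have hfe : f e = e' := by rw [hf]; simp only [hφC0, hg0]
  have hfa : AnalyticAt K f e := AnalyticAt.comp_of_eq hg hφC hφC0
  have hφCt : Tendsto (fun x ↦ φ (C x)) (𝓝 e) (𝓝 0) := by
    simpa only [ContinuousAt, hφC0] using hφC.continuousAt
  have hCf : ∀ᶠ x in 𝓝 e, C' (f x) = φ (C x) := hφCt.eventually hCg
  have hft : Tendsto f (𝓝 e) (𝓝 e') := by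
    simpa only [ContinuousAt, hfe] using hfa.continuousAt
  refine ⟨f, ⟨hfa, hfe, ?_⟩, fun v ↦ ?_, hCf⟩
  · have hfst : Tendsto (fun p : E × E ↦ p.1) (𝓝 (e, e)) (𝓝 e) := continuousAt_fst
    have hsnd : Tendsto (fun p : E × E ↦ p.2) (𝓝 (e, e)) (𝓝 e) := continuousAt_snd
    have hff : Tendsto (fun p : E × E ↦ (f p.1, f p.2)) (𝓝 (e, e)) (𝓝 (e', e')) :=
      (hft.comp hfst).prodMk_nhds (hft.comp hsnd)
    filter_upwards [hC.map_mul_conjugatorL hμ hb h,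
      hff.eventually (hC'.map_mul_conjugatorL hμ' hb' h'), hfst.eventually hCf,
      hsnd.eventually hCf, (hμ'.tendsto_mul.comp hff).eventually hgC] with p h1 h2 h3 h4 h5
    simp only [Function.comp_apply] at h5
    rw [← h5, h2, h3, h4, ← map_conjugator hφ hφD, ← map_add, ← h1]
  · have d1 : HasFDerivAt f _ e := HasFDerivAt.comp e (by rw [hφC0]; exact hg')
      ((LinearMap.toContinuousLinearMap φ).hasFDerivAt.comp e
        hC.analyticAt.differentiableAt.hasFDerivAt)
    rw [d1.fderiv, hC.fderiv_base hμ]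
    exact (congrArg g' (hφD v)).trans (hg'D _)

end LocalEquivalence

/-! ### Linear parts of contractive maps -/

section StableFixedPoint

open Filter BoundedContinuousFunction

variable {K : Type*} [NontriviallyNormedField K]

theorem isCompl_rootNormSpace {L : Type*} [AddCommGroup L] [Module K L] [FiniteDimensional K L]
    (β : L ≃ₗ[K] L) : IsCompl (rootNormSpace β (· < 1)) (rootNormSpace β (1 ≤ ·)) := by
  refine ⟨disjoint_rootNormSpace fun t ht ht' ↦ by linarith, codisjoint_iff.2 (top_unique ?_)⟩
  rw [← iSup_rootNormSpace β]
  refine iSup_le fun r ↦ ?_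
  rcases lt_or_ge r 1 with hr | hr
  · exact le_sup_of_le_left (rootNormSpace_mono fun t ht ↦ ht ▸ hr)
  · exact le_sup_of_le_right (rootNormSpace_mono fun t ht ↦ ht ▸ hr)

section BoundedFamily

variable {V F : Type*} [AddCommGroup V] [Module K V] [NormedAddCommGroup F] [NormedSpace K F]

/-- A pointwise bounded sequence of linear maps `T n : V → F`, as a linear map to the space of
bounded sequences in `F`. The norm of the value at `x` is the supremum of the norms of `T n x`. -/
noncomputable def boundedFamily (T : ℕ → V →ₗ[K] F) (hT : ∀ x, ∃ B : ℝ, ∀ n, ‖T n x‖ ≤ B) :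
    V →ₗ[K] (ℕ →ᵇ F) where
  toFun x := ofNormedAddCommGroupDiscrete (fun n ↦ T n x) (hT x).choose (hT x).choose_spec
  map_add' x y := by ext n; exact (T n).map_add x y
  map_smul' c x := by ext n; exact (T n).map_smul c x

theorem boundedFamily_apply (T : ℕ → V →ₗ[K] F) (hT : ∀ x, ∃ B : ℝ, ∀ n, ‖T n x‖ ≤ B) (x : V)
    (n : ℕ) : boundedFamily T hT x n = T n x := rfl

theorem BoundedContinuousFunction.norm_add_le_max_of_ultrametric [IsUltrametricDist F]
    (f g : ℕ →ᵇ F) : ‖f + g‖ ≤ max ‖f‖ ‖g‖ :=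
  (norm_le (le_max_of_le_left (norm_nonneg f))).2 fun n ↦
    (IsUltrametricDist.norm_add_le_max (f n) (g n)).trans
      (max_le_max (f.norm_coe_le_norm n) (g.norm_coe_le_norm n))

end BoundedFamily

variable [IsUltrametricDist K] [CompleteSpace K]
  {E : Type*} [NormedAddCommGroup E] [NormedSpace K E] [FiniteDimensional K E]

/-- The linearization of a map at a stable and attracting fixed point has no eigenvalues of norm at
least `1`. Otherwise, in norms adapted to the splitting of the space by the size of the eigenvalues,
the vectors whose expanding component dominates form a cone that is preserved by the map, and the
norm of that component does not decrease along the orbits in the cone. -/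
theorem rootNormSpace_eq_bot_of_stable (A : E ≃ₗ[K] E) {f : E → E} {e : E} (hfe : f e = e)
    (hf : HasFDerivAt f (Module.End.toContinuousLinearMap E A.toLinearMap) e)
    (hstab : ∀ U ∈ 𝓝 e, ∃ W ∈ 𝓝 e, ∀ x ∈ W, ∀ k, f^[k] x ∈ U)
    (hattr : ∀ᶠ x in 𝓝 e, Tendsto (fun k ↦ f^[k] x) atTop (𝓝 e)) :
    rootNormSpace A (1 ≤ ·) = ⊥ := by
  set S := rootNormSpace A (· < 1) with hS
  set C := rootNormSpace A (1 ≤ ·) with hC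
  have hSC : IsCompl S C := isCompl_rootNormSpace A
  have hAS : ∀ x ∈ S, A x ∈ S := fun x hx ↦
    map_mem_rootNormSpace (φ := A.toLinearMap) (fun _ ↦ rfl) hx
  have hAC : ∀ x ∈ C, A x ∈ C := fun x hx ↦
    map_mem_rootNormSpace (φ := A.toLinearMap) (fun _ ↦ rfl) hx
  set PS := Submodule.projection S C hSC with hPS
  set PC := Submodule.projection C S hSC.symm with hPC
  have hsum : ∀ x, PS x + PC x = x := fun x ↦ Submodule.projection_add_projection_eq_self hSC x
  have hPSA : ∀ x, PS (A x) = A (PS x) := by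
    intro x
    conv_lhs => rw [← hsum x]
    rw [map_add, map_add,
      Submodule.projection_apply_of_mem_right hSC (hAC _ (Submodule.projection_apply_mem _ _)),
      add_zero, Submodule.projection_apply_of_mem_left hSC
        (hAS _ (Submodule.projection_apply_mem _ _))]
  have hPCA : ∀ x, PC (A x) = A (PC x) := by
    intro x
    conv_lhs => rw [← hsum x]
    rw [map_add, map_add, Submodule.projection_apply_of_mem_right hSC.symm
        (hAS _ (Submodule.projection_apply_mem _ _)),
      zero_add, Submodule.projection_apply_of_mem_left hSC.symm
        (hAC _ (Submodule.projection_apply_mem _ _))]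
  let ι := (Module.finBasis K E).equivFun
  -- the orbits of the two components, forwards and backwards, are bounded
  have hTS : ∀ x, ∃ B : ℝ, ∀ n : ℕ,
      ‖(ι.toLinearMap ∘ₗ (A ^ (n : ℤ)).toLinearMap ∘ₗ PS) x‖ ≤ B := by
    intro x
    obtain ⟨P, hP, hx⟩ : PS x ∈ S := Submodule.projection_apply_mem _ _
    choose B hB using fun i ↦ (hP.mono fun t ht ↦ le_of_lt ht).norm_forward_le one_pos hx
      (LinearMap.proj i ∘ₗ ι.toLinearMap)
    refine ⟨∑ i, |B i|, fun n ↦ (pi_norm_le_iff_of_nonneg (by positivity)).2 fun i ↦ ?_⟩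
    refine (hB i n).trans ?_
    rw [one_pow, mul_one]
    exact (le_abs_self _).trans
      (Finset.single_le_sum (f := fun i ↦ |B i|) (fun _ _ ↦ abs_nonneg _) (Finset.mem_univ i))
  have hTC : ∀ x, ∃ B : ℝ, ∀ n : ℕ,
      ‖(ι.toLinearMap ∘ₗ (A ^ (-(n : ℤ))).toLinearMap ∘ₗ PC) x‖ ≤ B := by
    intro x
    obtain ⟨P, hP, hx⟩ : PC x ∈ C := Submodule.projection_apply_mem _ _
    choose B hB using fun i ↦ hP.norm_backward_le one_pos hx (LinearMap.proj i ∘ₗ ι.toLinearMap)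
    refine ⟨∑ i, |B i|, fun n ↦ (pi_norm_le_iff_of_nonneg (by positivity)).2 fun i ↦ ?_⟩
    refine (hB i n).trans ?_
    rw [inv_one, one_pow, mul_one]
    exact (le_abs_self _).trans
      (Finset.single_le_sum (f := fun i ↦ |B i|) (fun _ _ ↦ abs_nonneg _) (Finset.mem_univ i))
  set R := boundedFamily _ hTS with hR
  set Q := boundedFamily _ hTC with hQ
  have hRA : ∀ x, ‖R (A x)‖ ≤ ‖R x‖ := by
    intro x
    refine (norm_le (norm_nonneg _)).2 fun n ↦ ?_
    have h1 : R (A x) n = R x (n + 1) := by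
      simp only [hR, boundedFamily_apply, LinearMap.comp_apply, hPSA]
      congr 1
    exact h1 ▸ (R x).norm_coe_le_norm _
  have hQA : ∀ x, ‖Q x‖ ≤ ‖Q (A x)‖ := by
    intro x
    refine (norm_le (norm_nonneg _)).2 fun n ↦ ?_
    have h1 : Q x n = Q (A x) (n + 1) := by
      simp only [hQ, boundedFamily_apply, LinearMap.comp_apply, hPCA]
      congr 1
      have : (-((n + 1 : ℕ) : ℤ)) = -(n : ℤ) + -1 := by push_cast; ring
      rw [this, zpow_add, zpow_neg_one]
      exact congrArg _ (A.symm_apply_apply _).symm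
    exact h1 ▸ (Q (A x)).norm_coe_le_norm _
  -- `‖Φ x‖` is the maximum of `‖Q x‖` and `‖R x‖`, and is a norm equivalent to the given one
  let Φ : E →ₗ[K] (ℕ →ᵇ (Fin _ → K)) × (ℕ →ᵇ (Fin _ → K)) := Q.prod R
  have hΦinj : Function.Injective Φ := by
    rw [← LinearMap.ker_eq_bot, LinearMap.ker_eq_bot']
    intro x hx
    have h1 : Q x 0 = 0 := congrArg (fun p ↦ p.1 0) hx
    have h2 : R x 0 = 0 := congrArg (fun p ↦ p.2 0) hx
    have h3 : PC x = 0 := ι.map_eq_zero_iff.1 h1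
    have h4 : PS x = 0 := ι.map_eq_zero_iff.1 h2
    rw [← hsum x, h3, h4, add_zero]
  obtain ⟨c, hc, hanti⟩ := Φ.injective_iff_antilipschitz.1 hΦinj
  have hlow : ∀ x, ‖x‖ ≤ c * ‖Φ x‖ := ZeroHomClass.bound_of_antilipschitz Φ hanti
  set ΦL := LinearMap.toContinuousLinearMap Φ with hΦL
  have hup : ∀ x, ‖Φ x‖ ≤ ‖ΦL‖ * ‖x‖ := ΦL.le_opNorm
  have step : ∀ z w, ‖R z‖ ≤ ‖Q z‖ → ‖Φ (w - A z)‖ ≤ 1 / 2 * ‖Φ z‖ →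
      ‖R w‖ ≤ ‖Q w‖ ∧ ‖Q z‖ ≤ ‖Q w‖ := by
    intro z w h1 h2
    have hz : ‖Φ z‖ = ‖Q z‖ := max_eq_left h1
    rw [hz] at h2
    have hQρ : ‖Q (w - A z)‖ ≤ 1 / 2 * ‖Q z‖ := (le_max_left _ _).trans h2
    have hRρ : ‖R (w - A z)‖ ≤ 1 / 2 * ‖Q z‖ := (le_max_right _ _).trans h2
    have h3 : ‖R w‖ ≤ ‖Q z‖ := by
      have e : R w = R (A z) + R (w - A z) := by rw [← map_add]; congr 1; abel
      rw [e]
      refine (norm_add_le_max_of_ultrametric _ _).trans (max_le ((hRA z).trans h1) ?_)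
      linarith [norm_nonneg (Q z)]
    have h4 : ‖Q z‖ ≤ ‖Q w‖ := by
      have e : Q (A z) = Q w + -Q (w - A z) := by rw [← map_neg, ← map_add]; congr 1; abel
      have h5 := (hQA z).trans (e ▸ norm_add_le_max_of_ultrametric (Q w) (-Q (w - A z)))
      rw [norm_neg] at h5
      rcases le_max_iff.1 h5 with h6 | h6
      · exact h6
      · linarith [norm_nonneg (Q w), norm_nonneg (Q z)]
    exact ⟨h3.trans h4, h4⟩
  -- the remainder in the expansion of `f` at `e` is small in the adapted norm
  have hsmall : ∀ᶠ x in 𝓝 e, ‖Φ (f x - e - A (x - e))‖ ≤ 1 / 2 * ‖Φ (x - e)‖ := by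
    have hε : 0 < (1 / 2 / ((‖ΦL‖ + 1) * c) : ℝ) := by positivity
    filter_upwards [hf.isLittleO.def hε] with x hx
    rw [hfe] at hx
    calc ‖Φ (f x - e - A (x - e))‖ ≤ ‖ΦL‖ * ‖f x - e - A (x - e)‖ := hup _
      _ ≤ (‖ΦL‖ + 1) * (1 / 2 / ((‖ΦL‖ + 1) * c) * ‖x - e‖) := by
          gcongr
          · linarith
          · exact hx
      _ ≤ (‖ΦL‖ + 1) * (1 / 2 / ((‖ΦL‖ + 1) * c) * (c * ‖Φ (x - e)‖)) := by
          gcongr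
          exact hlow _
      _ = 1 / 2 * ‖Φ (x - e)‖ := by
          have : (c : ℝ) ≠ 0 := by exact_mod_cast hc.ne'
          have : ‖ΦL‖ + 1 ≠ 0 := by positivity
          field_simp
  rw [Submodule.eq_bot_iff]
  intro x₀ hx₀
  by_contra hne
  obtain ⟨W, hW, hWU⟩ := hstab _ hsmall
  have hW' : ∀ᶠ x in 𝓝 e, x ∈ W := hW
  have hcont : Tendsto (fun t : K ↦ e + t • x₀) (𝓝[≠] 0) (𝓝 e) := by
    have h1 : Continuous fun t : K ↦ e + t • x₀ := by fun_prop
    have h2 := h1.tendsto 0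
    rw [zero_smul, add_zero] at h2
    exact h2.mono_left nhdsWithin_le_nhds
  obtain ⟨t, ⟨htW, hta⟩, ht0⟩ := ((hcont.eventually (hW'.and hattr)).and
    self_mem_nhdsWithin).exists
  have hz : f^[0] (e + t • x₀) - e = t • x₀ := by simp
  have hPC0 : PC (t • x₀) = t • x₀ :=
    Submodule.projection_apply_of_mem_left hSC.symm (C.smul_mem t hx₀)
  have hPS0 : PS (t • x₀) = 0 := Submodule.projection_apply_of_mem_right hSC (C.smul_mem t hx₀)
  have hQ0 : 0 < ‖Q (t • x₀)‖ := by
    refine norm_pos_iff.2 fun h0 ↦ ?_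
    have h1 : Q (t • x₀) 0 = 0 := by rw [h0]; rfl
    have h3 : PC (t • x₀) = 0 := ι.map_eq_zero_iff.1 h1
    rw [hPC0, smul_eq_zero] at h3
    exact h3.elim ht0 hne
  have hR0 : R (t • x₀) = 0 := by
    ext n
    simp only [hR, boundedFamily_apply, LinearMap.comp_apply, hPS0, map_zero]
    rfl
  have hcone : ∀ k, ‖R (f^[k] (e + t • x₀) - e)‖ ≤ ‖Q (f^[k] (e + t • x₀) - e)‖ ∧
      ‖Q (t • x₀)‖ ≤ ‖Q (f^[k] (e + t • x₀) - e)‖ := by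
    intro k
    induction k with
    | zero =>
      rw [hz, hR0, norm_zero]
      exact ⟨norm_nonneg _, le_rfl⟩
    | succ k ih =>
      have h1 := hWU _ htW k
      rw [Function.iterate_succ_apply']
      obtain ⟨h2, h3⟩ := step _ _ ih.1 h1
      exact ⟨h2, ih.2.trans h3⟩
  have hlim : Tendsto (fun k ↦ ‖Q (f^[k] (e + t • x₀) - e)‖) atTop (𝓝 0) := by
    have h1 : Continuous fun x ↦ ‖Q (x - e)‖ :=
      (Q.continuous_of_finiteDimensional.comp (continuous_id.sub continuous_const)).norm
    have h2 := (h1.tendsto e).comp hta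
    simpa [Function.comp_def] using h2
  exact absurd (ge_of_tendsto' hlim fun k ↦ (hcone k).2) (not_le.2 hQ0)

theorem tendsto_zpow_of_rootNormSpace_eq_bot {L : Type*} [AddCommGroup L] [Module K L]
    [FiniteDimensional K L] {A : L ≃ₗ[K] L} (hA : rootNormSpace A (1 ≤ ·) = ⊥) (x : L)
    (ℓ : L →ₗ[K] K) : Tendsto (fun n : ℕ ↦ ℓ ((A ^ (n : ℤ)) x)) atTop (𝓝 0) := by
  have hx : x ∈ ⨆ r : ℝ, rootNormSpace A (· = r) := by rw [iSup_rootNormSpace]; trivial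
  induction hx using Submodule.iSup_induction' with
  | zero => simp
  | add x y _ _ hx hy => simpa using hx.add hy
  | mem r x hx =>
    rcases le_or_gt r 0 with hr | hr
    · rw [rootNormSpace_eq_bot_of_nonpos A hr, Submodule.mem_bot] at hx
      simp [hx]
    rcases le_or_gt 1 r with hr1 | hr1
    · have : x ∈ rootNormSpace A (1 ≤ ·) := rootNormSpace_mono (fun t ht ↦ ht ▸ hr1) hx
      rw [hA, Submodule.mem_bot] at this
      simp [this]
    obtain ⟨P, hP, hPx⟩ := hx
    obtain ⟨B, hB⟩ := (hP.mono fun t ht ↦ ht.le).norm_forward_le hr hPx ℓ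
    refine squeeze_zero_norm hB ?_
    simpa using (tendsto_pow_atTop_nhds_zero_of_lt_one hr.le hr1).const_mul B

end StableFixedPoint

section Stability

open Filter

/-- A contractive automorphism of a Baire group is stable at the identity. -/
theorem exists_nhds_forall_iterate_mem {G : Type*} [Group G] [TopologicalSpace G]
    [IsTopologicalGroup G] {α : G ≃* G} (hα : Continuous α) (hcon : IsContractiveAut α)
    {O : Set G} (hO : IsOpen O) (hO1 : (1 : G) ∈ O) (hOb : BaireSpace O) {U : Set G}
    (hU : U ∈ 𝓝 1) : ∃ W ∈ 𝓝 (1 : G), ∀ x ∈ W, ∀ k, (α : G → G)^[k] x ∈ U := by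
  obtain ⟨V, hV, hVc, hVi, hVU⟩ := exists_closed_nhds_one_inv_eq_mul_subset hU
  have hαk : ∀ k, Continuous (α : G → G)^[k] := fun k ↦ hα.iterate k
  let F : ℕ → Set G := fun n ↦ {x | ∀ k, n ≤ k → (α : G → G)^[k] x ∈ V}
  have hFc : ∀ n, IsClosed (F n) := by
    intro n
    simp only [F, Set.ofPred_forall]
    exact isClosed_iInter fun k ↦ isClosed_iInter fun _ ↦ hVc.preimage (hαk k)
  have : Nonempty O := ⟨⟨1, hO1⟩⟩
  obtain ⟨n, x, hx⟩ := nonempty_interior_of_iUnion_of_closed (X := O)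
    (f := fun n ↦ Subtype.val ⁻¹' F n) (fun n ↦ (hFc n).preimage continuous_subtype_val) (by
      refine Set.eq_univ_of_forall fun x ↦ Set.mem_iUnion.2 ?_
      obtain ⟨n, hn⟩ := eventually_atTop.1 ((hcon x).eventually hV)
      exact ⟨n, hn⟩)
  have hxF : F n ∈ 𝓝 (x : G) := by
    have h1 : Subtype.val ⁻¹' F n ∈ 𝓝 x := mem_interior_iff_mem_nhds.1 hx
    rw [nhds_subtype_eq_comap, mem_comap] at h1
    obtain ⟨T, hT, hTF⟩ := h1
    filter_upwards [hT, hO.mem_nhds x.2] with y hy hyO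
    exact hTF (show (⟨y, hyO⟩ : O) ∈ Subtype.val ⁻¹' T from hy)
  -- from `n` on, translate to the identity; the finitely many earlier iterates are continuous
  have h1 : ∀ᶠ y in 𝓝 (1 : G), (x : G) * y ∈ F n := by
    have : Tendsto (fun y ↦ (x : G) * y) (𝓝 1) (𝓝 (x : G)) := by
      simpa using (continuous_const_mul (x : G)).tendsto 1
    exact this hxF
  have h2 : ∀ᶠ y in 𝓝 (1 : G), ∀ k ∈ Finset.range n, (α : G → G)^[k] y ∈ U := by
    rw [Filter.eventually_all_finset]
    intro k _
    refine (hαk k).continuousAt ?_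
    rwa [iterate_map_one]
  refine ⟨_, h1.and h2, fun y hy k ↦ ?_⟩
  rcases lt_or_ge k n with hk | hk
  · exact hy.2 k (Finset.mem_range.2 hk)
  · have e1 := hy.1 k hk
    have e2 : (α : G → G)^[k] (x : G) ∈ V := mem_of_mem_nhds hxF k hk
    rw [iterate_map_mul] at e1
    refine hVU ⟨_, (hVi ▸ Set.inv_mem_inv.2 e2 : ((α : G → G)^[k] (x : G))⁻¹ ∈ V), _, e1, ?_⟩
    simp

end Stability

/-! ### The germ of a Lie group in a chart -/

section ChartAtOne

open Filter VectorField Set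

variable {K : Type*} [NontriviallyNormedField K]
  {E : Type*} [NormedAddCommGroup E] [NormedSpace K E]
  {E' : Type*} [NormedAddCommGroup E'] [NormedSpace K E']
  {G : Type*} [Group G] [TopologicalSpace G] [ChartedSpace E G]
  {H : Type*} [Group H] [TopologicalSpace H] [ChartedSpace E' H]

/-- The multiplication of a Lie group, read in the preferred chart at the identity. -/
noncomputable def chartMul (E : Type*) (G : Type*) [NormedAddCommGroup E] [Group G]
    [TopologicalSpace G] [ChartedSpace E G] (p : E × E) : E :=
  chartAt E (1 : G) ((chartAt E (1 : G)).symm p.1 * (chartAt E (1 : G)).symm p.2)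

/-- A map between groups, read in the preferred charts at the identities. -/
noncomputable def chartRep (E E' : Type*) {G H : Type*} [NormedAddCommGroup E]
    [NormedAddCommGroup E'] [Group G] [TopologicalSpace G] [ChartedSpace E G] [Group H]
    [TopologicalSpace H] [ChartedSpace E' H] (f : G → H) (x : E) : E' :=
  chartAt E' (1 : H) (f ((chartAt E (1 : G)).symm x))

theorem chartAt_symm_one : (chartAt E (1 : G)).symm (chartAt E (1 : G) 1) = 1 :=
  (chartAt E (1 : G)).left_inv (mem_chart_source E 1)

theorem eventually_mem_chart_target : ∀ᶠ x in 𝓝 (chartAt E (1 : G) 1),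
    x ∈ (chartAt E (1 : G)).target :=
  chart_target_mem_nhds E 1

theorem tendsto_chartAt_symm :
    Tendsto (chartAt E (1 : G)).symm (𝓝 (chartAt E (1 : G) 1)) (𝓝 1) := by
  have h := (chartAt E (1 : G)).continuousAt_symm (mem_chart_target E (1 : G))
  rwa [ContinuousAt, chartAt_symm_one] at h

theorem tendsto_chartAt_symm_mul [ContinuousMul G] : Tendsto
    (fun p : E × E ↦ (chartAt E (1 : G)).symm p.1 * (chartAt E (1 : G)).symm p.2)
    (𝓝 (chartAt E (1 : G) 1, chartAt E (1 : G) 1)) (𝓝 1) := by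
  have h1 : Tendsto (fun p : E × E ↦ (chartAt E (1 : G)).symm p.1)
      (𝓝 (chartAt E (1 : G) 1, chartAt E (1 : G) 1)) (𝓝 1) :=
    tendsto_chartAt_symm.comp continuousAt_fst
  have h2 : Tendsto (fun p : E × E ↦ (chartAt E (1 : G)).symm p.2)
      (𝓝 (chartAt E (1 : G) 1, chartAt E (1 : G) 1)) (𝓝 1) :=
    tendsto_chartAt_symm.comp continuousAt_snd
  simpa using h1.mul h2

theorem eventually_chartAt_symm_chartMul [ContinuousMul G] :
    ∀ᶠ p : E × E in 𝓝 (chartAt E (1 : G) 1, chartAt E (1 : G) 1),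
      (chartAt E (1 : G)).symm (chartMul E G p) =
        (chartAt E (1 : G)).symm p.1 * (chartAt E (1 : G)).symm p.2 := by
  filter_upwards [(tendsto_chartAt_symm_mul).eventually (chart_source_mem_nhds E (1 : G))]
    with p hp
  exact (chartAt E (1 : G)).left_inv hp

theorem fderiv_chartRep {f : G → H} (hf1 : f 1 = 1)
    (hf : MDifferentiableAt 𝓘(K, E) 𝓘(K, E') f (1 : G)) (v : E) :
    fderiv K (chartRep E E' f) (chartAt E (1 : G) 1) v =
      (mfderiv 𝓘(K, E) 𝓘(K, E') f (1 : G) v : E') := by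
  have h1 : chartRep E E' f = writtenInExtChartAt 𝓘(K, E) 𝓘(K, E') 1 f := by
    ext x
    simp only [writtenInExtChartAt, hf1]
    rfl
  have h2 : (mfderiv 𝓘(K, E) 𝓘(K, E') f (1 : G) v : E') = fderivWithin K
      (writtenInExtChartAt 𝓘(K, E) 𝓘(K, E') 1 f) (range 𝓘(K, E))
      (extChartAt 𝓘(K, E) (1 : G) 1) v :=
    congrArg (fun L : E →L[K] E' ↦ L v) (if_pos hf)
  rw [h2, h1, modelWithCornersSelf_coe, range_id, fderivWithin_univ]
  rfl

variable [LieGroup 𝓘(K, E) ω G] [LieGroup 𝓘(K, E') ω H]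

theorem contMDiffAt_chartAt_one {g : G} (hg : g ∈ (chartAt E (1 : G)).source) :
    ContMDiffAt 𝓘(K, E) 𝓘(K, E) ω (chartAt E (1 : G)) g :=
  (contMDiffOn_chart (I := 𝓘(K, E)) (x := (1 : G))).contMDiffAt
    ((chartAt E (1 : G)).open_source.mem_nhds hg)

theorem contMDiffAt_chartAt_one_symm {x : E} (hx : x ∈ (chartAt E (1 : G)).target) :
    ContMDiffAt 𝓘(K, E) 𝓘(K, E) ω (chartAt E (1 : G)).symm x :=
  (contMDiffOn_chart_symm (I := 𝓘(K, E)) (x := (1 : G))).contMDiffAt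
    ((chartAt E (1 : G)).open_target.mem_nhds hx)

theorem analyticAt_chartRep [CompleteSpace E'] {f : G → H} (hf1 : f 1 = 1)
    (hf : ContMDiffAt 𝓘(K, E) 𝓘(K, E') ω f 1) :
    AnalyticAt K (chartRep E E' f) (chartAt E (1 : G) 1) := by
  refine (contMDiffAt_iff_contDiffAt.1 ?_ : ContDiffAt K ω _ _).analyticAt
  have h1 : ContMDiffAt 𝓘(K, E) 𝓘(K, E) ω (chartAt E (1 : G)).symm (chartAt E (1 : G) 1) :=
    contMDiffAt_chartAt_one_symm (mem_chart_target E (1 : G))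
  have h2 : ContMDiffAt 𝓘(K, E) 𝓘(K, E') ω (f ∘ (chartAt E (1 : G)).symm) (chartAt E (1 : G) 1) :=
    ContMDiffAt.comp _ (by rwa [chartAt_symm_one]) h1
  refine ContMDiffAt.comp (g := chartAt E' (1 : H)) _ (contMDiffAt_chartAt_one ?_) h2
  simp only [chartAt_symm_one, hf1]
  exact mem_chart_source E' 1

variable (K E G) in
theorem isLocalGroup_chartMul [CompleteSpace E] :
    IsLocalGroup K (chartMul E G) (chartAt E (1 : G) 1) where
  analyticAt := by
    set e := chartAt E (1 : G) 1 with he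
    refine (contMDiffAt_iff_contDiffAt.1 ?_ : ContDiffAt K ω _ _).analyticAt
    have h0 : ContMDiffAt 𝓘(K, E) 𝓘(K, E) ω (chartAt E (1 : G)).symm e :=
      contMDiffAt_chartAt_one_symm (mem_chart_target E (1 : G))
    have h1 : ContMDiffAt 𝓘(K, E × E) 𝓘(K, E) ω (fun p : E × E ↦ (chartAt E (1 : G)).symm p.1)
        (e, e) := ContMDiffAt.comp (e, e) (g := (chartAt E (1 : G)).symm) h0
      (contDiff_fst (𝕜 := K) (E := E) (F := E)).contMDiff.contMDiffAt
    have h2 : ContMDiffAt 𝓘(K, E × E) 𝓘(K, E) ω (fun p : E × E ↦ (chartAt E (1 : G)).symm p.2)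
        (e, e) := ContMDiffAt.comp (e, e) (g := (chartAt E (1 : G)).symm) h0
      (contDiff_snd (𝕜 := K) (E := E) (F := E)).contMDiff.contMDiffAt
    refine ContMDiffAt.comp (g := chartAt E (1 : G)) (e, e) (contMDiffAt_chartAt_one ?_) (h1.mul h2)
    simp only [he, chartAt_symm_one, mul_one]
    exact mem_chart_source E 1
  one_mul := by
    filter_upwards [eventually_mem_chart_target] with x hx
    rw [chartMul, chartAt_symm_one, one_mul, (chartAt E (1 : G)).right_inv hx]
  mul_one := by
    filter_upwards [eventually_mem_chart_target] with x hx
    rw [chartMul, chartAt_symm_one, mul_one, (chartAt E (1 : G)).right_inv hx]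
  assoc := by
    have : IsTopologicalGroup G := topologicalGroup_of_lieGroup 𝓘(K, E) ω
    set e := chartAt E (1 : G) 1 with he
    have h1 : Tendsto (fun t : E × E × E ↦ (t.1, t.2.1)) (𝓝 (e, e, e)) (𝓝 (e, e)) :=
      Continuous.tendsto (by fun_prop) (e, e, e)
    have h2 : Tendsto (fun t : E × E × E ↦ t.2) (𝓝 (e, e, e)) (𝓝 (e, e)) :=
      Continuous.tendsto (by fun_prop) (e, e, e)
    filter_upwards [h1.eventually (eventually_chartAt_symm_chartMul),
      h2.eventually (eventually_chartAt_symm_chartMul)] with t h3 h4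
    change chartAt E (1 : G) ((chartAt E (1 : G)).symm (chartMul E G (t.1, t.2.1)) *
      (chartAt E (1 : G)).symm t.2.2) = chartAt E (1 : G) ((chartAt E (1 : G)).symm t.1 *
        (chartAt E (1 : G)).symm (chartMul E G t.2))
    rw [h3, h4, mul_assoc]

theorem isLocalGroupHom_chartRep [CompleteSpace E'] {f : G →* H}
    (hf : ContMDiff 𝓘(K, E) 𝓘(K, E') ω f) :
    IsLocalGroupHom K (chartMul E G) (chartAt E (1 : G) 1) (chartMul E' H) (chartAt E' (1 : H) 1)
      (chartRep E E' f) where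
  analyticAt := analyticAt_chartRep f.map_one (hf 1)
  map_base := by rw [chartRep, chartAt_symm_one, f.map_one]
  map_mul := by
    have : IsTopologicalGroup G := topologicalGroup_of_lieGroup 𝓘(K, E) ω
    have h1 : Tendsto (fun x ↦ f ((chartAt E (1 : G)).symm x)) (𝓝 (chartAt E (1 : G) 1)) (𝓝 1) := by
      have h2 := hf.continuous.tendsto 1
      rw [f.map_one] at h2
      exact h2.comp tendsto_chartAt_symm
    have h2 : ∀ᶠ x in 𝓝 (chartAt E (1 : G) 1), (chartAt E' (1 : H)).symm (chartRep E E' f x) =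
        f ((chartAt E (1 : G)).symm x) := by
      filter_upwards [h1.eventually (chart_source_mem_nhds E' (1 : H))] with x hx
      exact (chartAt E' (1 : H)).left_inv hx
    filter_upwards [eventually_chartAt_symm_chartMul,
      (continuousAt_fst (p := (chartAt E (1 : G) 1, chartAt E (1 : G) 1))).eventually h2,
      (continuousAt_snd (p := (chartAt E (1 : G) 1, chartAt E (1 : G) 1))).eventually h2]
      with p h3 h4 h5
    rw [chartRep, h3, map_mul, chartMul, h4, h5]

/-- The bracket of left invariant vector fields on a Lie group, computed in the chart at the
identity. -/
theorem lie_eq_localBracket [CompleteSpace E] (v w : GroupLieAlgebra 𝓘(K, E) G) :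
    (⁅v, w⁆ : GroupLieAlgebra 𝓘(K, E) G) =
      localBracket K (chartMul E G) (chartAt E (1 : G) 1) v w := by
  set e : E := chartAt E (1 : G) 1 with he
  set μ := chartMul E G with hμ
  have hloc : IsLocalGroup K μ e := isLocalGroup_chartMul K E G
  have : IsManifold 𝓘(K, E) 2 G := IsManifold.of_le (n := ω) le_top
  have : IsManifold 𝓘(K, E) 1 G := IsManifold.of_le (n := ω) le_top
  set φ := extChartAt 𝓘(K, E) (1 : G) with hφ
  have hφ1 : φ 1 = e := rfl
  have id1 : (mfderiv 𝓘(K, E) 𝓘(K, E) φ (1 : G) : E →L[K] E) = ContinuousLinearMap.id K E :=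
    mfderiv_extChartAt_self
  -- in the chart, the invariant vector field of `u` is `y ↦ dsnd μ (y, e) u`
  have key : ∀ᶠ y in 𝓝 e, ∀ u : GroupLieAlgebra 𝓘(K, E) G,
      (mpullbackWithin 𝓘(K, E) 𝓘(K, E) φ.symm (mulInvariantVectorField u) univ y : E) =
        dsnd K μ (y, e) u := by
    filter_upwards [eventually_mem_chart_target, hloc.eventually_differentiableAt_left]
      with y hy hdiff u
    have hy' : y ∈ φ.target := by
      simpa only [hφ, extChartAt_target, modelWithCornersSelf_coe, range_id, inter_univ,
        modelWithCornersSelf_coe_symm, preimage_id] using hy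
    have i1 : (mfderivWithin 𝓘(K, E) 𝓘(K, E) φ.symm univ y).IsInvertible := by
      have := isInvertible_mfderivWithin_extChartAt_symm (I := 𝓘(K, E)) hy'
      simpa only [modelWithCornersSelf_coe, range_id] using this
    have i2 : (mfderivWithin 𝓘(K, E) 𝓘(K, E) φ.symm univ y).comp
        (mfderiv 𝓘(K, E) 𝓘(K, E) φ (φ.symm y)) = ContinuousLinearMap.id _ _ := by
      have := mfderivWithin_extChartAt_symm_comp_mfderiv_extChartAt (I := 𝓘(K, E)) hy'
      simpa only [modelWithCornersSelf_coe, range_id] using this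
    have m1 : MDifferentiableAt 𝓘(K, E) 𝓘(K, E) (φ.symm y * ·) (1 : G) :=
      (contMDiff_mul_left (I := 𝓘(K, E)) (n := ω) (a := φ.symm y) 1).mdifferentiableAt (by simp)
    have m2 : MDifferentiableAt 𝓘(K, E) 𝓘(K, E) φ (φ.symm y * 1) := by
      rw [mul_one]
      exact mdifferentiableAt_extChartAt ((chartAt E (1 : G)).map_target hy)
    have m3 : MDifferentiableAt 𝓘(K, E) 𝓘(K, E) φ (1 : G) :=
      mdifferentiableAt_extChartAt (mem_chart_source E (1 : G))
    have d1 : HasFDerivAt (fun z ↦ μ (y, z)) (dsnd K μ (y, e)) e := hasFDerivAt_dsnd hdiff.1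
    have heq : φ ∘ (φ.symm y * ·) =ᶠ[𝓝 (1 : G)] (fun z ↦ μ (y, z)) ∘ φ := by
      filter_upwards [chart_source_mem_nhds E (1 : G)] with g hg
      exact congrArg (fun h ↦ φ (φ.symm y * h)) ((chartAt E (1 : G)).left_inv hg).symm
    have c1 := mfderiv_comp (1 : G) m2 m1
    have m4 : MDifferentiableAt 𝓘(K, E) 𝓘(K, E) (fun z ↦ μ (y, z)) (φ (1 : G)) :=
      d1.differentiableAt.mdifferentiableAt
    have c2 := mfderiv_comp (1 : G) m4 m3
    have c3 : (mfderiv 𝓘(K, E) 𝓘(K, E) (φ ∘ (φ.symm y * ·)) (1 : G) u : E) =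
        dsnd K μ (y, e) u := by
      have e1 := congrArg (fun L : E →L[K] E ↦ L u)
        (heq.mfderiv_eq (I := 𝓘(K, E)) (I' := 𝓘(K, E)))
      have e2 := congrArg (fun L : E →L[K] E ↦ L u) c2
      have e3 : (mfderiv 𝓘(K, E) 𝓘(K, E) (fun z ↦ μ (y, z)) e : E →L[K] E) = dsnd K μ (y, e) :=
        mfderiv_eq_fderiv.trans d1.fderiv
      have e4 := congrArg (fun L : E →L[K] E ↦ L (mfderiv 𝓘(K, E) 𝓘(K, E) φ (1 : G) u : E)) e3
      have e5 := congrArg (fun L : E →L[K] E ↦ dsnd K μ (y, e) (L u)) id1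
      exact e1.trans (e2.trans (e4.trans e5))
    have c4 : (mfderiv 𝓘(K, E) 𝓘(K, E) φ (φ.symm y) (mulInvariantVectorField u (φ.symm y)) : E) =
        dsnd K μ (y, e) u := by
      refine Eq.trans ?_ c3
      rw [c1]
      have : ∀ (g : G) (w : E), g = φ.symm y → (mfderiv 𝓘(K, E) 𝓘(K, E) φ (φ.symm y) w : E) =
          mfderiv 𝓘(K, E) 𝓘(K, E) φ g w := by
        rintro g w rfl
        rfl
      exact this (φ.symm y * 1) _ (mul_one _)
    rw [mpullbackWithin_apply]
    refine (i1.inverse_apply_eq).2 ?_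
    refine Eq.trans ?_ (congrArg (mfderivWithin 𝓘(K, E) 𝓘(K, E) φ.symm univ y) c4)
    exact (DFunLike.congr_fun i2 (mulInvariantVectorField u (φ.symm y))).symm
  have b1 : (⁅v, w⁆ : GroupLieAlgebra 𝓘(K, E) G) = (mfderiv 𝓘(K, E) 𝓘(K, E) φ (1 : G)).inverse
      (lieBracket K (mpullbackWithin 𝓘(K, E) 𝓘(K, E) φ.symm (mulInvariantVectorField v) univ)
        (mpullbackWithin 𝓘(K, E) 𝓘(K, E) φ.symm (mulInvariantVectorField w) univ) e : E) := by
    rw [GroupLieAlgebra.bracket_def, ← mlieBracketWithin_univ, mlieBracketWithin_apply]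
    simp only [modelWithCornersSelf_coe, range_id, preimage_univ, inter_univ]
    exact congrArg (mfderiv 𝓘(K, E) 𝓘(K, E) φ (1 : G)).inverse
      (congrFun (lieBracketWithin_univ (𝕜 := K)
        (V := mpullbackWithin 𝓘(K, E) 𝓘(K, E) φ.symm (mulInvariantVectorField v) univ)
        (W := mpullbackWithin 𝓘(K, E) 𝓘(K, E) φ.symm (mulInvariantVectorField w) univ)) e)
  refine b1.trans ?_
  have b2 := Filter.EventuallyEq.lieBracket_vectorField_eq (𝕜 := K)
    (key.mono fun y hy ↦ hy v) (key.mono fun y hy ↦ hy w)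
  rw [b2]
  have b3 : (mfderiv 𝓘(K, E) 𝓘(K, E) φ (1 : G)).inverse = ContinuousLinearMap.id K E :=
    (congrArg ContinuousLinearMap.inverse id1).trans ContinuousLinearMap.inverse_id
  refine (DFunLike.congr_fun b3 _).trans ?_
  have d0 : HasFDerivAt (fun x ↦ dsnd K μ (x, e)) (fderiv K (fun x ↦ dsnd K μ (x, e)) e) e :=
    hloc.analyticAt_dsnd.differentiableAt.hasFDerivAt
  have d : ∀ u : E, HasFDerivAt (fun x ↦ dsnd K μ (x, e) u)
      ((fderiv K (fun x ↦ dsnd K μ (x, e)) e).flip u) e := by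
    intro u
    simpa using d0.clm_apply (hasFDerivAt_const u e)
  change lieBracket K (fun y ↦ dsnd K μ (y, e) (v : E)) (fun y ↦ dsnd K μ (y, e) (w : E)) e = _
  rw [lieBracket, (d v).fderiv, (d w).fderiv, hloc.dsnd_base]
  rfl

end ChartAtOne

/-! ### Contractive automorphisms: linearization and globalization -/

section ModuleTopology

open Filter

variable {K : Type*} [NontriviallyNormedField K]

theorem LinearEquiv.pow_natCast_apply {V : Type*} [AddCommGroup V] [Module K V] (A : V ≃ₗ[K] V)
    (n : ℕ) (x : V) : (A ^ (n : ℤ)) x = (A : V → V)^[n] x := by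
  induction n generalizing x with
  | zero => rfl
  | succ n ih =>
    rw [Function.iterate_succ_apply, ← ih, Nat.cast_succ, zpow_add, zpow_one]
    rfl

/-- Convergence in the module topology of a finite-dimensional space is weak convergence. -/
theorem tendsto_nhds_moduleTopology_iff {V : Type*} [AddCommGroup V] [Module K V]
    [FiniteDimensional K V] {s : ℕ → V} :
    Tendsto s atTop (@nhds V (moduleTopology K V) 0) ↔
      ∀ ℓ : V →ₗ[K] K, Tendsto (fun n ↦ ℓ (s n)) atTop (𝓝 0) := by
  let _ : TopologicalSpace V := moduleTopology K V
  have : IsModuleTopology K V := ⟨rfl⟩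
  have : ContinuousAdd V := IsModuleTopology.toContinuousAdd K V
  have : ContinuousSMul K V := IsModuleTopology.toContinuousSMul K V
  constructor
  · intro h ℓ
    have hℓ : Continuous ℓ := IsModuleTopology.continuous_of_linearMap ℓ
    simpa [Function.comp_def] using (hℓ.tendsto 0).comp h
  · intro h
    let ε := (Module.finBasis K V).equivFun
    have hε : Continuous ε.symm.toLinearMap := IsModuleTopology.continuous_of_linearMap _
    have h1 : Tendsto (fun n ↦ ε (s n)) atTop (𝓝 0) :=
      tendsto_pi_nhds.2 fun i ↦ h (LinearMap.proj i ∘ₗ ε.toLinearMap)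
    have h2 := (hε.tendsto 0).comp h1
    simpa [Function.comp_def] using h2

theorem isContractiveLieAut_iff {L : Type*} [LieRing L] [LieAlgebra K L] [FiniteDimensional K L]
    (β : L ≃ₗ⁅K⁆ L) : IsContractiveLieAut β ↔ ∀ (x : L) (ℓ : L →ₗ[K] K),
      Tendsto (fun n : ℕ ↦ ℓ ((β.toLinearEquiv ^ (n : ℤ)) x)) atTop (𝓝 0) := by
  refine forall_congr' fun x ↦ ?_
  rw [tendsto_nhds_moduleTopology_iff]
  simp only [LinearEquiv.pow_natCast_apply]
  rfl

end ModuleTopology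

section Linearization

open Filter Set

variable {K : Type*} [NontriviallyNormedField K]
  {E : Type*} [NormedAddCommGroup E] [NormedSpace K E]
  {G : Type*} [Group G] [TopologicalSpace G] [ChartedSpace E G]

theorem iterate_chartRep {f : G → G} {x : E}
    (hf : ∀ k, f^[k] ((chartAt E (1 : G)).symm x) ∈ (chartAt E (1 : G)).source)
    (hx : x ∈ (chartAt E (1 : G)).target) (k : ℕ) :
    (chartRep E E f)^[k] x = chartAt E (1 : G) (f^[k] ((chartAt E (1 : G)).symm x)) := by
  induction k with
  | zero => exact ((chartAt E (1 : G)).right_inv hx).symm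
  | succ k ih =>
    rw [Function.iterate_succ_apply', ih, chartRep, (chartAt E (1 : G)).left_inv (hf k),
      ← Function.iterate_succ_apply' f]

theorem baireSpace_chart_source {E M : Type*} [NormedAddCommGroup E] [CompleteSpace E]
    [TopologicalSpace M] [ChartedSpace E M] (g : M) : BaireSpace (chartAt E g).source :=
  have : BaireSpace (chartAt E g).target := (chartAt E g).open_target.baireSpace
  (chartAt E g).toHomeomorphSourceTarget.symm.baireSpace

theorem IsContractiveAut.exists_nhds (K E : Type*) [NontriviallyNormedField K]
    [NormedAddCommGroup E] [NormedSpace K E] [CompleteSpace E] {G : Type*} [Group G]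
    [TopologicalSpace G] [ChartedSpace E G] [LieGroup 𝓘(K, E) ω G] {α : G ≃* G}
    (hα : Continuous α) (hcon : IsContractiveAut α) {U : Set G} (hU : U ∈ 𝓝 1) :
    ∃ W ∈ 𝓝 (1 : G), ∀ x ∈ W, ∀ k, (α : G → G)^[k] x ∈ U :=
  have : IsTopologicalGroup G := topologicalGroup_of_lieGroup 𝓘(K, E) ω
  exists_nhds_forall_iterate_mem hα hcon (chartAt E (1 : G)).open_source (mem_chart_source E 1)
    (baireSpace_chart_source 1) hU

variable [LieGroup 𝓘(K, E) ω G] [CompleteSpace E]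

/-- The tangent map of a contractive automorphism is contractive, since the identity is a stable and
attracting fixed point. -/
theorem IsContractiveAut.tendsto_tangentMap [IsUltrametricDist K] [CompleteSpace K]
    [FiniteDimensional K E] {α : G ≃* G} (hα : ContMDiff 𝓘(K, E) 𝓘(K, E) ω α)
    (hcon : IsContractiveAut α) {A : E ≃ₗ[K] E}
    (hA : ∀ v : E, A v = (mfderiv 𝓘(K, E) 𝓘(K, E) α (1 : G) v : E)) (x : E) (ℓ : E →ₗ[K] K) :
    Tendsto (fun n : ℕ ↦ ℓ ((A ^ (n : ℤ)) x)) atTop (𝓝 0) := by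
  refine tendsto_zpow_of_rootNormSpace_eq_bot ?_ x ℓ
  set e : E := chartAt E (1 : G) 1 with he
  have hsource : ∀ᶠ g in 𝓝 (1 : G), g ∈ (chartAt E (1 : G)).source := chart_source_mem_nhds E 1
  have hstab1 : ∀ U ∈ 𝓝 e, ∃ W ∈ 𝓝 e, ∀ x ∈ W, x ∈ (chartAt E (1 : G)).target ∧ ∀ k,
      (α : G → G)^[k] ((chartAt E (1 : G)).symm x) ∈ (chartAt E (1 : G)).source ∧
        chartAt E (1 : G) ((α : G → G)^[k] ((chartAt E (1 : G)).symm x)) ∈ U := by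
    intro U hU
    have hU' : ∀ᶠ g in 𝓝 (1 : G), chartAt E (1 : G) g ∈ U :=
      ((chartAt E (1 : G)).continuousAt (mem_chart_source E 1)).eventually hU
    obtain ⟨W, hW, hWU⟩ := hcon.exists_nhds K E hα.continuous (hsource.and hU')
    refine ⟨_, eventually_mem_chart_target.and (tendsto_chartAt_symm.eventually hW), ?_⟩
    exact fun x hx ↦ ⟨hx.1, fun k ↦ hWU _ hx.2 k⟩
  obtain ⟨W₀, hW₀, hWit⟩ := hstab1 univ univ_mem
  have hit : ∀ x ∈ W₀, ∀ k, (chartRep E E α)^[k] x =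
      chartAt E (1 : G) ((α : G → G)^[k] ((chartAt E (1 : G)).symm x)) :=
    fun x hx k ↦ iterate_chartRep (fun k ↦ ((hWit x hx).2 k).1) (hWit x hx).1 k
  refine rootNormSpace_eq_bot_of_stable A (f := chartRep E E α) (e := e) ?_ ?_ ?_ ?_
  · rw [chartRep, he, chartAt_symm_one, map_one]
  · have h1 := (analyticAt_chartRep (map_one α) (hα 1)).differentiableAt.hasFDerivAt
    convert! h1 using 1
    ext v
    exact (hA v).trans (fderiv_chartRep (map_one α) ((hα 1).mdifferentiableAt (by simp)) v).symm
  · intro U hU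
    obtain ⟨W, hW, hWU⟩ := hstab1 U hU
    refine ⟨W ∩ W₀, inter_mem hW hW₀, fun x hx k ↦ ?_⟩
    rw [hit x hx.2]
    exact ((hWU x hx.1).2 k).2
  · filter_upwards [hW₀] with x hx
    simp only [hit x hx]
    exact ((chartAt E (1 : G)).continuousAt (mem_chart_source E 1)).tendsto.comp
      (hcon ((chartAt E (1 : G)).symm x))

end Linearization

section Globalization

open Filter

variable {G H : Type*} [Group G] [TopologicalSpace G] [Group H]

/-- A germ of a homomorphism that is compatible with contractive automorphisms extends, since every
element is moved into a given neighbourhood of the identity. -/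
theorem exists_monoidHom_of_germ [ContinuousMul G] {α : G ≃* G} {α' : H ≃* H}
    (hcon : IsContractiveAut α)
    (hstab : ∀ U ∈ 𝓝 (1 : G), ∃ W ∈ 𝓝 (1 : G), ∀ x ∈ W, ∀ k, (α : G → G)^[k] x ∈ U)
    {F : G → H} (hmul : ∀ᶠ p : G × G in 𝓝 (1, 1), F (p.1 * p.2) = F p.1 * F p.2)
    (heq : ∀ᶠ g in 𝓝 (1 : G), F (α g) = α' (F g)) :
    ∃ f : G →* H, (∀ g, α' (f g) = f (α g)) ∧ ∀ᶠ g in 𝓝 1, f g = F g := by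
  obtain ⟨W, hW, hWU⟩ := hstab _ heq
  have hFW : ∀ g ∈ W, ∀ k, (α' : H → H)^[k] (F g) = F ((α : G → G)^[k] g) := by
    intro g hg k
    induction k with
    | zero => rfl
    | succ k ih =>
      rw [Function.iterate_succ_apply', Function.iterate_succ_apply', ih]
      exact (hWU g hg k).symm
  have hinj : ∀ n, Function.Injective (α' : H → H)^[n] := fun n ↦ α'.injective.iterate n
  have hsurj : ∀ n, Function.Surjective (α' : H → H)^[n] := fun n ↦ α'.surjective.iterate n
  -- the value at `g` is the common value of `α'⁻ⁿ (F (αⁿ g))` for large `n`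
  have hex : ∀ g, ∃ h, ∀ᶠ n in atTop, (α' : H → H)^[n] h = F ((α : G → G)^[n] g) := by
    intro g
    obtain ⟨N, hN⟩ := ((hcon g).eventually hW).exists
    obtain ⟨h, hh⟩ := hsurj N (F ((α : G → G)^[N] g))
    refine ⟨h, eventually_atTop.2 ⟨N, fun n hn ↦ ?_⟩⟩
    obtain ⟨k, rfl⟩ := Nat.exists_eq_add_of_le' hn
    rw [Function.iterate_add_apply, hh, hFW _ hN, ← Function.iterate_add_apply]
  have huniq : ∀ g h h', (∀ᶠ n in atTop, (α' : H → H)^[n] h = F ((α : G → G)^[n] g)) →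
      (∀ᶠ n in atTop, (α' : H → H)^[n] h' = F ((α : G → G)^[n] g)) → h = h' := by
    intro g h h' h1 h2
    obtain ⟨n, h3, h4⟩ := (h1.and h2).exists
    exact hinj n (h3.trans h4.symm)
  choose f hf using hex
  refine ⟨MonoidHom.mk' f fun g₁ g₂ ↦ ?_, fun g ↦ ?_, ?_⟩
  · refine huniq (g₁ * g₂) _ _ (hf _) ?_
    have h1 : Tendsto (fun n ↦ ((α : G → G)^[n] g₁, (α : G → G)^[n] g₂)) atTop (𝓝 (1, 1)) :=
      (hcon g₁).prodMk_nhds (hcon g₂)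
    filter_upwards [hf g₁, hf g₂, h1.eventually hmul] with n h2 h3 h4
    rw [iterate_map_mul, iterate_map_mul, h2, h3, h4]
  · refine huniq (α g) _ _ ?_ (hf _)
    filter_upwards [(tendsto_add_atTop_nat 1).eventually (hf g)] with n hn
    rwa [Function.iterate_succ_apply, Function.iterate_succ_apply] at hn
  · filter_upwards [hW] with g hg
    exact huniq g _ _ (hf g) (Eventually.of_forall (hFW g hg))

/-- Homomorphisms compatible with contractive automorphisms are determined by their germs. -/
theorem MonoidHom.eq_of_eventuallyEq_of_contractive {α : G ≃* G} {α' : H ≃* H}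
    (hcon : IsContractiveAut α) {f₁ f₂ : G →* H} (h₁ : ∀ g, α' (f₁ g) = f₁ (α g))
    (h₂ : ∀ g, α' (f₂ g) = f₂ (α g)) (h : ∀ᶠ g in 𝓝 1, f₁ g = f₂ g) : f₁ = f₂ := by
  ext g
  obtain ⟨n, hn⟩ := ((hcon g).eventually h).exists
  have key : ∀ f : G →* H, (∀ g, α' (f g) = f (α g)) →
      (α' : H → H)^[n] (f g) = f ((α : G → G)^[n] g) := fun f hf ↦
    (Function.Semiconj.iterate_right (f := f) (fun g ↦ (hf g).symm) n g).symm
  exact α'.injective.iterate n ((key f₁ h₁).trans (hn.trans (key f₂ h₂).symm))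

/-- A homomorphism of Lie groups that is analytic at the identity is analytic. -/
theorem MonoidHom.contMDiff_of_contMDiffAt_one {K : Type*} [NontriviallyNormedField K]
    {E E' : Type*} [NormedAddCommGroup E] [NormedSpace K E] [NormedAddCommGroup E']
    [NormedSpace K E'] [ChartedSpace E G] [LieGroup 𝓘(K, E) ω G] [TopologicalSpace H]
    [ChartedSpace E' H] [LieGroup 𝓘(K, E') ω H] {f : G →* H}
    (hf : ContMDiffAt 𝓘(K, E) 𝓘(K, E') ω f 1) :
    ContMDiff 𝓘(K, E) 𝓘(K, E') ω f := by
  intro g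
  have h1 : (f : G → H) = (f g * ·) ∘ f ∘ (g⁻¹ * ·) := by
    ext x
    simp
  rw [h1]
  refine ContMDiffAt.comp g (contMDiff_mul_left (I := 𝓘(K, E')) (n := ω)).contMDiffAt
    (ContMDiffAt.comp g ?_ (contMDiff_mul_left (I := 𝓘(K, E)) (n := ω)).contMDiffAt)
  rwa [inv_mul_cancel]

end Globalization

/-! ### The functor is fully faithful -/

section FullyFaithful

open Filter

/-- The Lie bracket of a Lie group, as a bilinear map on the model space. -/
noncomputable def chartBracket (K E G : Type*) [NontriviallyNormedField K] [NormedAddCommGroup E]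
    [NormedSpace K E] [Group G] [TopologicalSpace G] [ChartedSpace E G] : E →ₗ[K] E →ₗ[K] E :=
  (localBracket K (chartMul E G) (chartAt E (1 : G) 1)).toLinearMap₁₂

section

variable {K : Type*} [NontriviallyNormedField K]
  {E : Type*} [NormedAddCommGroup E] [NormedSpace K E]
  {E' : Type*} [NormedAddCommGroup E'] [NormedSpace K E']
  {G : Type*} [Group G] [TopologicalSpace G] [ChartedSpace E G]
  {H : Type*} [Group H] [TopologicalSpace H] [ChartedSpace E' H]

theorem chartBracket_apply [CompleteSpace E] [LieGroup 𝓘(K, E) ω G]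
    (v w : GroupLieAlgebra 𝓘(K, E) G) :
    chartBracket K E G v w = (⁅v, w⁆ : GroupLieAlgebra 𝓘(K, E) G) :=
  (lie_eq_localBracket v w).symm

theorem eventually_eq_of_chartRep {f₁ f₂ : G → H} (h1 : Tendsto f₁ (𝓝 1) (𝓝 1))
    (h2 : Tendsto f₂ (𝓝 1) (𝓝 1))
    (h : ∀ᶠ x in 𝓝 (chartAt E (1 : G) 1), chartRep E E' f₁ x = chartRep E E' f₂ x) :
    ∀ᶠ g in 𝓝 1, f₁ g = f₂ g := by
  filter_upwards [chart_source_mem_nhds E (1 : G), h1.eventually (chart_source_mem_nhds E' (1 : H)),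
    h2.eventually (chart_source_mem_nhds E' (1 : H)),
    ((chartAt E (1 : G)).continuousAt (mem_chart_source E 1)).eventually h] with g hg hg1 hg2 hg3
  rw [chartRep, chartRep, (chartAt E (1 : G)).left_inv hg] at hg3
  exact (chartAt E' (1 : H)).injOn hg1 hg2 hg3

end

variable {K : Type u} [NontriviallyNormedField K] [CompleteSpace K]

/-- The linear automorphism of the model space given by `L(α)`. -/
noncomputable def CLG.tangentAut (X : CLG K) : X.E ≃ₗ[K] X.E := X.lieAut.toLinearEquiv

theorem CLG.fderiv_chartRep_aut (X : CLG K) (v : X.E) :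
    fderiv K (chartRep X.E X.E X.aut) (chartAt X.E (1 : X.G) 1) v = X.tangentAut v :=
  fderiv_chartRep (map_one X.aut) ((X.contMDiff_aut 1).mdifferentiableAt (by simp)) v

variable [IsUltrametricDist K]

theorem CLG.tendsto_tangentAut (X : CLG K) (x : X.E) (ℓ : X.E →ₗ[K] K) :
    Tendsto (fun n : ℕ ↦ ℓ ((X.tangentAut ^ (n : ℤ)) x)) atTop (𝓝 0) :=
  X.contractive.tendsto_tangentMap X.contMDiff_aut (fun _ ↦ rfl) x ℓ

theorem CLG.isContractiveLieAut_lieAut (X : CLG K) : IsContractiveLieAut X.lieAut :=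
  (isContractiveLieAut_iff _).2 X.tendsto_tangentAut

variable [CharZero K]

/-- Two Lie groups with contractive automorphisms have Lie algebras graded by derivations that every
equivariant linear map intertwines, and cocycles that integrate these derivations. -/
theorem CLG.exists_isAdCocycle (X Y : CLG K) :
    ∃ (n : ℕ) (D : Module.End K X.E) (D' : Module.End K Y.E) (C : X.E → X.E) (C' : Y.E → Y.E),
      IsPositiveGrading (chartBracket K X.E X.G) n D ∧
      IsPositiveGrading (chartBracket K Y.E Y.G) n D' ∧
      (∀ x, X.tangentAut (D x) = D (X.tangentAut x)) ∧
      (∀ x, Y.tangentAut (D' x) = D' (Y.tangentAut x)) ∧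
      (∀ φ : X.E →ₗ[K] Y.E, (∀ x, φ (X.tangentAut x) = Y.tangentAut (φ x)) →
        ∀ x, φ (D x) = D' (φ x)) ∧
      IsAdCocycle K (chartMul X.E X.G) (chartAt X.E (1 : X.G) 1)
        (Module.End.toContinuousLinearMap X.E D) C ∧
      IsAdCocycle K (chartMul Y.E Y.G) (chartAt Y.E (1 : Y.G) 1)
        (Module.End.toContinuousLinearMap Y.E D') C' := by
  let B : ∀ X : CLG K, X.E → X.E → X.E := fun X v w ↦
    Bracket.bracket (L := GroupLieAlgebra 𝓘(K, X.E) X.G) (M := GroupLieAlgebra 𝓘(K, X.E) X.G) v w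
  have hB : ∀ (X : CLG K) (v w : X.E), chartBracket K X.E X.G v w = B X v w :=
    fun X v w ↦ chartBracket_apply (G := X.G) v w
  have halt : ∀ (X : CLG K) (x : X.E), chartBracket K X.E X.G x x = 0 := by
    intro X x
    rw [hB]
    exact lie_self (L := GroupLieAlgebra 𝓘(K, X.E) X.G) x
  have hjac : ∀ (X : CLG K) (x y z : X.E), chartBracket K X.E X.G x (chartBracket K X.E X.G y z) =
      chartBracket K X.E X.G (chartBracket K X.E X.G x y) z +
        chartBracket K X.E X.G y (chartBracket K X.E X.G x z) := by
    intro X x y z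
    simp only [hB]
    exact leibniz_lie (L₁ := GroupLieAlgebra 𝓘(K, X.E) X.G)
      (L₂ := GroupLieAlgebra 𝓘(K, X.E) X.G) (M := GroupLieAlgebra 𝓘(K, X.E) X.G) x y z
  have hb : ∀ (X : CLG K) (x y : X.E), X.tangentAut (chartBracket K X.E X.G x y) =
      chartBracket K X.E X.G (X.tangentAut x) (X.tangentAut y) := by
    intro X x y
    simp only [hB]
    exact X.lieAut.map_lie x y
  obtain ⟨n, D, D', h1, h2, h3, h4, h5⟩ := exists_isPositiveGrading X.tendsto_tangentAut (halt X)
    (hjac X) (hb X) Y.tendsto_tangentAut (halt Y) (hjac Y) (hb Y)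
  obtain ⟨C, hC⟩ := (isLocalGroup_chartMul K X.E X.G).exists_isAdCocycle
    (D := Module.End.toContinuousLinearMap X.E D) h1.derivation
  obtain ⟨C', hC'⟩ := (isLocalGroup_chartMul K Y.E Y.G).exists_isAdCocycle
    (D := Module.End.toContinuousLinearMap Y.E D') h2.derivation
  exact ⟨n, D, D', C, C', h1, h2, h3, h4, h5, hC, hC'⟩

/-- The functor is faithful: in the charts given by the cocycles, a morphism is its tangent map. -/
theorem CLG.Hom.eq_of_lieMap_eq {X Y : CLG K} {f₁ f₂ : CLG.Hom X Y}
    (h : f₁.lieMap = f₂.lieMap) : f₁ = f₂ := by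
  obtain ⟨n, D, D', C, C', hD, hD', -, -, hnat, hC, hC'⟩ := X.exists_isAdCocycle Y
  obtain ⟨U, hU, hinj⟩ := hC'.exists_injOn (isLocalGroup_chartMul K Y.E Y.G) hD'
  have hfd : ∀ (f : CLG.Hom X Y) (v : X.E),
      fderiv K (chartRep X.E Y.E f.hom) (chartAt X.E (1 : X.G) 1) v = (f.lieMap v : Y.E) :=
    fun f v ↦ fderiv_chartRep f.hom.map_one ((f.contMDiff_hom 1).mdifferentiableAt (by simp)) v
  have hloc : ∀ f : CLG.Hom X Y, ∀ᶠ x in 𝓝 (chartAt X.E (1 : X.G) 1),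
      chartRep X.E Y.E f.hom x ∈ U ∧ C' (chartRep X.E Y.E f.hom x) = (f.lieMap (C x) : Y.E) := by
    intro f
    have hhom := isLocalGroupHom_chartRep f.contMDiff_hom
    have hnat' : ∀ v : X.E, (f.lieMap (D v) : Y.E) = D' (f.lieMap v) :=
      hnat (f.lieMap : GroupLieAlgebra 𝓘(K, X.E) X.G →ₗ[K] GroupLieAlgebra 𝓘(K, Y.E) Y.G)
        fun x ↦ (f.lieMap_equivariant x).symm
    have h1 := hhom.map_cocycle (isLocalGroup_chartMul K X.E X.G)
      (isLocalGroup_chartMul K Y.E Y.G) hC hC' (fun v ↦ by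
        rw [hfd, hfd]
        exact hnat' v)
    filter_upwards [hhom.tendsto.eventually hU, h1] with x hx hx'
    exact ⟨hx, hx'.trans (hfd f _)⟩
  have htend : ∀ f : CLG.Hom X Y, Tendsto f.hom (𝓝 1) (𝓝 1) := fun f ↦ by
    have := f.contMDiff_hom.continuous.tendsto 1
    rwa [f.hom.map_one] at this
  refine CLG.Hom.ext (MonoidHom.eq_of_eventuallyEq_of_contractive X.contractive f₁.equivariant
    f₂.equivariant (eventually_eq_of_chartRep (E := X.E) (E' := Y.E) (htend f₁) (htend f₂) ?_))
  filter_upwards [hloc f₁, hloc f₂] with x h1 h2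
  exact hinj h1.1 h2.1 (h1.2.trans ((congrArg (fun φ ↦ (φ (C x) : Y.E)) h).trans h2.2.symm))

/-- The functor is full: a morphism of Lie algebras integrates to a germ of a homomorphism, which is
equivariant and so extends to the whole group by contraction. -/
theorem CLG.exists_hom_lieMap_eq {X Y : CLG K}
    (φ : GroupLieAlgebra 𝓘(K, X.E) X.G →ₗ⁅K⁆ GroupLieAlgebra 𝓘(K, Y.E) Y.G)
    (hφ : ∀ x, Y.lieAut (φ x) = φ (X.lieAut x)) : ∃ f : CLG.Hom X Y, f.lieMap = φ := by
  obtain ⟨n, D, D', C, C', hD, hD', hAD, hAD', hnat, hC, hC'⟩ := X.exists_isAdCocycle Y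
  set e := chartAt X.E (1 : X.G) 1 with he
  set e' := chartAt Y.E (1 : Y.G) 1 with he'
  have hμ := isLocalGroup_chartMul K X.E X.G
  have hμ' := isLocalGroup_chartMul K Y.E Y.G
  obtain ⟨U, hU, hinj⟩ := hC'.exists_injOn hμ' hD'
  let φ' : X.E →ₗ[K] Y.E :=
    (φ : GroupLieAlgebra 𝓘(K, X.E) X.G →ₗ[K] GroupLieAlgebra 𝓘(K, Y.E) Y.G)
  have hφ' : ∀ x, φ' (X.tangentAut x) = Y.tangentAut (φ' x) := fun x ↦ (hφ x).symm
  obtain ⟨f, hf, hfφ, hCf⟩ := hC.exists_isLocalGroupHom hμ hμ' (b := chartBracket K X.E X.G)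
    (b' := chartBracket K Y.E Y.G) (fun _ _ ↦ rfl) (fun _ _ ↦ rfl) hD hD' hC' (φ := φ')
    (fun x y ↦ by
      refine (congrArg φ' (chartBracket_apply (G := X.G) x y)).trans (Eq.trans ?_
        (chartBracket_apply (G := Y.G) (φ' x) (φ' y)).symm)
      exact φ.map_lie x y) (hnat φ' hφ')
  -- the automorphisms are linear in the charts `C` and `C'`, hence commute with `f`
  have hα := isLocalGroupHom_chartRep (f := X.aut.toMonoidHom) X.contMDiff_aut
  have hα' := isLocalGroupHom_chartRep (f := Y.aut.toMonoidHom) Y.contMDiff_aut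
  have hCα := hα.map_cocycle hμ hμ hC hC fun v ↦ by
    rw [show chartRep X.E X.E X.aut.toMonoidHom = chartRep X.E X.E X.aut from rfl,
      X.fderiv_chartRep_aut, X.fderiv_chartRep_aut]
    exact hAD v
  have hCα' := hα'.map_cocycle hμ' hμ' hC' hC' fun v ↦ by
    rw [show chartRep Y.E Y.E Y.aut.toMonoidHom = chartRep Y.E Y.E Y.aut from rfl,
      Y.fderiv_chartRep_aut, Y.fderiv_chartRep_aut]
    exact hAD' v
  have hequiv : ∀ᶠ x in 𝓝 e, f (chartRep X.E X.E X.aut x) = chartRep Y.E Y.E Y.aut (f x) := by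
    filter_upwards [hCα, hf.tendsto.eventually hCα', hCf, hα.tendsto.eventually hCf,
      hα.tendsto.eventually (hf.tendsto.eventually hU),
      hf.tendsto.eventually (hα'.tendsto.eventually hU)] with x h1 h2 h3 h4 h5 h6
    refine hinj h5 h6 (h4.trans (Eq.trans ?_ h2.symm))
    rw [h1, h3]
    exact (congrArg φ' (X.fderiv_chartRep_aut _)).trans
      ((hφ' _).trans (Y.fderiv_chartRep_aut _).symm)
  -- the germ of maps from `X.G` to `Y.G`
  let F : X.G → Y.G := fun g ↦ (chartAt Y.E (1 : Y.G)).symm (f (chartAt X.E (1 : X.G) g))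
  have hφt : Tendsto (chartAt X.E (1 : X.G)) (𝓝 1) (𝓝 e) :=
    (chartAt X.E (1 : X.G)).continuousAt (mem_chart_source X.E 1)
  have htarget : ∀ᶠ x in 𝓝 e, f x ∈ (chartAt Y.E (1 : Y.G)).target :=
    hf.tendsto.eventually eventually_mem_chart_target
  have hFt : Tendsto F (𝓝 1) (𝓝 1) :=
    tendsto_chartAt_symm.comp (hf.tendsto.comp hφt)
  have hgrp : IsTopologicalGroup X.G := topologicalGroup_of_lieGroup 𝓘(K, X.E) ω
  have hgrp' : IsTopologicalGroup Y.G := topologicalGroup_of_lieGroup 𝓘(K, Y.E) ω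
  have hFmul : ∀ᶠ p : X.G × X.G in 𝓝 (1, 1), F (p.1 * p.2) = F p.1 * F p.2 := by
    have h1 : Tendsto (fun p : X.G × X.G ↦ (chartAt X.E (1 : X.G) p.1, chartAt X.E (1 : X.G) p.2))
        (𝓝 (1, 1)) (𝓝 (e, e)) :=
      (hφt.comp (continuous_fst.tendsto _)).prodMk_nhds (hφt.comp (continuous_snd.tendsto _))
    have h2 : Tendsto (fun p : X.E × X.E ↦ (f p.1, f p.2)) (𝓝 (e, e)) (𝓝 (e', e')) :=
      (hf.tendsto.comp (continuous_fst.tendsto _)).prodMk_nhds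
        (hf.tendsto.comp (continuous_snd.tendsto _))
    filter_upwards [h1.eventually hf.map_mul,
      (h2.comp h1).eventually eventually_chartAt_symm_chartMul,
      (continuousAt_fst (p := ((1 : X.G), (1 : X.G)))).eventually (chart_source_mem_nhds X.E 1),
      (continuousAt_snd (p := ((1 : X.G), (1 : X.G)))).eventually (chart_source_mem_nhds X.E 1)]
      with p h3 h4 h5 h6
    rw [chartMul, (chartAt X.E (1 : X.G)).left_inv h5, (chartAt X.E (1 : X.G)).left_inv h6] at h3
    exact (congrArg (chartAt Y.E (1 : Y.G)).symm h3).trans h4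
  have hαt' : Tendsto Y.aut (𝓝 1) (𝓝 1) := by
    have := Y.contMDiff_aut.continuous.tendsto 1
    rwa [map_one] at this
  have hFeq : ∀ᶠ g in 𝓝 (1 : X.G), F (X.aut g) = Y.aut (F g) := by
    filter_upwards [hφt.eventually hequiv, chart_source_mem_nhds X.E (1 : X.G),
      (hαt'.comp hFt).eventually (chart_source_mem_nhds Y.E (1 : Y.G))] with g h1 h2 h3
    rw [chartRep, (chartAt X.E (1 : X.G)).left_inv h2] at h1
    exact (congrArg (chartAt Y.E (1 : Y.G)).symm h1).trans ((chartAt Y.E (1 : Y.G)).left_inv h3)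
  obtain ⟨Φ, hΦ, hΦF⟩ := exists_monoidHom_of_germ X.contractive
    (fun U hU ↦ X.contractive.exists_nhds K X.E X.contMDiff_aut.continuous hU) hFmul hFeq
  have hFan : ContMDiffAt 𝓘(K, X.E) 𝓘(K, Y.E) ω F 1 := by
    have h1 : ContMDiffAt 𝓘(K, X.E) 𝓘(K, Y.E) ω f e :=
      contMDiffAt_iff_contDiffAt.2 hf.analyticAt.contDiffAt
    have h2 : ContMDiffAt 𝓘(K, Y.E) 𝓘(K, Y.E) ω (chartAt Y.E (1 : Y.G)).symm (f e) := by
      rw [hf.map_base]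
      exact contMDiffAt_chartAt_one_symm (mem_chart_target Y.E (1 : Y.G))
    exact ContMDiffAt.comp (1 : X.G) h2 (ContMDiffAt.comp (1 : X.G) h1
      (contMDiffAt_chartAt_one (mem_chart_source X.E (1 : X.G))))
  have hΦan : ContMDiff 𝓘(K, X.E) 𝓘(K, Y.E) ω Φ :=
    MonoidHom.contMDiff_of_contMDiffAt_one (hFan.congr_of_eventuallyEq hΦF)
  refine ⟨⟨Φ, hΦan, hΦ⟩, LieHom.ext fun v ↦ ?_⟩
  have h1 : chartRep X.E Y.E Φ =ᶠ[𝓝 e] f := by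
    filter_upwards [tendsto_chartAt_symm.eventually hΦF, htarget, eventually_mem_chart_target]
      with x h1 h2 h3
    rw [chartRep, h1]
    change chartAt Y.E (1 : Y.G) ((chartAt Y.E (1 : Y.G)).symm (f (chartAt X.E (1 : X.G)
      ((chartAt X.E (1 : X.G)).symm x)))) = f x
    rw [(chartAt X.E (1 : X.G)).right_inv h3, (chartAt Y.E (1 : Y.G)).right_inv h2]
  have h2 := fderiv_chartRep Φ.map_one ((hΦan 1).mdifferentiableAt (by simp)) v
  have h3 : fderiv K (chartRep X.E Y.E Φ) e = fderiv K f e := h1.fderiv_eq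
  exact h2.symm.trans ((congrArg (fun T : X.E →L[K] Y.E ↦ T v) h3).trans (hfφ v))

end FullyFaithful

/-! ### The Lie group of a graded Lie algebra -/

section GradedLieGroup

open Filter

variable {K : Type*} [NontriviallyNormedField K]
  {E : Type*} [NormedAddCommGroup E] [NormedSpace K E]
  {b : E →ₗ[K] E →ₗ[K] E} {n : ℕ} {D : Module.End K E}

/-- The Lie group of a positively graded Lie algebra. As a manifold it is the vector space `E`; an
element `c` stands for the affine map `x ↦ c + a(c) x`, where `a(c)` is the conjugator, and the
group law is composition of affine maps. -/
def GradedGroup (_h : IsPositiveGrading b n D) : Type _ := E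

namespace GradedGroup

variable {h : IsPositiveGrading b n D}

instance topologicalSpace : TopologicalSpace (GradedGroup h) := inferInstanceAs (TopologicalSpace E)

instance chartedSpace : ChartedSpace E (GradedGroup h) := inferInstanceAs (ChartedSpace E E)

variable [CompleteSpace K] [CharZero K] [FiniteDimensional K E]

theorem isInvertible_conjugatorL (h : IsPositiveGrading b n D) (c : E) :
    (conjugatorL b n D c).IsInvertible :=
  ⟨(LinearEquiv.ofInjectiveEndo _ (h.conjugator_injective c)).toContinuousLinearEquiv,
    ContinuousLinearMap.ext fun _ ↦ rfl⟩

theorem law_assoc (h : IsPositiveGrading b n D) (c c' c'' : E) :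
    c + conjugatorL b n D c c' + conjugatorL b n D (c + conjugatorL b n D c c') c'' =
      c + conjugatorL b n D c (c' + conjugatorL b n D c' c'') := by
  simp only [conjugatorL_apply]
  rw [h.conjugator_mul, map_add, add_assoc]
  rfl

omit [CharZero K] in
theorem law_zero (c : E) : c + conjugatorL b n D c 0 = c := by
  rw [map_zero, add_zero]

theorem law_inverse (h : IsPositiveGrading b n D) (c : E) :
    c + conjugatorL b n D c (-(conjugatorL b n D c).inverse c) = 0 := by
  rw [map_neg, (isInvertible_conjugatorL h c).self_apply_inverse, add_neg_cancel]

noncomputable instance group : Group (GradedGroup h) :=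
  letI : Mul (GradedGroup h) := ⟨fun c c' : E ↦ (c + conjugatorL b n D c c' : E)⟩
  letI : One (GradedGroup h) := ⟨(0 : E)⟩
  letI : Inv (GradedGroup h) := ⟨fun c : E ↦ (-(conjugatorL b n D c).inverse c : E)⟩
  Group.ofRightAxioms (law_assoc (E := E) h) (law_zero (E := E) (b := b) (n := n) (D := D))
    (law_inverse (E := E) h)

variable (b n D) in
omit [CharZero K] in
theorem contDiff_conjugatorL : ContDiff K ω (conjugatorL b n D) :=
  have : CompleteSpace E := FiniteDimensional.complete K E
  contDiff_iff_contDiffAt.2 fun c ↦ (analyticAt_conjugatorL c).contDiffAt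

omit [CharZero K] in
theorem contDiff_mul :
    ContDiff K ω (fun p : E × E ↦ p.1 + conjugatorL b n D p.1 p.2) :=
  contDiff_fst.add (((contDiff_conjugatorL b n D).comp contDiff_fst).clm_apply contDiff_snd)

instance lieGroup : LieGroup 𝓘(K, E) ω (GradedGroup h) where
  toIsManifold := inferInstanceAs (IsManifold 𝓘(K, E) ω E)
  contMDiff_mul := by
    have h1 := (contDiff_mul (b := b) (n := n) (D := D)).contMDiff
    rw [modelWithCornersSelf_prod, ← chartedSpaceSelf_prod] at h1
    exact h1
  contMDiff_inv := by
    have : CompleteSpace E := FiniteDimensional.complete K E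
    have h1 : ContDiff K ω fun c : E ↦ -(conjugatorL b n D c).inverse c := by
      refine (contDiff_iff_contDiffAt.2 fun c ↦ ContDiffAt.clm_apply ?_ contDiffAt_id).neg
      obtain ⟨ε, hε⟩ := isInvertible_conjugatorL h c
      have h2 : ContDiffAt K ω ContinuousLinearMap.inverse (conjugatorL b n D c) :=
        hε ▸ contDiffAt_map_inverse ε
      exact h2.comp c (contDiff_conjugatorL b n D).contDiffAt
    exact h1.contMDiff

theorem localBracket_apply_derivation (h : IsPositiveGrading b n D) (x y : E) :
    localBracket K (chartMul E (GradedGroup h)) (chartAt E (1 : GradedGroup h) 1) (D x) (D y) =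
      D (b x y) := by
  have h1 : ∀ c : E, dsnd K (chartMul E (GradedGroup h)) (c, 0) = conjugatorL b n D c := fun c ↦
    (hasFDerivAt_dsnd (μ := fun p : E × E ↦ p.1 + conjugatorL b n D p.1 p.2)
      (contDiff_mul.differentiable (by simp) (c, 0))).unique
      ((conjugatorL b n D c).hasFDerivAt.const_add c)
  have h2 : localBracket K (chartMul E (GradedGroup h)) (0 : E) (D x) (D y) = D (b x y) := by
    rw [localBracket_apply]
    simp only [h1]
    rw [h.fderiv_conjugatorL_zero, h.fderiv_conjugatorL_zero, h.derivation]
    have h3 : b y (D x) = -b (D x) y := by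
      have := h.alt (D x + y)
      simp only [map_add, LinearMap.add_apply, h.alt, zero_add, add_zero] at this
      exact eq_neg_of_add_eq_zero_left this
    change b x (D y) - b y (D x) = _
    rw [h3]
    abel
  exact h2

/-- The Lie algebra of the Lie group of a graded Lie algebra is this Lie algebra: the grading
operator is an isomorphism. -/
theorem lie_derivation (h : IsPositiveGrading b n D) (x y : E) :
    Bracket.bracket (L := GroupLieAlgebra 𝓘(K, E) (GradedGroup h))
      (M := GroupLieAlgebra 𝓘(K, E) (GradedGroup h)) (D x) (D y) = D (b x y) :=
  have : CompleteSpace E := FiniteDimensional.complete K E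
  (lie_eq_localBracket (G := GradedGroup h) (D x) (D y)).trans (localBracket_apply_derivation h x y)

/-- A linear automorphism respecting the bracket and the grading is an automorphism of the group. -/
noncomputable def mapEquiv (h : IsPositiveGrading b n D) (β : E ≃ₗ[K] E)
    (hb : ∀ x y, β (b x y) = b (β x) (β y)) (hD : ∀ x, β (D x) = D (β x)) :
    GradedGroup h ≃* GradedGroup h where
  toFun := β
  invFun := β.symm
  left_inv := β.symm_apply_apply
  right_inv := β.apply_symm_apply
  map_mul' (c c' : E) := (map_add β c (conjugator b n D c c')).trans
    (congrArg (fun v ↦ β c + v) (map_conjugator (φ := (β : E →ₗ[K] E)) hb hD c c'))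

end GradedGroup

end GradedLieGroup

section EssentialSurjectivity

open Filter CategoryTheory

variable {K : Type u} [NontriviallyNormedField K] [CompleteSpace K] [CharZero K]

/-- A contractive automorphism of a graded Lie algebra is a contractive automorphism of the Lie
group of this Lie algebra, whose tangent map is the given automorphism. -/
theorem IsPositiveGrading.exists_clg {E : Type u} [NormedAddCommGroup E] [NormedSpace K E]
    [FiniteDimensional K E] {b : E →ₗ[K] E →ₗ[K] E} {n : ℕ} {D : Module.End K E}
    (h : IsPositiveGrading b n D) {β : E ≃ₗ[K] E}
    (hβ : ∀ x, Tendsto (fun k : ℕ ↦ (β : E → E)^[k] x) atTop (𝓝 0))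
    (hb : ∀ x y, β (b x y) = b (β x) (β y)) (hD : ∀ x, β (D x) = D (β x)) :
    ∃ (X : CLG K) (φ : E ≃ₗ[K] GroupLieAlgebra 𝓘(K, X.E) X.G),
      (∀ x y, φ (b x y) = ⁅φ x, φ y⁆) ∧ ∀ x, φ (β x) = X.lieAut (φ x) := by
  let X : CLG K := @CLG.mk K _ E (GradedGroup h) _ _ _ GradedGroup.group
    GradedGroup.topologicalSpace GradedGroup.chartedSpace GradedGroup.lieGroup
    (GradedGroup.mapEquiv h β hb hD) β.toContinuousLinearEquiv.contDiff.contMDiff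
    β.symm.toContinuousLinearEquiv.contDiff.contMDiff hβ
  let φ : E ≃ₗ[K] GroupLieAlgebra 𝓘(K, X.E) X.G :=
    LinearEquiv.ofInjectiveEndo D h.derivation_injective
  refine ⟨X, φ, fun x y ↦ (GradedGroup.lie_derivation h x y).symm, fun x ↦ (hD x).symm.trans ?_⟩
  have h1 : mfderiv 𝓘(K, E) 𝓘(K, E) (β : E → E) (0 : E) = fderiv K (β : E → E) 0 :=
    mfderiv_eq_fderiv
  have h2 : fderiv K (β : E → E) 0 = β.toContinuousLinearEquiv :=
    β.toContinuousLinearEquiv.fderiv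
  exact (congrArg (fun T : E →L[K] E ↦ T (D x)) (h1.trans h2)).symm

variable [IsUltrametricDist K]

/-- The functor is essentially surjective. The positive grading that defines the Lie group comes
from the contractive automorphism itself. -/
theorem CLA.exists_clg (Y : CLA K) : ∃ (X : CLG K)
    (φ : Y.L ≃ₗ⁅K⁆ GroupLieAlgebra 𝓘(K, X.E) X.G), ∀ x, φ (Y.aut x) = X.lieAut (φ x) := by
  let ψ : Y.L ≃ₗ[K] (Fin (Module.finrank K Y.L) → K) := (Module.finBasis K Y.L).equivFun
  set E := Fin (Module.finrank K Y.L) → K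
  let b : E →ₗ[K] E →ₗ[K] E := LinearMap.mk₂ K (fun x y ↦ ψ ⁅ψ.symm x, ψ.symm y⁆)
    (by simp) (by simp) (by simp) (by simp)
  have hbψ : ∀ x y, b x y = ψ ⁅ψ.symm x, ψ.symm y⁆ := fun _ _ ↦ rfl
  let β : E ≃ₗ[K] E := (ψ.symm.trans Y.aut.toLinearEquiv).trans ψ
  have hβψ : ∀ x, β x = ψ (Y.aut (ψ.symm x)) := fun _ ↦ rfl
  have hit : ∀ (k : ℕ) x, (β : E → E)^[k] x = ψ ((Y.aut : Y.L → Y.L)^[k] (ψ.symm x)) := by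
    intro k x
    have h1 : Function.Semiconj ψ.symm β Y.aut := fun x ↦ by simp [hβψ]
    rw [← ψ.symm_apply_eq]
    exact h1.iterate_right k x
  have hcon : ∀ (x : E) (ℓ : E →ₗ[K] K),
      Tendsto (fun k : ℕ ↦ ℓ ((β : E → E)^[k] x)) atTop (𝓝 0) := by
    intro x ℓ
    simp only [hit]
    exact tendsto_nhds_moduleTopology_iff.1 (Y.contractive (ψ.symm x)) (ℓ ∘ₗ ψ.toLinearMap)
  have hcon' : ∀ (x : E) (ℓ : E →ₗ[K] K),
      Tendsto (fun k : ℕ ↦ ℓ ((β ^ (k : ℤ)) x)) atTop (𝓝 0) := by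
    simpa only [LinearEquiv.pow_natCast_apply] using hcon
  have halt : ∀ x, b x x = 0 := by simp [hbψ]
  have hjac : ∀ x y z, b x (b y z) = b (b x y) z + b y (b x z) := by simp [hbψ]
  have hb : ∀ x y, β (b x y) = b (β x) (β y) := fun x y ↦ by
    simp only [hbψ, hβψ, ψ.symm_apply_apply]
    exact congrArg ψ (Y.aut.map_lie _ _)
  obtain ⟨n, D, -, hD, -, hβD, -⟩ :=
    exists_isPositiveGrading hcon' halt hjac hb hcon' halt hjac hb
  obtain ⟨X, φ, hφb, hφβ⟩ := hD.exists_clg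
    (fun x ↦ tendsto_pi_nhds.2 fun i ↦ hcon x (LinearMap.proj i)) hb hβD
  have hlie : ∀ x y : Y.L, φ (ψ ⁅x, y⁆) = ⁅φ (ψ x), φ (ψ y)⁆ := fun x y ↦ by
    rw [← hφb, hbψ, ψ.symm_apply_apply, ψ.symm_apply_apply]
  exact ⟨X, { ψ.trans φ with map_lie' := fun {x y} ↦ hlie x y }, fun x ↦ by
    refine Eq.trans ?_ (hφβ (ψ x))
    rw [hβψ, ψ.symm_apply_apply]
    rfl⟩

/-- A Lie algebra isomorphism that commutes with the automorphisms is an isomorphism of pairs. -/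
def CLA.isoMk {X Y : CLA K} (φ : X.L ≃ₗ⁅K⁆ Y.L) (hφ : ∀ x, φ (X.aut x) = Y.aut (φ x)) : X ≅ Y where
  hom := CLA.Hom.mk φ fun x ↦ (hφ x).symm
  inv := CLA.Hom.mk φ.symm fun y ↦ φ.injective (by
    refine (hφ _).trans ?_
    change Y.aut (φ (φ.symm y)) = φ (φ.symm (Y.aut y))
    rw [φ.apply_symm_apply, φ.apply_symm_apply])
  hom_inv_id := CLA.Hom.ext (LieHom.ext φ.symm_apply_apply)
  inv_hom_id := CLA.Hom.ext (LieHom.ext φ.apply_symm_apply)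

end EssentialSurjectivity

open CategoryTheory in
theorem lieFunctor_isEquivalence (K : Type u) [NontriviallyNormedField K] [IsUltrametricDist K]
    [CompleteSpace K] [CharZero K] (h : ∀ X : CLG K, IsContractiveLieAut X.lieAut) :
    (lieFunctor h).IsEquivalence where
  faithful := ⟨fun hfg ↦ CLG.Hom.eq_of_lieMap_eq (congrArg CLA.Hom.hom hfg)⟩
  full := ⟨fun φ ↦
    let ⟨f, hf⟩ := CLG.exists_hom_lieMap_eq (CLA.Hom.hom φ) (CLA.Hom.equivariant φ)
    ⟨f, CLA.Hom.ext hf⟩⟩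
  essSurj := ⟨fun Y ↦
    let ⟨X, φ, hφ⟩ := Y.exists_clg
    ⟨X, ⟨(CLA.isoMk (Y := (lieFunctor h).obj X) φ hφ).symm⟩⟩⟩

theorem mainTheorem4 (K : Type u) [NontriviallyNormedField K] [IsUltrametricDist K]
    [CompleteSpace K] [CharZero K] :
    ∃ h : ∀ X : CLG K, IsContractiveLieAut X.lieAut, (lieFunctor h).IsEquivalence :=
  ⟨CLG.isContractiveLieAut_lieAut, lieFunctor_isEquivalence K _⟩
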